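/- Manifolds are finite-dimensional, Hausdorff and second countable. Let $N$ be a connected complex manifold with almost complex structure $I_0$, and let $(g_0, I_0, \omega_0)$ be a real-analytic Kähler structure on $N$: $g_0$ is a real-analytic Riemannian metric and $\omega_0$ is a closed $2$-form with $\omega_0(u,v) = g_0(I_0u, v)$. Let $f : N \to M$ be a complexification of $N$, i.e. a real-analytic embedding into a complex manifold $(M, J)$ such that $T_{f(p)}M = df(T_pN) \oplus J\,df(T_pN)$ for all $p \in N$; identify $N$ with $f(N)$. A holomorphic extension $T^c$ of a real field $T$ of bilinear forms on $N$ is a holomorphic field of complex bilinear forms on a neighbourhood of $N$ in $M$ with $f^*T^c = T$. A sufficiently small neighbourhood $U$ of $N$ in $M$ is identified, by a biholomorphism $(z,w)$ with $z\circ f = w\circ f = \mathrm{id}_N$, with an open neighbourhood of the diagonal in $N \times \overline{N}$, where $\overline N$ is $N$ with the conjugate complex structure; the canonical pair of foliations of $U$ is the pair formed by the vertical foliation $\{z = \text{const}\}$ and the horizontal foliation $\{w = \text{const}\}$, in this order. A complex bi-Lagrangian structure $(\omega, \mathcal{F}_1, \mathcal{F}_2)$ on $U$ consists of a complex symplectic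 form $\omega$ (a holomorphic closed nondegenerate $2$-form) and an ordered pair of transverse holomorphic foliations whose leaves are complex Lagrangian (isotropic for $\omega$ and half-dimensional). Its complex bi-Lagrangian metric is the holomorphic metric $g$ (holomorphic symmetric nondegenerate complex bilinear form) with $\omega(u,v) = g(Fu,v)$, where $F$ is the endomorphism of $TU$ equal to $+1$ on $T\mathcal{F}_1$ and $-1$ on $T\mathcal{F}_2$. **Theorem.** There is a connected open neighbourhood $U_0$ of $N$ in $M$ such that on every connected open set $U$ with $N \subseteq U \subseteq U_0$ there exists a unique complex bi-Lagrangian structure $(\omega, \mathcal{F}_1, \mathcal{F}_2)$ such that: (i) $\omega$ is the holomorphic extension of $\omega_0$ to $U$: $\omega = \omega_0^c$; (ii) $(\mathcal{F}_1, \mathcal{F}_2)$ is the canonical pair of foliations of $U$; (iii) $g_0$ has a holomorphic extension $g_0^c$ to $U$, and the complex bi-Lagrangian metric of $(\omega, \mathcal{F}_1, \mathcal{F}_2)$ is $g = -i\, g_0^c$. -/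

import Mathlib

open Set
open scoped Manifold ContDiff Topology

noncomputable section

/-- The real-analytic manifold underlying a complex manifold. -/
instance ComplexManifold.isManifold_real {E : Type*} [NormedAddCommGroup E] [NormedSpace ℂ E]
    {X : Type*} [TopologicalSpace X] [ChartedSpace E X] [h : IsManifold 𝓘(ℂ, E) ω X] :
    IsManifold 𝓘(ℝ, E) ω X := by
  refine isManifold_of_contDiffOn 𝓘(ℝ, E) ω X fun e e' he he' ↦ ?_
  have h1 := (contDiffGroupoid ω 𝓘(ℂ, E)).compatible he he'
  rw [contDiffGroupoid, mem_groupoid_of_pregroupoid] at h1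
  exact h1.1.restrict_scalars ℝ

section TensorFields

variable {𝕜 : Type*} [NontriviallyNormedField 𝕜]
  {E : Type*} [NormedAddCommGroup E] [NormedSpace 𝕜 E]
  {X : Type*} [TopologicalSpace X] [ChartedSpace E X]

variable (𝕜 E X) in
/-- A (not necessarily continuous) field of `𝕜`-bilinear forms on the tangent spaces of `X`. -/
abbrev BilinField : Type _ :=
  ∀ x : X, TangentSpace 𝓘(𝕜, E) x →L[𝕜] TangentSpace 𝓘(𝕜, E) x →L[𝕜] 𝕜

/-- The field `b` is an analytic section, over the set `U`, of the bundle of bilinear forms on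
the tangent bundle. For `𝕜 = ℂ` this means that `b` is holomorphic on `U`. -/
def BilinField.IsAnalyticOn [IsManifold 𝓘(𝕜, E) ω X] (b : BilinField 𝕜 E X) (U : Set X) : Prop :=
  ContMDiffOn 𝓘(𝕜, E) (𝓘(𝕜, E).prod 𝓘(𝕜, E →L[𝕜] E →L[𝕜] 𝕜)) ω
    (fun x ↦ Bundle.TotalSpace.mk' (E →L[𝕜] E →L[𝕜] 𝕜)
      (E := fun x : X ↦ TangentSpace 𝓘(𝕜, E) x →L[𝕜] TangentSpace 𝓘(𝕜, E) x →L[𝕜] 𝕜) x (b x)) U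

/-- The expression of `b` in the preferred chart at `x₀`, i.e. the pullback of `b` under the
inverse of that chart. -/
def BilinField.inChart (b : BilinField 𝕜 E X) (x₀ : X) (y : E) : E →L[𝕜] E →L[𝕜] 𝕜 :=
  let B : E →L[𝕜] E →L[𝕜] 𝕜 := b ((chartAt E x₀).symm y)
  let D : E →L[𝕜] E := mfderiv 𝓘(𝕜, E) 𝓘(𝕜, E) (chartAt E x₀).symm y
  B.bilinearComp D D

/-- The (differentiable, alternating) field `b` is a closed 2-form on `U`: in charts,
`db(u, v, w) = ∂ᵤ b(v, w) - ∂ᵥ b(u, w) + ∂_w b(u, v)` vanishes. -/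
def BilinField.IsClosedOn (b : BilinField 𝕜 E X) (U : Set X) : Prop :=
  ∀ x₀ : X, ∀ y ∈ (chartAt E x₀).target, (chartAt E x₀).symm y ∈ U → ∀ u v w : E,
    fderiv 𝕜 (b.inChart x₀) y u v w - fderiv 𝕜 (b.inChart x₀) y v u w
      + fderiv 𝕜 (b.inChart x₀) y w u v = 0

end TensorFields

section Kahler

variable (E : Type*) [NormedAddCommGroup E] [NormedSpace ℂ E]
  (N : Type*) [TopologicalSpace N] [ChartedSpace E N]

variable {E N} in
/-- The almost complex structure of a complex manifold: multiplication by `i` on the (real)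
tangent spaces. -/
def almostComplex (x : N) : TangentSpace 𝓘(ℝ, E) x →L[ℝ] TangentSpace 𝓘(ℝ, E) x :=
  (Complex.I • ContinuousLinearMap.id ℂ E : E →L[ℂ] E).restrictScalars ℝ

/-- A real-analytic Kähler structure `(g₀, I₀, ω₀)` on the complex manifold `N`, where `I₀` is the
almost complex structure of `N`: a real-analytic Riemannian metric `g₀` and a closed
2-form `ω₀` such that `ω₀(u, v) = g₀(I₀ u, v)`. -/
structure RealAnalyticKahlerStructure [IsManifold 𝓘(ℂ, E) ω N] where
  /-- the real-analytic Riemannian metric `g₀` -/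
  metric : Bundle.ContMDiffRiemannianMetric 𝓘(ℝ, E) ω E fun x : N ↦ TangentSpace 𝓘(ℝ, E) x
  /-- the Kähler form `ω₀` -/
  form : BilinField ℝ E N
  form_alt : ∀ x u, form x u u = 0
  compat : ∀ x u v, form x u v = metric.inner x (almostComplex x u) v
  form_closed : form.IsClosedOn univ

end Kahler

section Complexification

variable {E : Type*} [NormedAddCommGroup E] [NormedSpace ℂ E]
  {N : Type*} [TopologicalSpace N] [ChartedSpace E N]
  {F : Type*} [NormedAddCommGroup F] [NormedSpace ℂ F]
  {M : Type*} [TopologicalSpace M] [ChartedSpace F M]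

variable (E F) in
/-- `f : N → M` is a complexification of `N`: a real-analytic embedding whose image is a maximal
totally real submanifold, `T M = T N ⊕ J (T N)` along `N`. -/
structure IsComplexification (f : N → M) : Prop where
  analytic : ContMDiff 𝓘(ℝ, E) 𝓘(ℝ, F) ω f
  isEmbedding : Topology.IsEmbedding f
  immersion : ∀ p, Function.Injective (mfderiv 𝓘(ℝ, E) 𝓘(ℝ, F) f p)
  totallyReal : ∀ p, IsCompl
    (mfderiv 𝓘(ℝ, E) 𝓘(ℝ, F) f p).range
    ((mfderiv 𝓘(ℝ, E) 𝓘(ℝ, F) f p).range.map (almostComplex (f p)).toLinearMap)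

/-- `Tc` is, on the neighbourhood `U` of `f(N)` in `M`, a holomorphic extension of the real tensor
field `T` on `N`: `Tc` is a holomorphic field of complex bilinear forms and `f^* Tc = T`. -/
def IsHolomorphicExtension [IsManifold 𝓘(ℂ, F) ω M] (f : N → M) (U : Set M)
    (T : BilinField ℝ E N) (Tc : BilinField ℂ F M) : Prop :=
  Tc.IsAnalyticOn U ∧ ∀ p u v,
    Tc (f p) (mfderiv 𝓘(ℝ, E) 𝓘(ℝ, F) f p u) (mfderiv 𝓘(ℝ, E) 𝓘(ℝ, F) f p v) = (T p u v : ℂ)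

end Complexification

section BiLagrangian

variable {F : Type*} [NormedAddCommGroup F] [NormedSpace ℂ F]
  {M : Type*} [TopologicalSpace M] [ChartedSpace F M]

variable (F) in
/-- A holomorphic foliation of the open set `U`, given by its tangent distribution: near every
point of `U` there is a holomorphic submersion to some `ℂᵏ` such that the distribution consists of
the tangent spaces of the fibres (the fibres being the local leaves). -/
structure HolomorphicFoliation (U : Set M) where
  /-- the tangent space of the leaf through `x` -/
  tangent : ∀ x : M, Submodule ℂ (TangentSpace 𝓘(ℂ, F) x)
  integrable : ∀ x ∈ U, ∃ V ⊆ U, IsOpen V ∧ x ∈ V ∧ ∃ (k : ℕ) (p : M → (Fin k → ℂ)),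
    ContMDiffOn 𝓘(ℂ, F) 𝓘(ℂ, Fin k → ℂ) ω p V ∧
    ∀ y ∈ V, Function.Surjective (mfderiv 𝓘(ℂ, F) 𝓘(ℂ, Fin k → ℂ) p y) ∧
      tangent y = (mfderiv 𝓘(ℂ, F) 𝓘(ℂ, Fin k → ℂ) p y).ker

/-- A complex symplectic structure on `U`: a holomorphic closed nondegenerate 2-form. -/
structure IsComplexSymplecticOn [IsManifold 𝓘(ℂ, F) ω M] (σ : BilinField ℂ F M) (U : Set M) :
    Prop where
  holomorphic : σ.IsAnalyticOn U
  alt : ∀ x ∈ U, ∀ u, σ x u u = 0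
  nondegenerate : ∀ x ∈ U, ∀ u, (∀ v, σ x u v = 0) → u = 0
  closed : σ.IsClosedOn U

/-- A holomorphic metric on `U`: a holomorphic symmetric nondegenerate complex bilinear form. -/
structure IsHolomorphicMetricOn [IsManifold 𝓘(ℂ, F) ω M] (g : BilinField ℂ F M) (U : Set M) :
    Prop where
  holomorphic : g.IsAnalyticOn U
  symm : ∀ x ∈ U, ∀ u v, g x u v = g x v u
  nondegenerate : ∀ x ∈ U, ∀ u, (∀ v, g x u v = 0) → u = 0

/-- The leaves of the foliation `𝓕` are complex Lagrangian submanifolds for `σ`: they are isotropic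
and half-dimensional. -/
def HolomorphicFoliation.IsLagrangian {U : Set M} (𝓕 : HolomorphicFoliation F U)
    (σ : BilinField ℂ F M) : Prop :=
  ∀ x ∈ U, (∀ u ∈ 𝓕.tangent x, ∀ v ∈ 𝓕.tangent x, σ x u v = 0) ∧
    2 * Module.finrank ℂ (𝓕.tangent x) = Module.finrank ℂ (TangentSpace 𝓘(ℂ, F) x)

variable (F) in
/-- A complex bi-Lagrangian structure `(ω, 𝓕₁, 𝓕₂)` on the open set `U`. -/
structure ComplexBiLagrangian [IsManifold 𝓘(ℂ, F) ω M] (U : Set M) where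
  /-- the complex symplectic structure `ω` -/
  form : BilinField ℂ F M
  /-- the first foliation `𝓕₁` -/
  fol₁ : HolomorphicFoliation F U
  /-- the second foliation `𝓕₂` -/
  fol₂ : HolomorphicFoliation F U
  symplectic : IsComplexSymplecticOn form U
  lagrangian₁ : fol₁.IsLagrangian form
  lagrangian₂ : fol₂.IsLagrangian form
  transverse : ∀ x ∈ U, IsCompl (fol₁.tangent x) (fol₂.tangent x)

variable [IsManifold 𝓘(ℂ, F) ω M] {U : Set M}

/-- The para-complex structure of a complex bi-Lagrangian structure: the endomorphism of `T M`
over `U` with eigendistributions `T 𝓕₁` and `T 𝓕₂`, for the eigenvalues `1` and `-1`. -/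
def ComplexBiLagrangian.paraComplex (S : ComplexBiLagrangian F U) (x : M) (hx : x ∈ U) :
    TangentSpace 𝓘(ℂ, F) x →ₗ[ℂ] TangentSpace 𝓘(ℂ, F) x :=
  (S.fol₁.tangent x).projection _ (S.transverse x hx) -
    (S.fol₂.tangent x).projection _ (S.transverse x hx).symm

/-- `g` is the complex bi-Lagrangian metric of `S`: the holomorphic metric on `U` which is
determined by `ω(u, v) = g(F u, v)`, where `F` is the para-complex structure of `S`. -/
def ComplexBiLagrangian.IsMetric (S : ComplexBiLagrangian F U) (g : BilinField ℂ F M) : Prop :=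
  IsHolomorphicMetricOn g U ∧
    ∀ x (hx : x ∈ U), ∀ u v, S.form x u v = g x (S.paraComplex x hx u) v

/-- `S` and `S'` are the same complex bi-Lagrangian structure on `U` (the values outside of `U` of
the total functions that represent tensor fields on `U` are irrelevant). -/
def ComplexBiLagrangian.Same (S S' : ComplexBiLagrangian F U) : Prop :=
  ∀ x ∈ U, S.form x = S'.form x ∧ S.fol₁.tangent x = S'.fol₁.tangent x ∧
    S.fol₂.tangent x = S'.fol₂.tangent x

end BiLagrangian

section CanonicalFoliations

variable {E : Type*} [NormedAddCommGroup E] [NormedSpace ℂ E]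
  {N : Type*} [TopologicalSpace N] [ChartedSpace E N]
  {F : Type*} [NormedAddCommGroup F] [NormedSpace ℂ F]
  {M : Type*} [TopologicalSpace M] [ChartedSpace F M]

variable (E F) in
/-- `a` is antiholomorphic on `U`: real-analytic with complex antilinear differential. -/
def IsAntiholomorphicOn (a : M → N) (U : Set M) : Prop :=
  ContMDiffOn 𝓘(ℝ, F) 𝓘(ℝ, E) ω a U ∧
    ∀ x ∈ U, ∀ u, mfderiv 𝓘(ℝ, F) 𝓘(ℝ, E) a x (almostComplex x u) =
      -almostComplex (a x) (mfderiv 𝓘(ℝ, F) 𝓘(ℝ, E) a x u)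

variable (E F) in
/-- `(z, w) : M → N × N` restricts to a biholomorphism from the open neighbourhood `U` of `f(N)`
onto an open neighbourhood of the diagonal in the canonical complexification `N × N̄` (the second
factor carrying the conjugate complex structure), compatible with `f` and with the diagonal
embedding of `N`. -/
structure IsCanonicalModel (f : N → M) (U : Set M) (z w : M → N) : Prop where
  holomorphic : ContMDiffOn 𝓘(ℂ, F) 𝓘(ℂ, E) ω z U
  antiholomorphic : IsAntiholomorphicOn E F w U
  injOn : InjOn (fun x ↦ (z x, w x)) U
  isOpen_image : IsOpen ((fun x ↦ (z x, w x)) '' U)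
  bijective : ∀ x ∈ U, Function.Bijective fun u : TangentSpace 𝓘(ℝ, F) x ↦
    (mfderiv 𝓘(ℝ, F) 𝓘(ℝ, E) z x u, mfderiv 𝓘(ℝ, F) 𝓘(ℝ, E) w x u)
  diagonal : ∀ p, z (f p) = p ∧ w (f p) = p

/-- `(𝓕₁, 𝓕₂)` is the canonical pair of foliations of the neighbourhood `U` of `f(N)`: under the
identification of `U` with an open subset of `N × N̄`, these are the vertical foliation
`{z = const}` and the horizontal foliation `{w = const}`. -/
def IsCanonicalPair (f : N → M) {U : Set M} (𝓕₁ 𝓕₂ : HolomorphicFoliation F U) : Prop :=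
  ∃ z w : M → N, IsCanonicalModel E F f U z w ∧ ∀ x ∈ U,
    (∀ u, u ∈ 𝓕₁.tangent x ↔ mfderiv 𝓘(ℝ, F) 𝓘(ℝ, E) z x u = 0) ∧
    (∀ u, u ∈ 𝓕₂.tangent x ↔ mfderiv 𝓘(ℝ, F) 𝓘(ℝ, E) w x u = 0)

end CanonicalFoliations

end

/-! Everything is local along `N` until the gluing. The model is the totally real diagonal `u ↦ (u,
ū)` in `E × Ē`, with `Ē` replaced by `E` through an antilinear involution. Every vector of `E × E`
is uniquely `r + i s` with `r`, `s` on the diagonal. Hence a real power series on `E` extends term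
by term to a holomorphic one (`AnalyticAt.exists_extension`), and a holomorphic function vanishing
on the diagonal vanishes nearby (`eventually_eq_zero_of_diagE`).

Extending `f`, read in charts, gives a holomorphic map whose derivative is the complexification of
`df`, bijective because `N` is totally real of maximal dimension. Its local inverse is a chart `φ`
of `M` that turns `N` into the diagonal (`IsComplexification.exists_adaptedChart`), and the
components of `φ` give `z` and `w`. In this chart let `G` extend `g₀`. Symmetry, invariance under
`I₀` and closedness of `ω₀` hold on the diagonal, so they persist near it by the identity principle;
nondegeneracy is an open condition (`exists_extension_kahler`).

The complexification of `I₀` is `I(a, b) = (i a, -i b)` and the extended Kähler form is `G(I u, v)`.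
On `ker dz` one has `I = -i`, on `ker dw` one has `I = i`. If `I u = s u` and `I v = s v` with `s² =
-1`, then `G(u, v) = G(I u, I v) = -G(u, v)`, so both kernels are isotropic. As `I = -i F`, where `F
= 1` on `ker dz` and `F = -1` on `ker dw`, the form is `(-i G)(F u, v)`: this is where the factor
`-i` comes from.

Any two local models have the same germs at the points of `N`
(`IsComplexification.eventually_model_eq`), so a locally finite shrinking glues them on a
neighbourhood of `N` (`exists_glue_of_eventually_eq`), and after shrinking again `(z, w)` is
injective (`exists_isOpen_injOn`).

For uniqueness, holomorphic extensions to a connected `U` are unique by the identity theorem. The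
form and the nondegenerate metric then determine `F`, and the foliations are its eigendistributions
(`ComplexBiLagrangian.same_of_isMetric`). -/

noncomputable section

/-! ### The linear model of a complexification -/

section LinearModel

variable (E : Type*) [NormedAddCommGroup E] [NormedSpace ℂ E]

/-- A real-linear map that commutes with multiplication by `i` is complex linear. -/
def ContinuousLinearMap.ofCommI {V H : Type*} [NormedAddCommGroup V] [NormedSpace ℂ V]
    [NormedAddCommGroup H] [NormedSpace ℂ H] (L : V →L[ℝ] H)
    (h : ∀ v, L (Complex.I • v) = Complex.I • L v) : V →L[ℂ] H where
  toFun := L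
  map_add' := L.map_add
  map_smul' z v := by
    have e : z • v = z.re • v + z.im • (Complex.I • v) := by
      conv_lhs => rw [← Complex.re_add_im z, add_smul, mul_smul]
      rfl
    have e' : z • L v = z.re • L v + z.im • (Complex.I • L v) := by
      conv_lhs => rw [← Complex.re_add_im z, add_smul, mul_smul]
      rfl
    simp [e, e', h]
  cont := L.continuous

@[simp] lemma ContinuousLinearMap.ofCommI_apply {V H : Type*} [NormedAddCommGroup V]
    [NormedSpace ℂ V] [NormedAddCommGroup H] [NormedSpace ℂ H] (L : V →L[ℝ] H)
    (h : ∀ v, L (Complex.I • v) = Complex.I • L v) (v : V) : L.ofCommI h v = L v := rfl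

variable [FiniteDimensional ℂ E]

/-- An antilinear involution of a finite-dimensional complex vector space. -/
def conjE : E →L[ℝ] E :=
  let e : E ≃L[ℂ] (Fin (Module.finrank ℂ E) → ℂ) := ContinuousLinearEquiv.ofFinrankEq (by simp)
  ((e.symm : (Fin (Module.finrank ℂ E) → ℂ) →L[ℂ] E).restrictScalars ℝ).comp
    ((ContinuousLinearMap.pi fun i ↦
      (Complex.conjCLE : ℂ →L[ℝ] ℂ).comp (ContinuousLinearMap.proj i)).comp
      ((e : E →L[ℂ] (Fin (Module.finrank ℂ E) → ℂ)).restrictScalars ℝ))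

variable {E}

@[simp] lemma conjE_conjE (u : E) : conjE E (conjE E u) = u := by
  simp only [conjE, ContinuousLinearMap.comp_apply, ContinuousLinearMap.coe_restrictScalars',
    ContinuousLinearEquiv.coe_coe, ContinuousLinearEquiv.apply_symm_apply]
  rw [ContinuousLinearEquiv.symm_apply_eq]
  ext i
  simp

lemma conjE_I_smul (u : E) : conjE E (Complex.I • u) = -(Complex.I • conjE E u) := by
  simp only [conjE, ContinuousLinearMap.comp_apply, ContinuousLinearMap.coe_restrictScalars',
    ContinuousLinearEquiv.coe_coe]
  rw [ContinuousLinearEquiv.symm_apply_eq]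
  ext i
  simp

variable (E)

/-- The diagonal embedding of `E` in its canonical complexification `E × Ē ≃ E × E`. -/
def diagE : E →L[ℝ] E × E := (ContinuousLinearMap.id ℝ E).prod (conjE E)

/-- The real part of a vector of `E × Ē`, with respect to the diagonal. -/
def reV : E × E →L[ℝ] E :=
  (2⁻¹ : ℝ) • (ContinuousLinearMap.fst ℝ E E + (conjE E).comp (ContinuousLinearMap.snd ℝ E E))

/-- The imaginary part of a vector of `E × Ē`, with respect to the diagonal. -/
def imV : E × E →L[ℝ] E :=
  -- The scalar is `1 / (2i)`.
  (-(2⁻¹ * Complex.I) : ℂ) • (ContinuousLinearMap.fst ℝ E E -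
    (conjE E).comp (ContinuousLinearMap.snd ℝ E E))

/-- The complexification of the complex structure of `E`. -/
def complexI : E × E →L[ℂ] E × E :=
  (Complex.I • ContinuousLinearMap.fst ℂ E E).prod (-(Complex.I • ContinuousLinearMap.snd ℂ E E))

variable {E}

@[simp] lemma diagE_apply (u : E) : diagE E u = (u, conjE E u) := rfl

lemma reV_apply (v : E × E) : reV E v = (2⁻¹ : ℝ) • (v.1 + conjE E v.2) := rfl

lemma imV_apply (v : E × E) : imV E v = (-(2⁻¹ * Complex.I) : ℂ) • (v.1 - conjE E v.2) := rfl

omit [FiniteDimensional ℂ E] in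
@[simp] lemma complexI_apply (v : E × E) :
    complexI E v = (Complex.I • v.1, -(Complex.I • v.2)) := rfl

/-- The sign on the second factor of `complexI` is forced here: the involution is antilinear. -/
lemma complexI_diagE (u : E) : complexI E (diagE E u) = diagE E (Complex.I • u) := by
  simp [conjE_I_smul]

lemma reV_diagE (u : E) : reV E (diagE E u) = u := by
  simp only [reV_apply, diagE_apply, conjE_conjE, ← two_smul ℝ u, smul_smul]
  norm_num

lemma imV_diagE (u : E) : imV E (diagE E u) = 0 := by
  simp [imV_apply]

lemma reV_I_smul (v : E × E) : reV E (Complex.I • v) = -imV E v := by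
  simp only [reV_apply, imV_apply, Prod.smul_fst, Prod.smul_snd, conjE_I_smul, neg_smul,
    mul_smul, smul_sub, smul_add, smul_neg]
  simp only [← Complex.coe_smul]
  push_cast
  abel

lemma imV_I_smul (v : E × E) : imV E (Complex.I • v) = reV E v := by
  simp only [reV_apply, imV_apply, Prod.smul_fst, Prod.smul_snd, conjE_I_smul, sub_neg_eq_add,
    ← smul_add]
  rw [← Complex.coe_smul, smul_smul]
  congr 1
  push_cast
  linear_combination (-2⁻¹ : ℂ) * Complex.I_mul_I

/-- With `r = reV v` and `s = imV v`, one has `v.1 = r + i s` and `conjE v.2 = r - i s`. This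
splitting drives every passage from the diagonal to `E × E`. -/
lemma diagE_reV_add (v : E × E) : diagE E (reV E v) + Complex.I • diagE E (imV E v) = v := by
  have h : ∀ u : E, conjE E ((-(2⁻¹ * Complex.I) : ℂ) • u) =
      ((2⁻¹ * Complex.I) : ℂ) • conjE E u := fun u ↦ by
    have : (-(2⁻¹ * Complex.I) : ℂ) • u = (-2⁻¹ : ℝ) • (Complex.I • u) := by
      rw [← Complex.coe_smul, smul_smul]; push_cast; ring_nf
    rw [this, map_smul, conjE_I_smul, ← Complex.coe_smul, smul_neg, smul_smul, ← neg_smul]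
    push_cast; ring_nf
  have hI : Complex.I * (2⁻¹ * Complex.I) = -2⁻¹ := by
    linear_combination (2⁻¹ : ℂ) * Complex.I_mul_I
  ext
  · simp only [reV_apply, imV_apply, diagE_apply, Prod.fst_add, Prod.smul_fst, smul_smul]
    rw [← Complex.coe_smul, mul_neg, hI, neg_neg]
    push_cast
    rw [← smul_add, add_add_sub_cancel, ← two_smul ℂ v.1, smul_smul]
    norm_num
  · simp only [reV_apply, imV_apply, diagE_apply, Prod.snd_add, Prod.smul_snd, h, smul_smul,
      map_smul, map_add, map_sub, conjE_conjE]
    rw [← Complex.coe_smul, hI]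
    push_cast
    rw [neg_smul, ← sub_eq_add_neg, ← smul_sub, add_sub_sub_cancel, ← two_smul ℂ v.2, smul_smul]
    norm_num

variable {H : Type*} [NormedAddCommGroup H] [NormedSpace ℂ H]

/-- Complex linear maps that agree on the diagonal are equal. -/
lemma eq_of_diagE {L L' : E × E →L[ℂ] H} (h : ∀ u, L (diagE E u) = L' (diagE E u)) : L = L' := by
  refine ContinuousLinearMap.ext fun v ↦ ?_
  rw [← diagE_reV_add v]
  simp only [map_add, map_smul, h]

lemma bilin_eq_of_diagE {B B' : E × E →L[ℂ] E × E →L[ℂ] H}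
    (h : ∀ u v, B (diagE E u) (diagE E v) = B' (diagE E u) (diagE E v)) : B = B' :=
  eq_of_diagE fun u ↦ eq_of_diagE fun v ↦ h u v

/-- The complex linear extension of a real-linear map on the diagonal, as a linear map. -/
def complexifyₗ : (E →L[ℝ] H) →ₗ[ℝ] (E × E →L[ℂ] H) where
  toFun L := ContinuousLinearMap.ofCommI (L.comp (reV E) + Complex.I • L.comp (imV E)) fun v ↦ by
    simp only [add_apply, smul_apply, ContinuousLinearMap.comp_apply, reV_I_smul, imV_I_smul,
      map_neg, smul_add, smul_smul, Complex.I_mul_I, neg_smul, one_smul]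
    abel
  map_add' L L' := by
    refine ContinuousLinearMap.ext fun v ↦ ?_
    simp only [ContinuousLinearMap.ofCommI_apply, add_apply, smul_apply,
      ContinuousLinearMap.comp_apply, smul_add]
    abel
  map_smul' r L := by
    refine ContinuousLinearMap.ext fun v ↦ ?_
    simp [smul_comm r Complex.I]

lemma norm_complexifyₗ_le (L : E →L[ℝ] H) :
    ‖complexifyₗ L‖ ≤ (‖reV E‖ + ‖imV E‖) * ‖L‖ := by
  refine ContinuousLinearMap.opNorm_le_bound _ (by positivity) fun v ↦ ?_
  refine (norm_add_le (L (reV E v)) (Complex.I • L (imV E v))).trans ?_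
  rw [norm_smul, Complex.norm_I, one_mul]
  have h1 := (L.le_opNorm (reV E v)).trans
    (mul_le_mul_of_nonneg_left ((reV E).le_opNorm v) (norm_nonneg L))
  have h2 := (L.le_opNorm (imV E v)).trans
    (mul_le_mul_of_nonneg_left ((imV E).le_opNorm v) (norm_nonneg L))
  linarith

/-- The complex linear extension of a real-linear map on the diagonal. -/
def complexify : (E →L[ℝ] H) →L[ℝ] (E × E →L[ℂ] H) :=
  LinearMap.mkContinuous complexifyₗ (‖reV E‖ + ‖imV E‖) fun L ↦ norm_complexifyₗ_le L

lemma norm_complexify_le (L : E →L[ℝ] H) :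
    ‖complexify L‖ ≤ (‖reV E‖ + ‖imV E‖) * ‖L‖ :=
  norm_complexifyₗ_le L

lemma complexify_diagE (L : E →L[ℝ] H) (u : E) : complexify L (diagE E u) = L u := by
  change L (reV E (diagE E u)) + Complex.I • L (imV E (diagE E u)) = L u
  rw [reV_diagE, imV_diagE, map_zero, smul_zero, add_zero]

/-- The complex bilinear extension of a real bilinear form on the diagonal. -/
def complexifyBilin : (E →L[ℝ] E →L[ℝ] ℝ) →L[ℝ] (E × E →L[ℂ] E × E →L[ℂ] ℂ) :=
  complexify.comp (ContinuousLinearMap.compL ℝ E (E →L[ℝ] ℝ) (E × E →L[ℂ] ℂ)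
    (complexify.comp (ContinuousLinearMap.compL ℝ E ℝ ℂ Complex.ofRealCLM)))

lemma complexifyBilin_diagE (B : E →L[ℝ] E →L[ℝ] ℝ) (u v : E) :
    complexifyBilin B (diagE E u) (diagE E v) = (B u v : ℂ) := by
  simp only [complexifyBilin, ContinuousLinearMap.comp_apply, complexify_diagE,
    ContinuousLinearMap.compL_apply, Complex.ofRealCLM_apply]

/-- Multilinear extension from the diagonal, with exponential norm bounds. -/
lemma exists_complexifyMultilinear (n : ℕ) :
    ∃ L : (E [×n]→L[ℝ] H) →L[ℝ] ((E × E) [×n]→L[ℂ] H),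
      (∀ m, ‖L m‖ ≤ (‖reV E‖ + ‖imV E‖) ^ n * ‖m‖) ∧
      ∀ m u, L m (fun i ↦ diagE E (u i)) = m u := by
  -- One variable is curried off and complexified, the others are treated by induction. Each
  -- variable costs one factor `‖reV E‖ + ‖imV E‖`; this geometric growth keeps the radius of
  -- convergence positive.
  induction n with
  | zero =>
    let e₁ := (continuousMultilinearCurryFin0 ℝ E H).toContinuousLinearEquiv
    let e₂ := (continuousMultilinearCurryFin0 ℂ (E × E) H).symm.toContinuousLinearEquiv
    refine ⟨((e₂ : H →L[ℂ] _).restrictScalars ℝ).comp (e₁ : _ →L[ℝ] H), fun m ↦ ?_, fun m u ↦ ?_⟩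
    · have h1 : ‖e₂ (e₁ m)‖ = ‖m‖ := by
        rw [show ‖e₂ (e₁ m)‖ = ‖e₁ m‖ from
          (continuousMultilinearCurryFin0 ℂ (E × E) H).symm.norm_map _]
        exact (continuousMultilinearCurryFin0 ℝ E H).norm_map m
      simpa using h1.le
    · change m 0 = m u
      congr 1
      exact Subsingleton.elim _ _
  | succ n ih =>
    obtain ⟨L, hL, hL'⟩ := ih
    let e₁ := (continuousMultilinearCurryLeftEquiv ℝ (fun _ : Fin (n + 1) ↦ E)
      H).toContinuousLinearEquiv
    let e₂ := (continuousMultilinearCurryLeftEquiv ℂ (fun _ : Fin (n + 1) ↦ E × E)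
      H).symm.toContinuousLinearEquiv
    refine ⟨((e₂ : _ →L[ℂ] _).restrictScalars ℝ).comp (complexify.comp
      ((ContinuousLinearMap.compL ℝ E _ _ L).comp (e₁ : _ →L[ℝ] _))), fun m ↦ ?_, fun m u ↦ ?_⟩
    · have h1 : ‖e₂ (complexify (L.comp (e₁ m)))‖ = ‖complexify (L.comp (e₁ m))‖ :=
        (continuousMultilinearCurryLeftEquiv ℂ (fun _ : Fin (n + 1) ↦ E × E) H).symm.norm_map _
      have h2 : ‖e₁ m‖ = ‖m‖ :=
        (continuousMultilinearCurryLeftEquiv ℝ (fun _ : Fin (n + 1) ↦ E) H).norm_map m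
      have h3 : ‖L.comp (e₁ m)‖ ≤ (‖reV E‖ + ‖imV E‖) ^ n * ‖m‖ := by
        refine ContinuousLinearMap.opNorm_le_bound _ (by positivity) fun v ↦ ?_
        refine (hL _).trans ?_
        rw [mul_assoc, ← h2]
        gcongr
        exact (e₁ m).le_opNorm v
      refine h1.le.trans ((norm_complexify_le _).trans ?_)
      rw [pow_succ', mul_assoc]
      gcongr
    · change complexify (L.comp (e₁ m)) (diagE E (u 0)) (fun i ↦ diagE E (u i.succ)) = m u
      rw [complexify_diagE]
      change L (e₁ m (u 0)) (fun i ↦ diagE E (u i.succ)) = m u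
      rw [hL']
      change m (Fin.cons (u 0) (Fin.tail u)) = m u
      rw [Fin.cons_self_tail]

end LinearModel

/-! ### Holomorphic extension of real-analytic functions -/

section Extension

variable {E : Type*} [NormedAddCommGroup E] [NormedSpace ℂ E] [FiniteDimensional ℂ E]
  {H : Type*} [NormedAddCommGroup H] [NormedSpace ℂ H]

/-- A real-analytic function on `E` extends locally to a holomorphic function on `E × Ē`. -/
lemma AnalyticAt.exists_extension [CompleteSpace H] {h : E → H} {a : E} (ha : AnalyticAt ℝ h a) :
    ∃ k : E × E → H, AnalyticAt ℂ k (diagE E a) ∧ ∀ᶠ e in 𝓝 a, k (diagE E e) = h e := by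
  obtain ⟨p, r, hp⟩ := ha
  choose L hL hL' using fun n ↦ exists_complexifyMultilinear (E := E) (H := H) n
  -- The summand `1` keeps `C` positive when `E` is trivial.
  set C : ℝ := ‖reV E‖ + ‖imV E‖ + 1
  have hC : 0 < C := by positivity
  let q : FormalMultilinearSeries ℂ (E × E) H := fun n ↦ L n (p n)
  obtain ⟨s, hs0, hsr⟩ : ∃ s : NNReal, 0 < s ∧ (s : ENNReal) < p.radius := by
    obtain ⟨s, h1, h2⟩ := ENNReal.lt_iff_exists_nnreal_btwn.1 (hp.r_pos.trans_le hp.r_le)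
    exact ⟨s, by simpa using h1, h2⟩
  obtain ⟨K, hK0, hK⟩ := p.norm_mul_pow_le_of_lt_radius hsr
  let C' : NNReal := ⟨C, hC.le⟩
  -- The `n`-th coefficient grows by at most `C ^ n`, so dividing the radius by `C` is enough.
  have hq : ((s / C' : NNReal) : ENNReal) ≤ q.radius := by
    refine q.le_radius_of_bound K fun n ↦ ?_
    refine le_trans ?_ (hK n)
    have : ‖q n‖ ≤ C ^ n * ‖p n‖ := (hL n (p n)).trans (by gcongr; simp [C])
    calc ‖q n‖ * ((s / C' : NNReal) : ℝ) ^ n ≤ (C ^ n * ‖p n‖) * ((s / C' : NNReal) : ℝ) ^ n := by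
          gcongr
      _ = ‖p n‖ * (s : ℝ) ^ n := by
          rw [NNReal.coe_div, div_pow]
          change C ^ n * ‖p n‖ * ((s : ℝ) ^ n / C ^ n) = _
          field_simp
  have hq0 : 0 < q.radius := lt_of_lt_of_le (by
    have : 0 < s / C' := div_pos hs0 hC
    exact_mod_cast this) hq
  have hqs := q.hasFPowerSeriesOnBall hq0
  refine ⟨fun v ↦ q.sum (v - diagE E a), ?_, ?_⟩
  · have := hqs.comp_sub (diagE E a)
    rw [zero_add] at this
    exact this.analyticAt
  · have h1 : ∀ᶠ e in 𝓝 a, e ∈ Metric.eball a r := Metric.eball_mem_nhds a hp.r_pos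
    filter_upwards [h1] with e he
    have h2 := hp.hasSum_sub he
    have h3 : ∀ n, q n (fun _ ↦ diagE E e - diagE E a) = p n fun _ ↦ e - a := fun n ↦ by
      rw [← hL' n, map_sub]
    change ∑' n, q n (fun _ ↦ diagE E e - diagE E a) = h e
    simp_rw [h3]
    exact h2.tsum_eq

/-- Holomorphic functions near a point of the diagonal that vanish on the diagonal vanish near that
point, uniformly in families. -/
lemma eventually_eq_zero_of_diagE [CompleteSpace H] {ι : Type*} {h : ι → E × E → H} {a : E}
    (hd : ∀ᶠ v in 𝓝 (diagE E a), ∀ i, DifferentiableAt ℂ (h i) v)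
    (h0 : ∀ᶠ e in 𝓝 a, ∀ i, h i (diagE E e) = 0) :
    ∀ᶠ v in 𝓝 (diagE E a), ∀ i, h i v = 0 := by
  obtain ⟨R, hR, hd⟩ := Metric.eventually_nhds_iff_ball.1 hd
  obtain ⟨δ, hδ, h0⟩ := Metric.eventually_nhds_iff_ball.1 h0
  set D := ‖diagE E‖ + 1
  have hD : 0 < D := by positivity
  -- The factor `3` is `1 + 2`: one `η` for the real part, and the imaginary part times a parameter
  -- of modulus below `2`. As `η` does not depend on `i`, neither does the neighbourhood obtained.
  obtain ⟨η, hη, hη1, hη2⟩ : ∃ η : ℝ, 0 < η ∧ 3 * (D * η) < R ∧ 3 * η < δ := by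
    refine ⟨min (R / (4 * D)) (δ / 4), by positivity, ?_, ?_⟩
    · calc 3 * (D * min (R / (4 * D)) (δ / 4)) ≤ 3 * (D * (R / (4 * D))) := by
            gcongr; exact min_le_left _ _
        _ < R := by field_simp; linarith
    · have := min_le_right (R / (4 * D)) (δ / 4)
      linarith
  have e1 : ∀ᶠ v in 𝓝 (diagE E a), ‖reV E v - a‖ < η := by
    have : Filter.Tendsto (fun v ↦ ‖reV E v - a‖) (𝓝 (diagE E a)) (𝓝 ‖reV E (diagE E a) - a‖) :=
      (by fun_prop : Continuous fun v ↦ ‖reV E v - a‖).tendsto _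
    rw [reV_diagE, sub_self, norm_zero] at this
    exact this.eventually_lt_const hη
  have e2 : ∀ᶠ v in 𝓝 (diagE E a), ‖imV E v‖ < η := by
    have : Filter.Tendsto (fun v ↦ ‖imV E v‖) (𝓝 (diagE E a)) (𝓝 ‖imV E (diagE E a)‖) :=
      (by fun_prop : Continuous fun v ↦ ‖imV E v‖).tendsto _
    rw [imV_diagE, norm_zero] at this
    exact this.eventually_lt_const hη
  filter_upwards [e1, e2] with v hv1 hv2 i
  have hnorm : ∀ u : E, ‖diagE E u‖ ≤ D * ‖u‖ := fun u ↦
    ((diagE E).le_opNorm u).trans (by gcongr; simp [D])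
  -- A complex line that is on the diagonal for real `t` and passes through `v` at `t = i`. The
  -- one-variable identity theorem on the disc of radius `2`, which contains `i`, carries the
  -- vanishing from real `t` to `v`.
  let path : ℂ → E × E := fun t ↦ diagE E (reV E v) + t • diagE E (imV E v)
  have hpath : ∀ t ∈ Metric.ball (0 : ℂ) 2, path t ∈ Metric.ball (diagE E a) R := by
    intro t ht
    rw [mem_ball_zero_iff] at ht
    rw [mem_ball_iff_norm]
    have : path t - diagE E a = diagE E (reV E v - a) + t • diagE E (imV E v) := by
      simp only [path, map_sub]; abel
    rw [this]
    calc _ ≤ D * ‖reV E v - a‖ + ‖t‖ * (D * ‖imV E v‖) := by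
          refine (norm_add_le _ _).trans ?_
          rw [norm_smul]
          gcongr <;> exact hnorm _
      _ ≤ D * η + 2 * (D * η) := by gcongr
      _ < R := by linarith
  have hdiff : DifferentiableOn ℂ (fun t ↦ h i (path t)) (Metric.ball 0 2) := fun t ht ↦ by
    refine ((hd _ (hpath t ht) i).comp t ?_).differentiableWithinAt
    simp only [path]
    fun_prop
  have hzero : ∀ᶠ t : ℝ in 𝓝[≠] 0, h i (path t) = 0 := by
    have : ∀ᶠ t : ℝ in 𝓝 0, |t| < 2 := by
      have h2 := (continuous_abs (G := ℝ)).tendsto 0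
      rw [abs_zero] at h2
      exact h2.eventually_lt_const two_pos
    filter_upwards [this.filter_mono nhdsWithin_le_nhds] with t ht
    have : path t = diagE E (reV E v + t • imV E v) := by
      simp only [path, map_add, map_smul, Complex.coe_smul]
    rw [this]
    refine h0 _ ?_ i
    rw [mem_ball_iff_norm, add_sub_right_comm]
    calc _ ≤ ‖reV E v - a‖ + |t| * ‖imV E v‖ := by
          refine (norm_add_le _ _).trans ?_
          rw [norm_smul, Real.norm_eq_abs]
      _ ≤ η + 2 * η := by gcongr
      _ < δ := by linarith
  have htend : Filter.Tendsto (fun t : ℝ ↦ (t : ℂ)) (𝓝[≠] 0) (𝓝[≠] 0) := by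
    refine tendsto_nhdsWithin_iff.2 ⟨?_, ?_⟩
    · exact (Complex.continuous_ofReal.tendsto' 0 0 (by simp)).mono_left nhdsWithin_le_nhds
    · filter_upwards [self_mem_nhdsWithin] with t ht
      simpa using ht
  have hz := (hdiff.analyticOnNhd Metric.isOpen_ball).eqOn_zero_of_preconnected_of_frequently_eq_zero
    (convex_ball (0 : ℂ) 2).isPreconnected (by simp) (htend.frequently hzero.frequently)
  have hI := hz (x := Complex.I) (by simp)
  simpa only [path, diagE_reV_add, Pi.zero_apply] using hI

end Extension


/-! ### Fields of bilinear forms in charts -/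

section InChart

variable {𝕜 : Type*} [NontriviallyNormedField 𝕜]
  {E : Type*} [NormedAddCommGroup E] [NormedSpace 𝕜 E]
  {X : Type*} [TopologicalSpace X] [ChartedSpace E X]

lemma BilinField.inChart_apply (b : BilinField 𝕜 E X) (x₀ : X) (y u v : E) :
    b.inChart x₀ y u v = b ((chartAt E x₀).symm y)
      (mfderiv 𝓘(𝕜, E) 𝓘(𝕜, E) (chartAt E x₀).symm y u)
      (mfderiv 𝓘(𝕜, E) 𝓘(𝕜, E) (chartAt E x₀).symm y v) := rfl

variable [IsManifold 𝓘(𝕜, E) ω X]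

/-- The trivialization of the bundle of forms is induced by that of the tangent bundle, whose
inverse is the derivative of the inverse chart. -/
lemma BilinField.trivializationAt_eq_inChart (b : BilinField 𝕜 E X) {x₀ x : X}
    (hx : x ∈ (chartAt E x₀).source) :
    (trivializationAt (E →L[𝕜] E →L[𝕜] 𝕜)
      (fun x : X ↦ TangentSpace 𝓘(𝕜, E) x →L[𝕜] TangentSpace 𝓘(𝕜, E) x →L[𝕜] 𝕜) x₀
      ⟨x, b x⟩).2 = b.inChart x₀ (chartAt E x₀ x) := by
  have : IsManifold 𝓘(𝕜, E) 1 X := IsManifold.of_le (n := ω) le_top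
  have h := TangentBundle.symmL_trivializationAt (I := 𝓘(𝕜, E)) hx
  rw [show ((extChartAt 𝓘(𝕜, E) x₀).symm : E → X) = (chartAt E x₀).symm by ext; simp,
    show extChartAt 𝓘(𝕜, E) x₀ x = chartAt E x₀ x by simp, 
    show range 𝓘(𝕜, E) = univ by simp, mfderivWithin_univ] at h
  refine ContinuousLinearMap.ext fun u ↦ ContinuousLinearMap.ext fun v ↦ ?_
  rw [BilinField.inChart_apply, (chartAt E x₀).left_inv hx, ← h]
  have hm : x ∈ (trivializationAt (E →L[𝕜] 𝕜)
      (fun x : X ↦ TangentSpace 𝓘(𝕜, E) x →L[𝕜] 𝕜) x₀).baseSet := by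
    simpa [hom_trivializationAt_baseSet] using hx
  simp [hom_trivializationAt_apply, ContinuousLinearMap.inCoordinates,
    Bundle.Trivialization.coe_linearMapAt_of_mem _ hm]
  rfl

/-- Reduces smoothness of a bundle section to that of a function between normed spaces, where power
series and the identity theorem apply. -/
lemma BilinField.isAnalyticOn_iff {b : BilinField 𝕜 E X} {U : Set X} (hU : IsOpen U) :
    b.IsAnalyticOn U ↔ ∀ x₀ ∈ U, ContDiffAt 𝕜 ω (b.inChart x₀) (chartAt E x₀ x₀) := by
  refine forall₂_congr fun x₀ hx₀ ↦ ?_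
  refine Iff.trans ⟨fun h ↦ h.contMDiffAt (hU.mem_nhds hx₀), fun h ↦ h.contMDiffWithinAt⟩ ?_
  rw [Bundle.contMDiffAt_section]
  have hs : (chartAt E x₀).source ∈ 𝓝 x₀ :=
    (chartAt E x₀).open_source.mem_nhds (mem_chart_source E x₀)
  have ht : (chartAt E x₀).target ∈ 𝓝 (chartAt E x₀ x₀) :=
    (chartAt E x₀).open_target.mem_nhds (mem_chart_target E x₀)
  rw [Filter.EventuallyEq.contMDiffAt_iff (f := b.inChart x₀ ∘ chartAt E x₀) (by
    filter_upwards [hs] with x hx using b.trivializationAt_eq_inChart hx),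
    ← contMDiffAt_iff_contDiffAt]
  constructor
  · intro h
    have h' := (contMDiffOn_chart_symm (I := 𝓘(𝕜, E)) (n := ω) (x := x₀)).contMDiffAt ht
    rw [← (chartAt E x₀).left_inv (mem_chart_source E x₀)] at h
    refine (h.comp _ h').congr_of_eventuallyEq ?_
    filter_upwards [ht] with y hy
    simp [hy]
  · intro h
    exact h.comp _ ((contMDiffOn_chart (I := 𝓘(𝕜, E)) (n := ω) (x := x₀)).contMDiffAt hs)

end InChart

/-! ### Restriction of scalars on complex manifolds -/

section RestrictScalars

/-- The chart expression is the same function for `𝕜 = ℝ` and `𝕜 = ℂ`, so this and the next two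
lemmas reduce restriction of scalars to normed spaces. -/
lemma mdifferentiableAt_iff_chartAt {𝕜 : Type*} [NontriviallyNormedField 𝕜]
    {E : Type*} [NormedAddCommGroup E] [NormedSpace 𝕜 E]
    {X : Type*} [TopologicalSpace X] [ChartedSpace E X]
    {E' : Type*} [NormedAddCommGroup E'] [NormedSpace 𝕜 E']
    {Y : Type*} [TopologicalSpace Y] [ChartedSpace E' Y] {h : X → Y} {x : X} :
    MDifferentiableAt 𝓘(𝕜, E) 𝓘(𝕜, E') h x ↔ ContinuousAt h x ∧
      DifferentiableAt 𝕜 (chartAt E' (h x) ∘ h ∘ (chartAt E x).symm) (chartAt E x x) := by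
  rw [mdifferentiableAt_iff]
  simp [writtenInExtChartAt, extChartAt, differentiableWithinAt_univ]

lemma mfderiv_eq_chartAt {𝕜 : Type*} [NontriviallyNormedField 𝕜]
    {E : Type*} [NormedAddCommGroup E] [NormedSpace 𝕜 E]
    {X : Type*} [TopologicalSpace X] [ChartedSpace E X]
    {E' : Type*} [NormedAddCommGroup E'] [NormedSpace 𝕜 E']
    {Y : Type*} [TopologicalSpace Y] [ChartedSpace E' Y] {h : X → Y} {x : X}
    (hx : MDifferentiableAt 𝓘(𝕜, E) 𝓘(𝕜, E') h x) :
    mfderiv 𝓘(𝕜, E) 𝓘(𝕜, E') h x =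
      (fderiv 𝕜 (chartAt E' (h x) ∘ h ∘ (chartAt E x).symm) (chartAt E x x) : E →L[𝕜] E') := by
  rw [hx.mfderiv]
  simp [writtenInExtChartAt, extChartAt, fderivWithin_univ]
  rfl

lemma contMDiffAt_iff_chartAt {𝕜 : Type*} [NontriviallyNormedField 𝕜]
    {E : Type*} [NormedAddCommGroup E] [NormedSpace 𝕜 E]
    {X : Type*} [TopologicalSpace X] [ChartedSpace E X]
    {E' : Type*} [NormedAddCommGroup E'] [NormedSpace 𝕜 E']
    {Y : Type*} [TopologicalSpace Y] [ChartedSpace E' Y] {h : X → Y} {x : X} {n : WithTop ℕ∞} :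
    ContMDiffAt 𝓘(𝕜, E) 𝓘(𝕜, E') n h x ↔ ContinuousAt h x ∧
      ContDiffAt 𝕜 n (chartAt E' (h x) ∘ h ∘ (chartAt E x).symm) (chartAt E x x) := by
  rw [contMDiffAt_iff]
  simp [extChartAt, contDiffWithinAt_univ]

variable {F : Type*} [NormedAddCommGroup F] [NormedSpace ℂ F]
  {X : Type*} [TopologicalSpace X] [ChartedSpace F X]
  {E : Type*} [NormedAddCommGroup E] [NormedSpace ℂ E]
  {Y : Type*} [TopologicalSpace Y] [ChartedSpace E Y] {h : X → Y} {x : X}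

lemma MDifferentiableAt.restrictScalars_real (hx : MDifferentiableAt 𝓘(ℂ, F) 𝓘(ℂ, E) h x) :
    MDifferentiableAt 𝓘(ℝ, F) 𝓘(ℝ, E) h x := by
  rw [mdifferentiableAt_iff_chartAt] at hx ⊢
  exact ⟨hx.1, hx.2.restrictScalars ℝ⟩

lemma MDifferentiableAt.mfderiv_real_apply (hx : MDifferentiableAt 𝓘(ℂ, F) 𝓘(ℂ, E) h x)
    (u : TangentSpace 𝓘(ℂ, F) x) :
    (mfderiv 𝓘(ℝ, F) 𝓘(ℝ, E) h x u : E) = mfderiv 𝓘(ℂ, F) 𝓘(ℂ, E) h x u := by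
  rw [mfderiv_eq_chartAt hx, mfderiv_eq_chartAt hx.restrictScalars_real,
    (mdifferentiableAt_iff_chartAt.1 hx).2.fderiv_restrictScalars ℝ]
  rfl

lemma ContMDiffAt.restrictScalars_real {n : WithTop ℕ∞}
    (hx : ContMDiffAt 𝓘(ℂ, F) 𝓘(ℂ, E) n h x) : ContMDiffAt 𝓘(ℝ, F) 𝓘(ℝ, E) n h x := by
  rw [contMDiffAt_iff_chartAt] at hx ⊢
  exact ⟨hx.1, hx.2.restrict_scalars ℝ⟩

/-- The Cauchy–Riemann criterion: a derivative commuting with `i` is complex linear. -/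
lemma MDifferentiableAt.of_commutes (hx : MDifferentiableAt 𝓘(ℝ, F) 𝓘(ℝ, E) h x)
    (hI : ∀ u, mfderiv 𝓘(ℝ, F) 𝓘(ℝ, E) h x (almostComplex x u) =
      almostComplex (h x) (mfderiv 𝓘(ℝ, F) 𝓘(ℝ, E) h x u)) :
    MDifferentiableAt 𝓘(ℂ, F) 𝓘(ℂ, E) h x := by
  rw [mfderiv_eq_chartAt hx] at hI
  rw [mdifferentiableAt_iff_chartAt] at hx ⊢
  refine ⟨hx.1, (differentiableAt_iff_restrictScalars ℝ hx.2).2 ?_⟩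
  exact ⟨ContinuousLinearMap.ofCommI _ hI, rfl⟩

lemma MDifferentiableAt.mfderiv_almostComplex (hx : MDifferentiableAt 𝓘(ℂ, F) 𝓘(ℂ, E) h x)
    (u : TangentSpace 𝓘(ℝ, F) x) :
    mfderiv 𝓘(ℝ, F) 𝓘(ℝ, E) h x (almostComplex x u) =
      almostComplex (h x) (mfderiv 𝓘(ℝ, F) 𝓘(ℝ, E) h x u) := by
  have h1 := hx.mfderiv_real_apply u
  have h2 := hx.mfderiv_real_apply (almostComplex x u)
  refine h2.trans ?_
  refine ((mfderiv 𝓘(ℂ, F) 𝓘(ℂ, E) h x).map_smul Complex.I u).trans ?_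
  exact congrArg (fun v : E ↦ Complex.I • v) h1.symm

end RestrictScalars

/-! ### Pullbacks of fields of bilinear forms -/

section Pullback

lemma ContDiffAt.bilin_flip {𝕜 : Type*} [NontriviallyNormedField 𝕜]
    {W : Type*} [NormedAddCommGroup W] [NormedSpace 𝕜 W]
    {V : Type*} [NormedAddCommGroup V] [NormedSpace 𝕜 V]
    {V' : Type*} [NormedAddCommGroup V'] [NormedSpace 𝕜 V'] {n : WithTop ℕ∞}
    {A : W → V →L[𝕜] V' →L[𝕜] 𝕜} {x : W} (hA : ContDiffAt 𝕜 n A x) :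
    ContDiffAt 𝕜 n (fun x ↦ (A x).flip) x := by
  have h : IsBoundedLinearMap 𝕜 fun A : V →L[𝕜] V' →L[𝕜] 𝕜 ↦ A.flip :=
    ⟨⟨fun A B ↦ A.flip_add B, fun c A ↦ A.flip_smul c⟩, 1, one_pos, fun A ↦ by
      rw [A.opNorm_flip, one_mul]⟩
  exact (IsBoundedLinearMap.contDiff (F := V' →L[𝕜] V →L[𝕜] 𝕜) h).contDiffAt.comp x hA

/-- Composition acts on the first slot only; flipping before and after reaches the second. -/
lemma ContDiffAt.bilinearComp {𝕜 : Type*} [NontriviallyNormedField 𝕜]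
    {W : Type*} [NormedAddCommGroup W] [NormedSpace 𝕜 W]
    {V : Type*} [NormedAddCommGroup V] [NormedSpace 𝕜 V]
    {V' : Type*} [NormedAddCommGroup V'] [NormedSpace 𝕜 V'] {n : WithTop ℕ∞}
    {A : W → V →L[𝕜] V →L[𝕜] 𝕜} {D : W → V' →L[𝕜] V} {x : W} (hA : ContDiffAt 𝕜 n A x)
    (hD : ContDiffAt 𝕜 n D x) :
    ContDiffAt 𝕜 n (fun x ↦ (A x).bilinearComp (D x) (D x)) x :=
  ((hA.clm_comp hD).bilin_flip.clm_comp hD).bilin_flip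

/-- The product rule for `θ^* B`. The two terms with second derivatives of `θ` are isolated because
they cancel in the exterior derivative. -/
lemma fderiv_bilinearComp_fderiv {𝕜 : Type*} [NontriviallyNormedField 𝕜]
    {V : Type*} [NormedAddCommGroup V] [NormedSpace 𝕜 V]
    {V' : Type*} [NormedAddCommGroup V'] [NormedSpace 𝕜 V']
    {θ : V' → V} {B : V → V →L[𝕜] V →L[𝕜] 𝕜} {y : V'}
    (hθ : ContDiffAt 𝕜 2 θ y) (hB : ContDiffAt 𝕜 1 B (θ y)) (u v w : V') :
    fderiv 𝕜 (fun y ↦ (B (θ y)).bilinearComp (fderiv 𝕜 θ y) (fderiv 𝕜 θ y)) y u v w =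
      fderiv 𝕜 B (θ y) (fderiv 𝕜 θ y u) (fderiv 𝕜 θ y v) (fderiv 𝕜 θ y w) +
      B (θ y) (fderiv 𝕜 (fderiv 𝕜 θ) y u v) (fderiv 𝕜 θ y w) +
      B (θ y) (fderiv 𝕜 θ y v) (fderiv 𝕜 (fderiv 𝕜 θ) y u w) := by
  have h1 : HasFDerivAt θ (fderiv 𝕜 θ y) y := (hθ.differentiableAt (by simp)).hasFDerivAt
  have h2 : HasFDerivAt (fderiv 𝕜 θ) (fderiv 𝕜 (fderiv 𝕜 θ) y) y :=
    ((hθ.fderiv_right (m := 1) le_rfl).differentiableAt (by simp)).hasFDerivAt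
  have h3 : HasFDerivAt (fun y ↦ B (θ y)) ((fderiv 𝕜 B (θ y)).comp (fderiv 𝕜 θ y)) y :=
    HasFDerivAt.comp (g := B) y (hB.differentiableAt (by simp)).hasFDerivAt h1
  have h4 : DifferentiableAt 𝕜
      (fun y ↦ (B (θ y)).bilinearComp (fderiv 𝕜 θ y) (fderiv 𝕜 θ y)) y :=
    ((ContDiffAt.comp (g := B) y hB (hθ.of_le (by norm_num))).bilinearComp
      (hθ.fderiv_right (m := 1) le_rfl)).differentiableAt (by simp)
  have h5 : ∀ v : V', HasFDerivAt (fun y ↦ fderiv 𝕜 θ y v)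
      ((fderiv 𝕜 (fderiv 𝕜 θ) y).flip v) y := fun v ↦ by
    simpa using h2.clm_apply (hasFDerivAt_const v y)
  have h6 := ((h3.clm_apply (h5 v)).clm_apply (h5 w)).fderiv
  have h7 : fderiv 𝕜 (fun y ↦ (B (θ y)).bilinearComp (fderiv 𝕜 θ y) (fderiv 𝕜 θ y)) y u v w =
      fderiv 𝕜 (fun y ↦ B (θ y) (fderiv 𝕜 θ y v) (fderiv 𝕜 θ y w)) y u := by
    have h8 := ((h4.hasFDerivAt.clm_apply (hasFDerivAt_const v y)).clm_apply
      (hasFDerivAt_const w y)).fderiv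
    change _ = fderiv 𝕜 (fun y ↦ (B (θ y)).bilinearComp (fderiv 𝕜 θ y) (fderiv 𝕜 θ y) v w) y u
    rw [h8]
    simp
  rw [h7, h6]
  simp only [add_apply, ContinuousLinearMap.comp_apply, ContinuousLinearMap.flip_apply]
  abel

variable {F : Type*} [NormedAddCommGroup F] [NormedSpace ℂ F]
  {M : Type*} [TopologicalSpace M] [ChartedSpace F M]
  {V : Type*} [NormedAddCommGroup V] [NormedSpace ℂ V]

/-- The pullback of a field of bilinear forms on a vector space. -/
def BilinField.pullback (φ : M → V) (B : V → V →L[ℂ] V →L[ℂ] ℂ) : BilinField ℂ F M := fun x ↦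
  let D : F →L[ℂ] V := mfderiv 𝓘(ℂ, F) 𝓘(ℂ, V) φ x
  ((B (φ x)).bilinearComp D D : F →L[ℂ] F →L[ℂ] ℂ)

variable [IsManifold 𝓘(ℂ, F) ω M]

lemma BilinField.inChart_pullback {φ : M → V} (B : V → V →L[ℂ] V →L[ℂ] ℂ) {x₀ : M} {y : F}
    (hy : y ∈ (chartAt F x₀).target)
    (hφ : MDifferentiableAt 𝓘(ℂ, F) 𝓘(ℂ, V) φ ((chartAt F x₀).symm y)) :
    (BilinField.pullback φ B : BilinField ℂ F M).inChart x₀ y =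
      (B (φ ((chartAt F x₀).symm y))).bilinearComp (fderiv ℂ (φ ∘ (chartAt F x₀).symm) y)
        (fderiv ℂ (φ ∘ (chartAt F x₀).symm) y) := by
  have h1 : MDifferentiableAt 𝓘(ℂ, F) 𝓘(ℂ, F) (chartAt F x₀).symm y :=
    ((contMDiffOn_chart_symm (I := 𝓘(ℂ, F)) (n := ω) (x := x₀)).contMDiffAt
      ((chartAt F x₀).open_target.mem_nhds hy)).mdifferentiableAt (by simp)
  rw [← mfderiv_eq_fderiv, mfderiv_comp y hφ h1]
  rfl

lemma contDiffAt_comp_chartAt_symm {φ : M → V} {x₀ : M} {y : F}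
    (hy : y ∈ (chartAt F x₀).target)
    (hφ : ContMDiffAt 𝓘(ℂ, F) 𝓘(ℂ, V) ω φ ((chartAt F x₀).symm y)) :
    ContDiffAt ℂ ω (φ ∘ (chartAt F x₀).symm) y := by
  rw [← contMDiffAt_iff_contDiffAt]
  exact hφ.comp y ((contMDiffOn_chart_symm (I := 𝓘(ℂ, F)) (n := ω) (x := x₀)).contMDiffAt
      ((chartAt F x₀).open_target.mem_nhds hy))

lemma BilinField.pullback_isAnalyticOn {φ : M → V} {B : V → V →L[ℂ] V →L[ℂ] ℂ} {W : Set M}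
    (hW : IsOpen W) (hφ : ContMDiffOn 𝓘(ℂ, F) 𝓘(ℂ, V) ω φ W)
    (hB : ∀ x ∈ W, ContDiffAt ℂ ω B (φ x)) :
    (BilinField.pullback φ B : BilinField ℂ F M).IsAnalyticOn W := by
  rw [BilinField.isAnalyticOn_iff hW]
  intro x₀ hx₀
  have hx : (chartAt F x₀).symm (chartAt F x₀ x₀) = x₀ :=
    (chartAt F x₀).left_inv (mem_chart_source F x₀)
  have hy := mem_chart_target F x₀
  have hyW : (chartAt F x₀).symm (chartAt F x₀ x₀) ∈ W := hx.symm ▸ hx₀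
  have hθ := contDiffAt_comp_chartAt_symm hy (hφ.contMDiffAt (hW.mem_nhds hyW))
  set θ := φ ∘ (chartAt F x₀).symm
  have hev : (BilinField.pullback φ B : BilinField ℂ F M).inChart x₀ =ᶠ[𝓝 (chartAt F x₀ x₀)]
      fun y ↦ (B (θ y)).bilinearComp (fderiv ℂ θ y) (fderiv ℂ θ y) := by
    filter_upwards [((chartAt F x₀).isOpen_inter_preimage_symm hW).mem_nhds ⟨hy, hyW⟩] with y' hy'
    exact BilinField.inChart_pullback B hy'.1
      ((hφ.contMDiffAt (hW.mem_nhds hy'.2)).mdifferentiableAt (by simp))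
  refine ContDiffAt.congr_of_eventuallyEq ?_ hev
  have h2 : ContDiffAt ℂ ω (fderiv ℂ θ) (chartAt F x₀ x₀) := hθ.fderiv_right le_rfl
  have h3 : ContDiffAt ℂ ω (fun y ↦ B (θ y)) (chartAt F x₀ x₀) :=
    ContDiffAt.comp (g := B) _ (hB _ hyW) hθ
  exact h3.bilinearComp h2

/-- Exterior differentiation commutes with pullback: of the six second-order terms, two pairs cancel
by symmetry of the second derivative and one by this symmetry together with antisymmetry of `B`. -/
lemma BilinField.pullback_isClosedOn {φ : M → V} {B : V → V →L[ℂ] V →L[ℂ] ℂ} {W : Set M}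
    (hW : IsOpen W) (hφ : ContMDiffOn 𝓘(ℂ, F) 𝓘(ℂ, V) ω φ W)
    (hB : ∀ x ∈ W, ContDiffAt ℂ 1 B (φ x)) (halt : ∀ x ∈ W, ∀ u, B (φ x) u u = 0)
    (hcl : ∀ x ∈ W, ∀ u v w, fderiv ℂ B (φ x) u v w - fderiv ℂ B (φ x) v u w +
      fderiv ℂ B (φ x) w u v = 0) :
    (BilinField.pullback φ B : BilinField ℂ F M).IsClosedOn W := by
  intro x₀ y hy hyW u v w
  have hφ' := hφ.contMDiffAt (hW.mem_nhds hyW)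
  have hθ := contDiffAt_comp_chartAt_symm hy hφ'
  set θ := φ ∘ (chartAt F x₀).symm
  have hev : (BilinField.pullback φ B : BilinField ℂ F M).inChart x₀ =ᶠ[𝓝 y]
      fun y ↦ (B (θ y)).bilinearComp (fderiv ℂ θ y) (fderiv ℂ θ y) := by
    filter_upwards [((chartAt F x₀).isOpen_inter_preimage_symm hW).mem_nhds ⟨hy, hyW⟩] with y' hy'
    exact BilinField.inChart_pullback B hy'.1
      ((hφ.contMDiffAt (hW.mem_nhds hy'.2)).mdifferentiableAt (by simp))
  have hsymm : ∀ u v, fderiv ℂ (fderiv ℂ θ) y u v = fderiv ℂ (fderiv ℂ θ) y v u :=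
    fun u v ↦ hθ.isSymmSndFDerivAt (by simp) u v
  have hanti : ∀ a b, B (θ y) a b = -B (θ y) b a := fun a b ↦ by
    have := halt _ hyW (a + b)
    have h1 := halt _ hyW a
    have h2 := halt _ hyW b
    simp only [map_add, add_apply] at this
    change B (θ y) a a = 0 at h1
    change B (θ y) b b = 0 at h2
    change B (θ y) a a + B (θ y) b a + (B (θ y) a b + B (θ y) b b) = 0 at this
    linear_combination this - h1 - h2
  have h2 : ContDiffAt ℂ 2 θ y := hθ.of_le le_top
  rw [hev.fderiv_eq, fderiv_bilinearComp_fderiv h2 (hB _ hyW), fderiv_bilinearComp_fderiv h2 (hB _ hyW),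
    fderiv_bilinearComp_fderiv h2 (hB _ hyW)]
  have := hcl _ hyW (fderiv ℂ θ y u) (fderiv ℂ θ y v) (fderiv ℂ θ y w)
  rw [hsymm v u, hsymm w u, hsymm w v, hanti (fderiv ℂ θ y v) (fderiv ℂ (fderiv ℂ θ) y u w)]
  change fderiv ℂ B (θ y) _ _ _ - fderiv ℂ B (θ y) _ _ _ + fderiv ℂ B (θ y) _ _ _ = 0 at this
  linear_combination this

end Pullback


/-! ### Derivatives of operator-valued maps evaluated at fixed vectors -/

section

variable {𝕜 : Type*} [NontriviallyNormedField 𝕜] {V W H₁ : Type*}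
  [NormedAddCommGroup V] [NormedSpace 𝕜 V] [NormedAddCommGroup W] [NormedSpace 𝕜 W]
  [NormedAddCommGroup H₁] [NormedSpace 𝕜 H₁] {x : V}

lemma HasFDerivAt.clm_apply₂ {B : V → W →L[𝕜] W →L[𝕜] H₁} {B'} (hB : HasFDerivAt B B' x) (u v : W) :
    HasFDerivAt (fun x ↦ B x u v) ((B'.flip u).flip v) x := by
  simpa using (hB.clm_apply (hasFDerivAt_const u x)).clm_apply (hasFDerivAt_const v x)

lemma DifferentiableAt.clm_apply₂ {B : V → W →L[𝕜] W →L[𝕜] H₁} (hB : DifferentiableAt 𝕜 B x)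
    (u v : W) : DifferentiableAt 𝕜 (fun x ↦ B x u v) x :=
  (hB.hasFDerivAt.clm_apply₂ u v).differentiableAt

lemma DifferentiableAt.clm_apply₃ {B : V → W →L[𝕜] W →L[𝕜] W →L[𝕜] H₁}
    (hB : DifferentiableAt 𝕜 B x) (u v w : W) : DifferentiableAt 𝕜 (fun x ↦ B x u v w) x :=
  (hB.clm_apply₂ u v).clm_apply (differentiableAt_const w)

end

/-! ### Holomorphic extension of Kähler metrics in coordinates -/

section KahlerCoordinates

variable {E : Type*} [NormedAddCommGroup E] [NormedSpace ℂ E] [FiniteDimensional ℂ E]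

/-- Multiplication by `i`, as a real-linear map. -/
def mulI (E : Type*) [NormedAddCommGroup E] [NormedSpace ℂ E] : E →L[ℝ] E :=
  (Complex.I • ContinuousLinearMap.id ℂ E).restrictScalars ℝ

omit [FiniteDimensional ℂ E] in
@[simp] lemma mulI_apply (u : E) : mulI E u = Complex.I • u := rfl

/-- Pairing `u = r + i s` with a diagonal vector `w` gives `B(r, w) + i B(s, w) = 0` with both
values real. Taking `w = r` and `w = s`, positivity gives `r = s = 0`. -/
lemma complexifyBilin_nondegenerate {B : E →L[ℝ] E →L[ℝ] ℝ} (hB : ∀ u, u ≠ 0 → 0 < B u u)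
    {u : E × E} (hu : ∀ v, complexifyBilin B u v = 0) : u = 0 := by
  have key : ∀ w, B (reV E u) w = 0 ∧ B (imV E u) w = 0 := fun w ↦ by
    have h := hu (diagE E w)
    rw [← diagE_reV_add u, map_add, map_smul, add_apply,
      smul_apply, complexifyBilin_diagE, complexifyBilin_diagE] at h
    have h1 := congrArg Complex.re h
    have h2 := congrArg Complex.im h
    simpa using And.intro h1 h2
  have h1 : reV E u = 0 := by
    by_contra h
    exact (hB _ h).ne' (key _).1
  have h2 : imV E u = 0 := by
    by_contra h
    exact (hB _ h).ne' (key _).2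
  rw [← diagE_reV_add u, h1, h2]
  simp

lemma HasFDerivAt.comp_diagE {H : Type*} [NormedAddCommGroup H] [NormedSpace ℂ H]
    {k : E × E → H} {k' : E × E →L[ℂ] H} {e : E} (h : HasFDerivAt k k' (diagE E e)) :
    HasFDerivAt (fun e ↦ k (diagE E e)) ((k'.restrictScalars ℝ).comp (diagE E)) e :=
  HasFDerivAt.comp (g := k) e (h.restrictScalars ℝ) (diagE E).hasFDerivAt

/-- The exterior derivative of the extended form is holomorphic. On the diagonal, applied to
diagonal vectors, it is that of the real form, which vanishes; trilinearity frees the vectors and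
the identity principle frees the base point. -/
lemma eventually_closed_extension {g : E → E →L[ℝ] E →L[ℝ] ℝ} {a : E}
    {G : E × E → E × E →L[ℂ] E × E →L[ℂ] ℂ} (hg : AnalyticAt ℝ g a)
    (hG : AnalyticAt ℂ G (diagE E a))
    (hGe' : ∀ᶠ e in 𝓝 a, ∀ u v, G (diagE E e) (diagE E u) (diagE E v) = (g e u v : ℂ))
    (hclosed : ∀ᶠ e in 𝓝 a, ∀ u v w : E,
      fderiv ℝ (fun e ↦ (g e).comp (mulI E)) e u v w -
        fderiv ℝ (fun e ↦ (g e).comp (mulI E)) e v u w +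
        fderiv ℝ (fun e ↦ (g e).comp (mulI E)) e w u v = 0) :
    ∀ᶠ x in 𝓝 (diagE E a), ∀ i : (E × E) × (E × E) × (E × E),
      fderiv ℂ (fun x ↦ (G x).comp (complexI E)) x i.1 i.2.1 i.2.2 -
        fderiv ℂ (fun x ↦ (G x).comp (complexI E)) x i.2.1 i.1 i.2.2 +
        fderiv ℂ (fun x ↦ (G x).comp (complexI E)) x i.2.2 i.1 i.2.1 = 0 := by
  set Ω : E × E → E × E →L[ℂ] E × E →L[ℂ] ℂ := fun x ↦ (G x).comp (complexI E)
  have hΩan : ∀ᶠ x in 𝓝 (diagE E a), AnalyticAt ℂ Ω x := by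
    filter_upwards [hG.eventually_analyticAt] with x hx
    exact (hx.contDiffAt.clm_comp contDiffAt_const : ContDiffAt ℂ ω Ω x).analyticAt
  refine eventually_eq_zero_of_diagE (h := fun (i : (E × E) × (E × E) × (E × E)) x ↦ fderiv ℂ Ω x i.1 i.2.1 i.2.2 -
    fderiv ℂ Ω x i.2.1 i.1 i.2.2 + fderiv ℂ Ω x i.2.2 i.1 i.2.1) ?_ ?_
  · filter_upwards [hΩan] with x hx i
    have := hx.fderiv.differentiableAt
    exact ((this.clm_apply₃ _ _ _).sub (this.clm_apply₃ _ _ _)).add (this.clm_apply₃ _ _ _)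
  · have hdiag : Filter.Tendsto (diagE E) (𝓝 a) (𝓝 (diagE E a)) := (diagE E).continuous.tendsto a
    filter_upwards [hdiag.eventually hΩan, hGe'.eventually_nhds, hclosed,
      hg.eventually_analyticAt] with e hΩe hev hcl hge
    -- Both sides differentiate the same function of `e`; only derivatives along the diagonal can be
    -- compared this way.
    have key : ∀ u v w : E, fderiv ℂ Ω (diagE E e) (diagE E u) (diagE E v) (diagE E w) =
        (fderiv ℝ (fun e ↦ (g e).comp (mulI E)) e u v w : ℂ) := by
      intro u v w
      have hΩd : HasFDerivAt Ω (fderiv ℂ Ω (diagE E e)) (diagE E e) :=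
        hΩe.differentiableAt.hasFDerivAt
      have h1 : HasFDerivAt (fun e ↦ Ω (diagE E e) (diagE E v) (diagE E w)) _ e :=
        (hΩd.clm_apply₂ (diagE E v) (diagE E w)).comp_diagE
      have hgd : HasFDerivAt (fun e ↦ (g e).comp (mulI E))
          (fderiv ℝ (fun e ↦ (g e).comp (mulI E)) e) e :=
        (hge.differentiableAt.clm_comp (differentiableAt_const _)).hasFDerivAt
      have h2 : HasFDerivAt (fun e ↦ ((g e (mulI E v) w : ℝ) : ℂ)) _ e :=
        HasFDerivAt.comp (g := Complex.ofRealCLM) e (Complex.ofRealCLM.hasFDerivAt)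
          (hgd.clm_apply₂ v w)
      have h3 := (h1.congr_of_eventuallyEq (f₁ := fun e ↦ ((g e (mulI E v) w : ℝ) : ℂ)) (by
        filter_upwards [hev] with e' he'
        simp only [Ω, ContinuousLinearMap.comp_apply, complexI_diagE]
        exact (he' _ _).symm)).unique h2
      exact congrArg (fun L ↦ L u) h3
    rintro ⟨u, v, w⟩
    set D := fderiv ℂ Ω (diagE E e)
    -- From here the arguments are released from the diagonal one at a time, by complex linearity.
    have h0 : ∀ u v w : E, D (diagE E u) (diagE E v) (diagE E w) -
        D (diagE E v) (diagE E u) (diagE E w) + D (diagE E w) (diagE E u) (diagE E v) = 0 :=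
      fun u v w ↦ by
        rw [key, key, key]
        exact_mod_cast hcl u v w
    have h1 : ∀ (u v : E) (w : E × E), D (diagE E u) (diagE E v) w -
        D (diagE E v) (diagE E u) w + D w (diagE E u) (diagE E v) = 0 := fun u v w ↦ by
      rw [← diagE_reV_add w]
      simp only [map_add, map_smul, add_apply, smul_apply, smul_eq_mul]
      linear_combination h0 u v (reV E w) + Complex.I * h0 u v (imV E w)
    have h2 : ∀ (u : E) (v w : E × E), D (diagE E u) v w -
        D v (diagE E u) w + D w (diagE E u) v = 0 := fun u v w ↦ by
      rw [← diagE_reV_add v]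
      simp only [map_add, map_smul, add_apply, smul_apply, smul_eq_mul]
      linear_combination h1 u (reV E v) w + Complex.I * h1 u (imV E v) w
    change D u v w - D v u w + D w u v = 0
    rw [← diagE_reV_add u]
    simp only [map_add, map_smul, add_apply, smul_apply, smul_eq_mul]
    linear_combination h2 (reV E u) v w + Complex.I * h2 (imV E u) v w

/-- The identities spread from the diagonal by the identity principle. The vectors serve as the
index of the family, so that one neighbourhood works for all of them. -/
lemma exists_extension_kahler {g : E → E →L[ℝ] E →L[ℝ] ℝ} {a : E} (hg : AnalyticAt ℝ g a)
    (hsymm : ∀ᶠ e in 𝓝 a, ∀ u v, g e u v = g e v u)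
    (hinv : ∀ᶠ e in 𝓝 a, ∀ u v : E, g e (Complex.I • u) (Complex.I • v) = g e u v)
    (hpos : ∀ u, u ≠ 0 → 0 < g a u u)
    (hclosed : ∀ᶠ e in 𝓝 a, ∀ u v w : E,
      fderiv ℝ (fun e ↦ (g e).comp (mulI E)) e u v w -
        fderiv ℝ (fun e ↦ (g e).comp (mulI E)) e v u w +
        fderiv ℝ (fun e ↦ (g e).comp (mulI E)) e w u v = 0) :
    ∃ G : E × E → E × E →L[ℂ] E × E →L[ℂ] ℂ,
      (∀ᶠ e in 𝓝 a, ∀ u v, G (diagE E e) (diagE E u) (diagE E v) = (g e u v : ℂ)) ∧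
      ∀ᶠ x in 𝓝 (diagE E a), AnalyticAt ℂ G x ∧ (∀ u v, G x u v = G x v u) ∧
        (∀ u v, G x (complexI E u) (complexI E v) = G x u v) ∧
        (∀ u, (∀ v, G x u v = 0) → u = 0) ∧
        ∀ u v w, fderiv ℂ (fun x ↦ (G x).comp (complexI E)) x u v w -
          fderiv ℂ (fun x ↦ (G x).comp (complexI E)) x v u w +
          fderiv ℂ (fun x ↦ (G x).comp (complexI E)) x w u v = 0 := by
  have hc : AnalyticAt ℝ (complexifyBilin (E := E)) (g a) := ContinuousLinearMap.analyticAt _ _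
  have hga : AnalyticAt ℝ (fun e ↦ complexifyBilin (g e)) a := hc.comp hg
  obtain ⟨G, hG, hGe⟩ :=
    AnalyticAt.exists_extension (H := E × E →L[ℂ] E × E →L[ℂ] ℂ) hga
  have hGan := hG.eventually_analyticAt
  have hGd : ∀ᶠ x in 𝓝 (diagE E a), DifferentiableAt ℂ G x :=
    hGan.mono fun x hx ↦ hx.differentiableAt
  have hGe' : ∀ᶠ e in 𝓝 a, ∀ u v, G (diagE E e) (diagE E u) (diagE E v) = (g e u v : ℂ) := by
    filter_upwards [hGe] with e he u v
    rw [he, complexifyBilin_diagE]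
  refine ⟨G, hGe', ?_⟩
  have e1 : ∀ᶠ x in 𝓝 (diagE E a), ∀ i : (E × E) × (E × E), G x i.1 i.2 - G x i.2 i.1 = 0 := by
    refine eventually_eq_zero_of_diagE (h := fun (i : (E × E) × (E × E)) x ↦ G x i.1 i.2 - G x i.2 i.1) ?_ ?_
    · filter_upwards [hGd] with x hx i
      exact (hx.clm_apply₂ _ _).sub (hx.clm_apply₂ _ _)
    · filter_upwards [hGe', hsymm] with e he hs i
      have : G (diagE E e) = (G (diagE E e)).flip := bilin_eq_of_diagE fun u v ↦ by
        rw [ContinuousLinearMap.flip_apply, he, he, hs]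
      rw [sub_eq_zero]
      exact congrArg (fun B ↦ B i.1 i.2) this
  have e2 : ∀ᶠ x in 𝓝 (diagE E a), ∀ i : (E × E) × (E × E),
      G x (complexI E i.1) (complexI E i.2) - G x i.1 i.2 = 0 := by
    refine eventually_eq_zero_of_diagE
      (h := fun (i : (E × E) × (E × E)) x ↦ G x (complexI E i.1) (complexI E i.2) - G x i.1 i.2) ?_ ?_
    · filter_upwards [hGd] with x hx i
      exact (hx.clm_apply₂ _ _).sub (hx.clm_apply₂ _ _)
    · filter_upwards [hGe', hinv] with e he hs i
      have : (G (diagE E e)).bilinearComp (complexI E) (complexI E) = G (diagE E e) :=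
        bilin_eq_of_diagE fun u v ↦ by
          rw [ContinuousLinearMap.bilinearComp_apply, complexI_diagE, complexI_diagE, he, he, hs]
      rw [sub_eq_zero]
      exact congrArg (fun B ↦ B i.1 i.2) this
  -- Injectivity is open in finite dimension, so positivity at the single point `a` suffices.
  have e3 : ∀ᶠ x in 𝓝 (diagE E a), Function.Injective (G x) := by
    refine hG.continuousAt.eventually
      (ContinuousLinearMap.isOpen_injective.mem_nhds (?_ : Function.Injective (G (diagE E a))))
    rw [injective_iff_map_eq_zero, hGe.self_of_nhds]
    intro u hu
    exact complexifyBilin_nondegenerate hpos fun v ↦ by rw [hu]; rfl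
  have e4 := eventually_closed_extension hg hG hGe' hclosed
  filter_upwards [hGan, e1, e2, e3, e4] with x h0 h1 h2 h3 h4
  refine ⟨h0, fun u v ↦ sub_eq_zero.1 (h1 (u, v)), fun u v ↦ sub_eq_zero.1 (h2 (u, v)),
    fun u hu ↦ h3 ?_, fun u v w ↦ h4 (u, v, w)⟩
  refine ContinuousLinearMap.ext fun v ↦ ?_
  rw [hu, map_zero]
  rfl

end KahlerCoordinates


/-! ### Charts adapted to a complexification -/

section AdaptedCharts

/-- The differential of a map between manifolds, as a continuous linear map between the model
spaces. -/
def modelDeriv (𝕜 : Type*) [NontriviallyNormedField 𝕜]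
    (E : Type*) [NormedAddCommGroup E] [NormedSpace 𝕜 E]
    (E' : Type*) [NormedAddCommGroup E'] [NormedSpace 𝕜 E']
    {X : Type*} [TopologicalSpace X] [ChartedSpace E X]
    {Y : Type*} [TopologicalSpace Y] [ChartedSpace E' Y] (h : X → Y) (x : X) : E →L[𝕜] E' :=
  mfderiv 𝓘(𝕜, E) 𝓘(𝕜, E') h x

lemma bijective_mfderiv_chartAt {𝕜 : Type*} [NontriviallyNormedField 𝕜]
    {E : Type*} [NormedAddCommGroup E] [NormedSpace 𝕜 E]
    {X : Type*} [TopologicalSpace X] [ChartedSpace E X] [IsManifold 𝓘(𝕜, E) ω X] {x₀ x : X}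
    (hx : x ∈ (chartAt E x₀).source) :
    Function.Bijective (mfderiv 𝓘(𝕜, E) 𝓘(𝕜, E) (chartAt E x₀) x) := by
  have : IsManifold 𝓘(𝕜, E) 1 X := IsManifold.of_le (n := ω) le_top
  have h := isInvertible_mfderiv_extChartAt (I := 𝓘(𝕜, E)) (x := x₀) (y := x) (by simpa using hx)
  rw [show (extChartAt 𝓘(𝕜, E) x₀ : X → E) = chartAt E x₀ by ext; simp] at h
  exact h.bijective

lemma bijective_mfderiv_chartAt_symm {𝕜 : Type*} [NontriviallyNormedField 𝕜]
    {E : Type*} [NormedAddCommGroup E] [NormedSpace 𝕜 E]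
    {X : Type*} [TopologicalSpace X] [ChartedSpace E X] [IsManifold 𝓘(𝕜, E) ω X] {x₀ : X} {y : E}
    (hy : y ∈ (chartAt E x₀).target) :
    Function.Bijective (mfderiv 𝓘(𝕜, E) 𝓘(𝕜, E) (chartAt E x₀).symm y) := by
  have : IsManifold 𝓘(𝕜, E) 1 X := IsManifold.of_le (n := ω) le_top
  have h := isInvertible_mfderivWithin_extChartAt_symm (I := 𝓘(𝕜, E)) (x := x₀) (y := y)
    (by simpa using hy)
  rw [show ((extChartAt 𝓘(𝕜, E) x₀).symm : E → X) = (chartAt E x₀).symm by ext; simp,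
    show range 𝓘(𝕜, E) = univ by simp, mfderivWithin_univ] at h
  exact h.bijective

lemma contMDiffAt_chartAt {𝕜 : Type*} [NontriviallyNormedField 𝕜]
    {E : Type*} [NormedAddCommGroup E] [NormedSpace 𝕜 E]
    {X : Type*} [TopologicalSpace X] [ChartedSpace E X] [IsManifold 𝓘(𝕜, E) ω X] {x₀ x : X}
    (hx : x ∈ (chartAt E x₀).source) : ContMDiffAt 𝓘(𝕜, E) 𝓘(𝕜, E) ω (chartAt E x₀) x :=
  contMDiffOn_chart.contMDiffAt ((chartAt E x₀).open_source.mem_nhds hx)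

lemma contMDiffAt_chartAt_symm {𝕜 : Type*} [NontriviallyNormedField 𝕜]
    {E : Type*} [NormedAddCommGroup E] [NormedSpace 𝕜 E]
    {X : Type*} [TopologicalSpace X] [ChartedSpace E X] [IsManifold 𝓘(𝕜, E) ω X] {x₀ : X} {y : E}
    (hy : y ∈ (chartAt E x₀).target) :
    ContMDiffAt 𝓘(𝕜, E) 𝓘(𝕜, E) ω (chartAt E x₀).symm y :=
  contMDiffOn_chart_symm.contMDiffAt ((chartAt E x₀).open_target.mem_nhds hy)

variable {E : Type*} [NormedAddCommGroup E] [NormedSpace ℂ E]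
  {N : Type*} [TopologicalSpace N] [ChartedSpace E N]
  {F : Type*} [NormedAddCommGroup F] [NormedSpace ℂ F]
  {M : Type*} [TopologicalSpace M] [ChartedSpace F M]
  {f : N → M}

/-- Together with `exists_add_eq`, this says that the complex linear extension of `df` to `E × E` is
bijective. -/
lemma IsComplexification.eq_zero_of_add_eq_zero (hf : IsComplexification E F f) (p : N) {r s : E}
    (h : modelDeriv ℝ E F f p r + Complex.I • modelDeriv ℝ E F f p s = 0) : r = 0 ∧ s = 0 := by
  have hd := (hf.totallyReal p).disjoint
  have hinj : Function.Injective (modelDeriv ℝ E F f p) := hf.immersion p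
  have h2 : modelDeriv ℝ E F f p r ∈
      ((mfderiv 𝓘(ℝ, E) 𝓘(ℝ, F) f p).range.map (almostComplex (f p)).toLinearMap) := by
    refine ⟨modelDeriv ℝ E F f p (-s), ⟨-s, rfl⟩, ?_⟩
    change Complex.I • modelDeriv ℝ E F f p (-s) = modelDeriv ℝ E F f p r
    rw [map_neg, smul_neg]
    exact (eq_neg_of_add_eq_zero_left h).symm
  have h3 : modelDeriv ℝ E F f p r = 0 := Submodule.disjoint_def.1 hd _ ⟨r, rfl⟩ h2
  rw [h3, zero_add] at h
  exact ⟨(map_eq_zero_iff _ hinj).1 h3,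
    (map_eq_zero_iff _ hinj).1 ((smul_eq_zero.1 h).resolve_left Complex.I_ne_zero)⟩

lemma IsComplexification.exists_add_eq (hf : IsComplexification E F f) (p : N) (y : F) :
    ∃ r s : E, modelDeriv ℝ E F f p r + Complex.I • modelDeriv ℝ E F f p s = y := by
  have hc := (hf.totallyReal p).codisjoint
  have hy : ∀ y : TangentSpace 𝓘(ℝ, F) (f p), y ∈ (mfderiv 𝓘(ℝ, E) 𝓘(ℝ, F) f p).range ⊔
      ((mfderiv 𝓘(ℝ, E) 𝓘(ℝ, F) f p).range.map (almostComplex (f p)).toLinearMap) := by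
    rw [codisjoint_iff.1 hc]
    exact fun _ ↦ trivial
  obtain ⟨_, ⟨r, rfl⟩, _, ⟨_, ⟨s, rfl⟩, rfl⟩, h⟩ := Submodule.mem_sup.1 (hy y)
  exact ⟨r, s, h⟩

/-- Complex bilinear forms that agree on the tangent space of a totally real submanifold of maximal
dimension are equal. -/
lemma IsComplexification.bilin_ext (hf : IsComplexification E F f) (p : N)
    {B B' : F →L[ℂ] F →L[ℂ] ℂ}
    (h : ∀ u v : E, B (modelDeriv ℝ E F f p u) (modelDeriv ℝ E F f p v) =
      B' (modelDeriv ℝ E F f p u) (modelDeriv ℝ E F f p v)) : B = B' := by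
  refine ContinuousLinearMap.ext fun x ↦ ContinuousLinearMap.ext fun y ↦ ?_
  obtain ⟨r, s, rfl⟩ := hf.exists_add_eq p x
  obtain ⟨r', s', rfl⟩ := hf.exists_add_eq p y
  simp only [map_add, map_smul, add_apply, smul_apply, smul_eq_mul]
  rw [h, h, h, h]

variable [FiniteDimensional ℂ E] [FiniteDimensional ℂ F] [IsManifold 𝓘(ℂ, F) ω M]

/-- Around every point of a totally real submanifold `N` of maximal dimension there are holomorphic
coordinates on `M` with values in `E × Ē` in which `N` is the diagonal. -/
lemma IsComplexification.exists_adaptedChart (hf : IsComplexification E F f) (p : N) :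
    ∃ (φ : M → E × E) (σ : E × E → M) (W : Set M), IsOpen W ∧ f p ∈ W ∧
      ContMDiffOn 𝓘(ℂ, F) 𝓘(ℂ, E × E) ω φ W ∧
      (∀ x ∈ W, Function.Bijective (mfderiv 𝓘(ℂ, F) 𝓘(ℂ, E × E) φ x)) ∧
      (∀ x ∈ W, σ (φ x) = x) ∧ (∀ x ∈ W, Filter.map φ (𝓝 x) = 𝓝 (φ x)) ∧
      (∀ᶠ v in 𝓝 (diagE E (chartAt E p p)), MDifferentiableAt 𝓘(ℂ, E × E) 𝓘(ℂ, F) σ v) ∧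
      ∀ q, f q ∈ W → q ∈ (chartAt E p).source ∧ φ (f q) = diagE E (chartAt E p q) := by
  have : CompleteSpace F := FiniteDimensional.complete ℂ F
  have : CompleteSpace E := FiniteDimensional.complete ℂ E
  set χ := chartAt E p
  set ψ := chartAt F (f p)
  set a := χ p
  have hfp := hf.analytic p
  have hdf : MDifferentiableAt 𝓘(ℝ, E) 𝓘(ℝ, F) f p := hfp.mdifferentiableAt (by simp)
  have hft : AnalyticAt ℝ (ψ ∘ f ∘ χ.symm) a := by
    have : CompleteSpace F := FiniteDimensional.complete ℂ F
    exact (contMDiffAt_iff_chartAt.1 hfp).2.analyticAt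
  -- The inverse of the adapted chart, read in the chart `ψ` of `M`, is to be `k`.
  obtain ⟨k, hk, hkf⟩ := hft.exists_extension
  set B := fderiv ℂ k (diagE E a)
  have hkB : HasFDerivAt k B (diagE E a) := hk.differentiableAt.hasFDerivAt
  have hBA : ∀ e : E, B (diagE E e) = modelDeriv ℝ E F f p e := by
    intro e
    rw [modelDeriv, mfderiv_eq_chartAt hdf]
    have h1 := hkB.comp_diagE
    have h2 := h1.congr_of_eventuallyEq (f₁ := ψ ∘ f ∘ χ.symm) (hkf.mono fun e he ↦ he.symm)
    rw [h2.fderiv]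
    rfl
  have hBinj : Function.Injective B := by
    rw [injective_iff_map_eq_zero]
    intro v hv
    rw [← diagE_reV_add v, map_add, map_smul, hBA, hBA] at hv
    obtain ⟨h1, h2⟩ := hf.eq_zero_of_add_eq_zero p hv
    rw [← diagE_reV_add v, h1, h2]
    simp
  have hBsurj : Function.Surjective B := by
    intro y
    obtain ⟨r, s, h⟩ := hf.exists_add_eq p y
    exact ⟨diagE E r + Complex.I • diagE E s, by rw [map_add, map_smul, hBA, hBA, h]⟩
  let Be : (E × E) ≃L[ℂ] F := ContinuousLinearEquiv.ofBijective B
    (LinearMap.ker_eq_bot.2 hBinj) (LinearMap.range_eq_top.2 hBsurj)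
  have hBe : HasFDerivAt k (Be : E × E →L[ℂ] F) (diagE E a) := hkB
  have hkω : ContDiffAt ℂ ω k (diagE E a) := hk.contDiffAt
  -- The holomorphic inverse function theorem.
  let R := hkω.toOpenPartialHomeomorph k hBe (by simp)
  have hRk : (R : E × E → F) = k := rfl
  have hRa : diagE E a ∈ R.source := hkω.mem_toOpenPartialHomeomorph_source hBe (by simp)
  have hka : k (diagE E a) = ψ (f p) := by
    rw [hkf.self_of_nhds]
    simp [a, χ]
  have hRt : ψ (f p) ∈ R.target := by
    rw [← hka]; exact R.map_source hRa
  have hRs : R.symm (ψ (f p)) = diagE E a := by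
    rw [← hka]; exact R.left_inv hRa
  have hsymm : AnalyticAt ℂ R.symm (ψ (f p)) := by
    have := R.contDiffAt_symm (n := ω) (f₀' := Be) hRt (by rw [hRs]; exact hBe)
      (by rw [hRs]; exact hkω)
    exact this.analyticAt
  have hnear : ∀ᶠ y in 𝓝 (ψ (f p)), y ∈ R.target ∧ AnalyticAt ℂ R.symm y ∧
      AnalyticAt ℂ k (R.symm y) := by
    have h1 := hsymm.continuousAt
    rw [ContinuousAt, hRs] at h1
    filter_upwards [R.open_target.mem_nhds hRt, hsymm.eventually_analyticAt,
      h1.eventually hk.eventually_analyticAt] with y h1 h2 h3 using ⟨h1, h2, h3⟩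
  have hbij : ∀ᶠ y in 𝓝 (ψ (f p)), Function.Bijective (fderiv ℂ R.symm y) := by
    filter_upwards [hnear] with y ⟨hy, h1, h2⟩
    have h3 : HasFDerivAt (k ∘ R.symm) _ y :=
      h2.differentiableAt.hasFDerivAt.comp y h1.differentiableAt.hasFDerivAt
    have h4 : HasFDerivAt (k ∘ R.symm) (ContinuousLinearMap.id ℂ F) y :=
      (hasFDerivAt_id y).congr_of_eventuallyEq (by
        filter_upwards [R.open_target.mem_nhds hy] with y' hy' using R.right_inv hy')
    have h1' : HasFDerivAt R.symm (fderiv ℂ R.symm y) (k (R.symm y)) := by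
      rw [show k (R.symm y) = y from R.right_inv hy]
      exact h1.differentiableAt.hasFDerivAt
    have h5 : HasFDerivAt (R.symm ∘ k) _ (R.symm y) :=
      h1'.comp (R.symm y) h2.differentiableAt.hasFDerivAt
    have h6 : HasFDerivAt (R.symm ∘ k) (ContinuousLinearMap.id ℂ (E × E)) (R.symm y) :=
      (hasFDerivAt_id _).congr_of_eventuallyEq (by
        filter_upwards [R.open_source.mem_nhds (R.map_target hy)] with y' hy' using R.left_inv hy')
    have h7 := h3.unique h4
    have h8 := h5.unique h6
    exact ⟨Function.LeftInverse.injective (g := fderiv ℂ k (R.symm y))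
        fun u ↦ congrArg (fun L ↦ L u) h7,
      Function.RightInverse.surjective (g := fderiv ℂ k (R.symm y))
        fun u ↦ congrArg (fun L ↦ L u) h8⟩
  have hψc : ContinuousAt ψ (f p) := ψ.continuousAt (mem_chart_source F (f p))
  have hW1 : ∀ᶠ x in 𝓝 (f p), x ∈ ψ.source ∧ ψ x ∈ R.target ∧ AnalyticAt ℂ R.symm (ψ x) ∧
      Function.Bijective (fderiv ℂ R.symm (ψ x)) := by
    filter_upwards [ψ.open_source.mem_nhds (mem_chart_source F (f p)),
      hψc.eventually hnear, hψc.eventually hbij] with x h1 h2 h3 using ⟨h1, h2.1, h2.2.1, h3⟩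
  -- Here `f` must be an embedding: points of `N` whose images are close to `f p` are close to `p`,
  -- hence in the chart at `p`.
  have hW2 : ∀ᶠ x in 𝓝 (f p), ∀ q, f q = x →
      q ∈ χ.source ∧ R.symm (ψ (f q)) = diagE E (χ q) := by
    rw [← Filter.eventually_comap, ← hf.isEmbedding.isInducing.nhds_eq_comap]
    have hχc : ContinuousAt χ p := χ.continuousAt (mem_chart_source E p)
    have hΔ : ContinuousAt (fun q ↦ diagE E (χ q)) p :=
      ContinuousAt.comp (g := diagE E) (diagE E).continuous.continuousAt hχc
    filter_upwards [χ.open_source.mem_nhds (mem_chart_source E p), hχc.eventually hkf,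
      hΔ.eventually_mem (R.open_source.mem_nhds hRa)] with q h1 h2 h3
    refine ⟨h1, ?_⟩
    have h4 : ψ (f q) = k (diagE E (χ q)) := by
      rw [h2]
      simp [h1]
    rw [h4]
    exact R.left_inv h3
  obtain ⟨W, hW, hWo, hpW⟩ := eventually_nhds_iff.1 (hW1.and hW2)
  refine ⟨R.symm ∘ ψ, ψ.symm ∘ k, W, hWo, hpW, fun x hx ↦ ?_, fun x hx ↦ ?_, fun x hx ↦ ?_,
    fun x hx ↦ ?_, ?_,
    fun q hq ↦ (hW _ hq).2 q rfl⟩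
  · obtain ⟨⟨h1, h2, h3, h4⟩, -⟩ := hW x hx
    exact (h3.contDiffAt.contMDiffAt.comp x (contMDiffAt_chartAt h1)).contMDiffWithinAt
  · obtain ⟨⟨h1, h2, h3, h4⟩, -⟩ := hW x hx
    rw [mfderiv_comp x (I' := 𝓘(ℂ, F)) h3.differentiableAt.mdifferentiableAt
      ((contMDiffAt_chartAt (𝕜 := ℂ) h1).mdifferentiableAt (by simp)), mfderiv_eq_fderiv]
    exact h4.comp (bijective_mfderiv_chartAt h1)
  · obtain ⟨⟨h1, h2, h3, h4⟩, -⟩ := hW x hx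
    simp only [Function.comp_apply]
    rw [show k (R.symm (ψ x)) = ψ x from R.right_inv h2, ψ.left_inv h1]
  · obtain ⟨⟨h1, h2, h3, h4⟩, -⟩ := hW x hx
    rw [← Filter.map_map, ψ.map_nhds_eq h1, R.symm.map_nhds_eq h2]
    rfl
  · have h1 : ∀ᶠ v in 𝓝 (diagE E a), k v ∈ ψ.target := by
      refine hk.continuousAt.eventually_mem ?_
      rw [hka]
      exact ψ.open_target.mem_nhds (mem_chart_target F (f p))
    filter_upwards [h1, hk.eventually_analyticAt] with v h1 h2
    exact ((contMDiffAt_chartAt_symm h1).mdifferentiableAt (by simp)).comp v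
      h2.differentiableAt.mdifferentiableAt

end AdaptedCharts


/-! ### Uniqueness of holomorphic extensions -/

section Uniqueness

variable {E : Type*} [NormedAddCommGroup E] [NormedSpace ℂ E] [FiniteDimensional ℂ E]
  {N : Type*} [TopologicalSpace N] [ChartedSpace E N]
  {F : Type*} [NormedAddCommGroup F] [NormedSpace ℂ F] [FiniteDimensional ℂ F]
  {M : Type*} [TopologicalSpace M] [ChartedSpace F M] [IsManifold 𝓘(ℂ, F) ω M]
  {f : N → M}

/-- Holomorphic functions near a point of `N` that vanish on `N` vanish near that point. -/
lemma IsComplexification.eventually_eq_zero (hf : IsComplexification E F f) (p : N)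
    {H : Type*} [NormedAddCommGroup H] [NormedSpace ℂ H] [CompleteSpace H] {h : M → H}
    (hd : ∀ᶠ x in 𝓝 (f p), MDifferentiableAt 𝓘(ℂ, F) 𝓘(ℂ, H) h x)
    (h0 : ∀ᶠ q in 𝓝 p, h (f q) = 0) : ∀ᶠ x in 𝓝 (f p), h x = 0 := by
  obtain ⟨φ, σ, W, hWo, hpW, hφ, -, hσφ, -, hσ, hφf⟩ := hf.exists_adaptedChart p
  have hfW : ∀ᶠ q in 𝓝 p, f q ∈ W :=
    hf.isEmbedding.continuous.continuousAt.eventually_mem (hWo.mem_nhds hpW)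
  have hσp : σ (diagE E (chartAt E p p)) = f p := by
    rw [← (hφf p hpW).2, hσφ _ hpW]
  have h1 : ∀ᶠ v in 𝓝 (diagE E (chartAt E p p)), ∀ _ : Unit, h (σ v) = 0 := by
    refine eventually_eq_zero_of_diagE (h := fun _ v ↦ h (σ v)) ?_ ?_
    · have hc := hσ.self_of_nhds.continuousAt
      rw [ContinuousAt, hσp] at hc
      filter_upwards [hσ, hc.eventually hd] with v h1 h2 _
      rw [← mdifferentiableAt_iff_differentiableAt]
      exact h2.comp v h1
    · have hc : Filter.Tendsto (chartAt E p).symm (𝓝 (chartAt E p p)) (𝓝 p) := by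
        have := (chartAt E p).continuousAt_symm (mem_chart_target E p)
        rwa [ContinuousAt, (chartAt E p).left_inv (mem_chart_source E p)] at this
      filter_upwards [hc.eventually hfW, hc.eventually h0,
        (chartAt E p).open_target.mem_nhds (mem_chart_target E p)] with e h1 h2 h3 _
      have h4 := (hφf _ h1).2
      rw [(chartAt E p).right_inv h3] at h4
      rw [← h4, hσφ _ h1, h2]
  have hφc := (hφ.contMDiffAt (hWo.mem_nhds hpW)).continuousAt
  rw [ContinuousAt, (hφf p hpW).2] at hφc
  filter_upwards [hφc.eventually h1, hWo.mem_nhds hpW] with x hx hxW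
  rw [← hσφ x hxW]
  exact hx ()

omit [FiniteDimensional ℂ F] in
lemma BilinField.eq_of_inChart_eq {b b' : BilinField ℂ F M} {x₀ : M} {y : F}
    (hy : y ∈ (chartAt F x₀).target) (h : b.inChart x₀ y = b'.inChart x₀ y) :
    b ((chartAt F x₀).symm y) = b' ((chartAt F x₀).symm y) := by
  have hs := (bijective_mfderiv_chartAt_symm (𝕜 := ℂ) hy).surjective
  refine ContinuousLinearMap.ext fun u ↦ ContinuousLinearMap.ext fun v ↦ ?_
  obtain ⟨u, rfl⟩ := hs u
  obtain ⟨v, rfl⟩ := hs v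
  exact congrArg (fun B : F →L[ℂ] F →L[ℂ] ℂ ↦ B u v) h

omit [FiniteDimensional ℂ F] [IsManifold 𝓘(ℂ, F) ω M] in
lemma BilinField.inChart_congr {b b' : BilinField ℂ F M} {x₀ : M} {y : F}
    (h : b ((chartAt F x₀).symm y) = b' ((chartAt F x₀).symm y)) :
    b.inChart x₀ y = b'.inChart x₀ y := by
  refine ContinuousLinearMap.ext fun u ↦ ContinuousLinearMap.ext fun v ↦ ?_
  rw [BilinField.inChart_apply, BilinField.inChart_apply, h]

/-- Tangent vectors of `N` span the tangent space of `M` over `ℂ`, so the fields agree along `N` by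
`bilin_ext`; the identity principle then applies to their coefficients in the chart at `f p`. -/
lemma IsComplexification.eventually_bilinField_eq (hf : IsComplexification E F f) (p : N)
    {b b' : BilinField ℂ F M} {W W' : Set M} (hW : IsOpen W) (hW' : IsOpen W') (hpW : f p ∈ W)
    (hpW' : f p ∈ W') (hb : b.IsAnalyticOn W) (hb' : b'.IsAnalyticOn W')
    (h : ∀ᶠ q in 𝓝 p, ∀ u v, b (f q) (mfderiv 𝓘(ℝ, E) 𝓘(ℝ, F) f q u)
      (mfderiv 𝓘(ℝ, E) 𝓘(ℝ, F) f q v) = b' (f q) (mfderiv 𝓘(ℝ, E) 𝓘(ℝ, F) f q u)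
      (mfderiv 𝓘(ℝ, E) 𝓘(ℝ, F) f q v)) : ∀ᶠ x in 𝓝 (f p), b x = b' x := by
  have hs : ∀ᶠ x in 𝓝 (f p), x ∈ (chartAt F (f p)).source :=
    (chartAt F (f p)).open_source.mem_nhds (mem_chart_source F (f p))
  have han : ∀ {b : BilinField ℂ F M} {W : Set M}, IsOpen W → f p ∈ W → b.IsAnalyticOn W →
      ∀ᶠ x in 𝓝 (f p), MDifferentiableAt 𝓘(ℂ, F) 𝓘(ℂ, F →L[ℂ] F →L[ℂ] ℂ)
        (b.inChart (f p) ∘ chartAt F (f p)) x := by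
    intro b W hW hpW hb
    have h1 := ((BilinField.isAnalyticOn_iff hW).1 hb _ hpW).analyticAt.eventually_analyticAt
    have hc := (chartAt F (f p)).continuousAt (mem_chart_source F (f p))
    filter_upwards [hs, hc.eventually h1] with x h2 h3
    exact h3.differentiableAt.mdifferentiableAt.comp x
      ((contMDiffAt_chartAt h2).mdifferentiableAt (by simp))
  have key := hf.eventually_eq_zero p (H := F →L[ℂ] F →L[ℂ] ℂ)
    (h := fun x ↦ b.inChart (f p) (chartAt F (f p) x) - b'.inChart (f p) (chartAt F (f p) x)) ?_ ?_
  · filter_upwards [key, hs] with x h1 h2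
    have h3 := BilinField.eq_of_inChart_eq ((chartAt F (f p)).map_source h2) (sub_eq_zero.1 h1)
    rwa [(chartAt F (f p)).left_inv h2] at h3
  · filter_upwards [han hW hpW hb, han hW' hpW' hb'] with x h1 h2
    exact h1.sub h2
  · filter_upwards [h, hf.isEmbedding.continuous.continuousAt.eventually hs] with q h1 h2
    have h3 : b.inChart (f p) (chartAt F (f p) (f q)) =
        b'.inChart (f p) (chartAt F (f p) (f q)) := BilinField.inChart_congr (by
      rw [(chartAt F (f p)).left_inv h2]
      exact hf.bilin_ext q h1)
    exact sub_eq_zero.2 h3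

omit [FiniteDimensional ℂ F] in
/-- The identity theorem for holomorphic fields of bilinear forms. -/
lemma BilinField.eq_of_eventually_eq [FiniteDimensional ℂ F] {b b' : BilinField ℂ F M} {U : Set M}
    (hU : IsOpen U) (hc : IsPreconnected U) (hb : b.IsAnalyticOn U) (hb' : b'.IsAnalyticOn U)
    {x₀ : M} (hx₀ : x₀ ∈ U) (h : ∀ᶠ x in 𝓝 x₀, b x = b' x) : ∀ x ∈ U, b x = b' x := by
  -- This set is open. It is closed in `U`: in a chart ball around a limit point both fields are
  -- analytic and agree near some point of the ball.
  have hs : U ⊆ {x | ∀ᶠ y in 𝓝 x, b y = b' y} := by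
    refine hc.subset_of_closure_inter_subset isOpen_setOfPred_eventually_nhds ⟨x₀, hx₀, h⟩ ?_
    rintro x ⟨hx, hxU⟩
    set ψ := chartAt F x
    have h1 := ((BilinField.isAnalyticOn_iff hU).1 hb x hxU).analyticAt.eventually_analyticAt
    have h2 := ((BilinField.isAnalyticOn_iff hU).1 hb' x hxU).analyticAt.eventually_analyticAt
    obtain ⟨r, hr, hball⟩ := Metric.eventually_nhds_iff_ball.1
      ((h1.and h2).and (ψ.open_target.mem_nhds (mem_chart_target F x)))
    have hO : IsOpen (ψ.source ∩ ψ ⁻¹' Metric.ball (ψ x) r) :=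
      ψ.isOpen_inter_preimage Metric.isOpen_ball
    have hxO : x ∈ ψ.source ∩ ψ ⁻¹' Metric.ball (ψ x) r :=
      ⟨mem_chart_source F x, Metric.mem_ball_self hr⟩
    obtain ⟨y, hyO, hy⟩ := mem_closure_iff.1 hx _ hO hxO
    have heq : b.inChart x =ᶠ[𝓝 (ψ y)] b'.inChart x := by
      have hcs := ψ.continuousAt_symm (ψ.map_source hyO.1)
      rw [ContinuousAt, ψ.left_inv hyO.1] at hcs
      filter_upwards [hcs.eventually hy] with y' hy'
      exact BilinField.inChart_congr hy'
    have hon := AnalyticOnNhd.eqOn_of_preconnected_of_eventuallyEq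
      (fun y hy ↦ (hball y hy).1.1) (fun y hy ↦ (hball y hy).1.2)
      (convex_ball (ψ x) r).isPreconnected hyO.2 heq
    change ∀ᶠ y in 𝓝 x, b y = b' y
    filter_upwards [hO.mem_nhds hxO] with x' hx'
    have := BilinField.eq_of_inChart_eq (ψ.map_source hx'.1) (hon hx'.2)
    rwa [ψ.left_inv hx'.1] at this
  exact fun x hx ↦ (hs hx).self_of_nhds

variable [IsManifold 𝓘(ℂ, E) ω N]

/-- By continuity both maps take values in the chart at `p` near `f p`, and there their difference
vanishes along `N`. -/
lemma IsComplexification.eventually_eq_of_holomorphic (hf : IsComplexification E F f) (p : N)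
    {z z' : M → N} (hz : ∀ᶠ x in 𝓝 (f p), MDifferentiableAt 𝓘(ℂ, F) 𝓘(ℂ, E) z x)
    (hz' : ∀ᶠ x in 𝓝 (f p), MDifferentiableAt 𝓘(ℂ, F) 𝓘(ℂ, E) z' x)
    (h : ∀ᶠ q in 𝓝 p, z (f q) = q ∧ z' (f q) = q) : ∀ᶠ x in 𝓝 (f p), z x = z' x := by
  have : CompleteSpace E := FiniteDimensional.complete ℂ E
  have hO : (chartAt E p).source ∈ 𝓝 p :=
    (chartAt E p).open_source.mem_nhds (mem_chart_source E p)
  have hs : ∀ {z : M → N}, (∀ᶠ x in 𝓝 (f p), MDifferentiableAt 𝓘(ℂ, F) 𝓘(ℂ, E) z x) →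
      z (f p) = p → ∀ᶠ x in 𝓝 (f p), z x ∈ (chartAt E p).source := by
    intro z hz hp
    exact hz.self_of_nhds.continuousAt.eventually_mem (by rwa [hp])
  have h1 := hs hz h.self_of_nhds.1
  have h2 := hs hz' h.self_of_nhds.2
  have key := hf.eventually_eq_zero p
    (h := fun x ↦ chartAt E p (z x) - chartAt E p (z' x)) ?_ ?_
  · filter_upwards [key, h1, h2] with x h3 h4 h5
    exact (chartAt E p).injOn h4 h5 (sub_eq_zero.1 h3)
  · filter_upwards [hz, hz', h1, h2] with x h3 h4 h5 h6
    exact (((contMDiffAt_chartAt h5).mdifferentiableAt (by simp)).comp x h3).sub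
      (((contMDiffAt_chartAt h6).mdifferentiableAt (by simp)).comp x h4)
  · filter_upwards [h] with q hq
    rw [hq.1, hq.2, sub_self]

/-- Pointwise antiholomorphy. -/
def IsAntiholomorphicAt (E F : Type*) [NormedAddCommGroup E] [NormedSpace ℂ E]
    [NormedAddCommGroup F] [NormedSpace ℂ F]
    {N : Type*} [TopologicalSpace N] [ChartedSpace E N]
    {M : Type*} [TopologicalSpace M] [ChartedSpace F M] (a : M → N) (x : M) : Prop :=
  MDifferentiableAt 𝓘(ℝ, F) 𝓘(ℝ, E) a x ∧
    ∀ u, modelDeriv ℝ F E a x (Complex.I • u) = -(Complex.I • modelDeriv ℝ F E a x u)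

omit [FiniteDimensional ℂ F] [IsManifold 𝓘(ℂ, F) ω M] in
-- The antilinear involution undoes the antilinearity of `dw`, which makes the identity principle
-- available for `w`.
lemma IsAntiholomorphicAt.mdifferentiableAt_conj {w : M → N} {p : N} {x : M}
    (hw : IsAntiholomorphicAt E F w x) (hx : w x ∈ (chartAt E p).source) :
    MDifferentiableAt 𝓘(ℂ, F) 𝓘(ℂ, E) (fun x ↦ conjE E (chartAt E p (w x))) x := by
  have h1 : MDifferentiableAt 𝓘(ℂ, E) 𝓘(ℂ, E) (chartAt E p) (w x) :=
    (contMDiffAt_chartAt hx).mdifferentiableAt (by simp)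
  have h2 : MDifferentiableAt 𝓘(ℝ, E) 𝓘(ℝ, E) (conjE E) (chartAt E p (w x)) :=
    (conjE E).differentiableAt.mdifferentiableAt
  have h3 := h1.restrictScalars_real.comp x hw.1
  have h4 : modelDeriv ℝ F E (fun x ↦ conjE E (chartAt E p (w x))) x =
      (conjE E).comp ((modelDeriv ℝ E E (chartAt E p) (w x)).comp (modelDeriv ℝ F E w x)) := by
    have h5 := mfderiv_comp x h2 h3
    rw [mfderiv_comp x h1.restrictScalars_real hw.1, mfderiv_eq_fderiv,
      ContinuousLinearMap.fderiv] at h5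
    exact h5
  have h6 : ∀ u : E, modelDeriv ℝ E E (chartAt E p) (w x) (Complex.I • u) =
      Complex.I • modelDeriv ℝ E E (chartAt E p) (w x) u := h1.mfderiv_almostComplex
  refine MDifferentiableAt.of_commutes (h2.comp x h3) fun (u : F) ↦ ?_
  change modelDeriv ℝ F E (fun x ↦ conjE E (chartAt E p (w x))) x (Complex.I • u) =
    Complex.I • modelDeriv ℝ F E (fun x ↦ conjE E (chartAt E p (w x))) x u
  rw [h4]
  simp only [ContinuousLinearMap.comp_apply]
  rw [hw.2, map_neg, h6, map_neg, conjE_I_smul, neg_neg]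

lemma IsComplexification.eventually_eq_of_antiholomorphic (hf : IsComplexification E F f) (p : N)
    {w w' : M → N} (hw : ∀ᶠ x in 𝓝 (f p), IsAntiholomorphicAt E F w x)
    (hw' : ∀ᶠ x in 𝓝 (f p), IsAntiholomorphicAt E F w' x)
    (h : ∀ᶠ q in 𝓝 p, w (f q) = q ∧ w' (f q) = q) : ∀ᶠ x in 𝓝 (f p), w x = w' x := by
  have : CompleteSpace E := FiniteDimensional.complete ℂ E
  have hO : (chartAt E p).source ∈ 𝓝 p :=
    (chartAt E p).open_source.mem_nhds (mem_chart_source E p)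
  have hs : ∀ {z : M → N}, (∀ᶠ x in 𝓝 (f p), IsAntiholomorphicAt E F z x) →
      z (f p) = p → ∀ᶠ x in 𝓝 (f p), z x ∈ (chartAt E p).source := by
    intro z hz hp
    exact hz.self_of_nhds.1.continuousAt.eventually_mem (by rwa [hp])
  have h1 := hs hw h.self_of_nhds.1
  have h2 := hs hw' h.self_of_nhds.2
  have key := hf.eventually_eq_zero p
    (h := fun x ↦ conjE E (chartAt E p (w x)) - conjE E (chartAt E p (w' x))) ?_ ?_
  · filter_upwards [key, h1, h2] with x h3 h4 h5
    have h6 := congrArg (conjE E) (sub_eq_zero.1 h3)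
    rw [conjE_conjE, conjE_conjE] at h6
    exact (chartAt E p).injOn h4 h5 h6
  · filter_upwards [hw, hw', h1, h2] with x h3 h4 h5 h6
    exact (h3.mdifferentiableAt_conj h5).sub (h4.mdifferentiableAt_conj h6)
  · filter_upwards [h] with q hq
    rw [hq.1, hq.2, sub_self]

end Uniqueness

/-! ### Kähler structures in charts -/

section KahlerCharts

variable {E : Type*} [NormedAddCommGroup E] [NormedSpace ℂ E]
  {N : Type*} [TopologicalSpace N] [ChartedSpace E N] [IsManifold 𝓘(ℂ, E) ω N]
  (K : RealAnalyticKahlerStructure E N)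

/-- The Riemannian metric of a Kähler structure as a field of bilinear forms. -/
def RealAnalyticKahlerStructure.metricField : BilinField ℝ E N := K.metric.inner

/-- Alternation of the form makes `I` skew for the metric; with `I² = -1` and symmetry, `I` is an
isometry. -/
lemma RealAnalyticKahlerStructure.metric_I (x : N) (u v : TangentSpace 𝓘(ℝ, E) x) :
    K.metricField x (almostComplex x u) (almostComplex x v) = K.metricField x u v := by
  have h : ∀ a b, K.metricField x (almostComplex x a) b =
      -K.metricField x (almostComplex x b) a := by
    intro a b
    have h0 : ∀ u, K.metricField x (almostComplex x u) u = 0 := fun u ↦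
      (K.compat x u u).symm.trans (K.form_alt x u)
    have h1 := h0 (a + b)
    simp only [map_add, add_apply] at h1
    rw [h0 a, h0 b] at h1
    linarith
  have hs : ∀ a b, K.metricField x a b = K.metricField x b a := K.metric.symm x
  have hII : almostComplex x (almostComplex x v) = -v := by
    have h : ∀ w : E, Complex.I • (Complex.I • w) = -w := fun w ↦ by
      rw [smul_smul, Complex.I_mul_I, neg_smul, one_smul]
    exact h v
  rw [h, hII, map_neg, neg_apply, neg_neg, hs]

lemma RealAnalyticKahlerStructure.metricField_analyticAt [FiniteDimensional ℂ E] (p : N) :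
    AnalyticAt ℝ (K.metricField.inChart p) (chartAt E p p) := by
  have : FiniteDimensional ℝ E := FiniteDimensional.complexToReal E
  exact ((BilinField.isAnalyticOn_iff isOpen_univ).1 K.metric.contMDiff.contMDiffOn p
    (mem_univ p)).analyticAt

lemma mfderiv_chartAt_symm_I {p : N} {y : E} (hy : y ∈ (chartAt E p).target) (u : E) :
    modelDeriv ℝ E E (chartAt E p).symm y (Complex.I • u) =
      Complex.I • modelDeriv ℝ E E (chartAt E p).symm y u :=
  ((contMDiffAt_chartAt_symm (𝕜 := ℂ) hy).mdifferentiableAt (by simp)).mfderiv_almostComplex u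

/-- The charts of `N` are holomorphic, so `I₀` becomes the constant multiplication by `i` in them.
-/
lemma RealAnalyticKahlerStructure.form_inChart {p : N} {y : E} (hy : y ∈ (chartAt E p).target) :
    K.form.inChart p y = (K.metricField.inChart p y).comp (mulI E) := by
  refine ContinuousLinearMap.ext fun u ↦ ContinuousLinearMap.ext fun v ↦ ?_
  rw [BilinField.inChart_apply, K.compat, ContinuousLinearMap.comp_apply, BilinField.inChart_apply,
    mulI_apply]
  have := mfderiv_chartAt_symm_I hy u
  change K.metricField _ (Complex.I • modelDeriv ℝ E E (chartAt E p).symm y u : E) _ =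
    K.metricField _ (modelDeriv ℝ E E (chartAt E p).symm y (Complex.I • u) : E) _
  rw [this]

lemma RealAnalyticKahlerStructure.exists_extension [FiniteDimensional ℂ E] (p : N) :
    ∃ G : E × E → E × E →L[ℂ] E × E →L[ℂ] ℂ,
      (∀ᶠ e in 𝓝 (chartAt E p p), ∀ u v,
        G (diagE E e) (diagE E u) (diagE E v) = (K.metricField.inChart p e u v : ℂ)) ∧
      ∀ᶠ x in 𝓝 (diagE E (chartAt E p p)), AnalyticAt ℂ G x ∧ (∀ u v, G x u v = G x v u) ∧
        (∀ u v, G x (complexI E u) (complexI E v) = G x u v) ∧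
        (∀ u, (∀ v, G x u v = 0) → u = 0) ∧
        ∀ u v w, fderiv ℂ (fun x ↦ (G x).comp (complexI E)) x u v w -
          fderiv ℂ (fun x ↦ (G x).comp (complexI E)) x v u w +
          fderiv ℂ (fun x ↦ (G x).comp (complexI E)) x w u v = 0 := by
  have ht : ∀ᶠ e in 𝓝 (chartAt E p p), e ∈ (chartAt E p).target :=
    (chartAt E p).open_target.mem_nhds (mem_chart_target E p)
  refine exists_extension_kahler (K.metricField_analyticAt p) ?_ ?_ ?_ ?_
  · exact Filter.Eventually.of_forall fun e u v ↦ K.metric.symm _ _ _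
  · filter_upwards [ht] with e he u v
    have h := K.metric_I ((chartAt E p).symm e) (modelDeriv ℝ E E (chartAt E p).symm e u)
      (modelDeriv ℝ E E (chartAt E p).symm e v)
    have h1 : ∀ u : E, almostComplex ((chartAt E p).symm e)
        (modelDeriv ℝ E E (chartAt E p).symm e u) =
        modelDeriv ℝ E E (chartAt E p).symm e (Complex.I • u) :=
      fun u ↦ (mfderiv_chartAt_symm_I he u).symm
    rw [h1, h1] at h
    exact h
  · intro u hu
    have hinj : Function.Injective (modelDeriv ℝ E E (chartAt E p).symm (chartAt E p p)) :=
      (bijective_mfderiv_chartAt_symm (𝕜 := ℝ) (mem_chart_target E p)).injective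
    have hu' : modelDeriv ℝ E E (chartAt E p).symm (chartAt E p p) u ≠ 0 :=
      (map_ne_zero_iff _ hinj).2 hu
    exact K.metric.pos ((chartAt E p).symm (chartAt E p p)) _ hu'
  · filter_upwards [ht.eventually_nhds] with e he u v w
    have h := K.form_closed p e he.self_of_nhds (mem_univ _) u v w
    have hev : K.form.inChart p =ᶠ[𝓝 e] fun e ↦ (K.metricField.inChart p e).comp (mulI E) :=
      he.mono fun e' he' ↦ K.form_inChart he'
    rwa [hev.fderiv_eq] at h

end KahlerCharts


/-! ### Local models of the complexified Kähler structure -/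

section LocalModels

lemma modelDeriv_congr {𝕜 : Type*} [NontriviallyNormedField 𝕜]
    {E : Type*} [NormedAddCommGroup E] [NormedSpace 𝕜 E]
    {E' : Type*} [NormedAddCommGroup E'] [NormedSpace 𝕜 E']
    {X : Type*} [TopologicalSpace X] [ChartedSpace E X]
    {Y : Type*} [TopologicalSpace Y] [ChartedSpace E' Y] {h h' : X → Y} {x : X}
    (hh : ∀ᶠ y in 𝓝 x, h y = h' y) : modelDeriv 𝕜 E E' h x = modelDeriv 𝕜 E E' h' x :=
  Filter.EventuallyEq.mfderiv_eq hh

lemma modelDeriv_comp {𝕜 : Type*} [NontriviallyNormedField 𝕜]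
    {E : Type*} [NormedAddCommGroup E] [NormedSpace 𝕜 E]
    {E' : Type*} [NormedAddCommGroup E'] [NormedSpace 𝕜 E']
    {E'' : Type*} [NormedAddCommGroup E''] [NormedSpace 𝕜 E'']
    {X : Type*} [TopologicalSpace X] [ChartedSpace E X]
    {Y : Type*} [TopologicalSpace Y] [ChartedSpace E' Y]
    {Z : Type*} [TopologicalSpace Z] [ChartedSpace E'' Z] {g : Y → Z} {h : X → Y} {x : X}
    (hg : MDifferentiableAt 𝓘(𝕜, E') 𝓘(𝕜, E'') g (h x))
    (hh : MDifferentiableAt 𝓘(𝕜, E) 𝓘(𝕜, E') h x) :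
    modelDeriv 𝕜 E E'' (g ∘ h) x = (modelDeriv 𝕜 E' E'' g (h x)).comp (modelDeriv 𝕜 E E' h x) :=
  mfderiv_comp x hg hh

lemma modelDeriv_clm {𝕜 : Type*} [NontriviallyNormedField 𝕜]
    {E : Type*} [NormedAddCommGroup E] [NormedSpace 𝕜 E]
    {E' : Type*} [NormedAddCommGroup E'] [NormedSpace 𝕜 E'] (L : E →L[𝕜] E') (x : E) :
    modelDeriv 𝕜 E E' L x = L := by
  rw [modelDeriv, mfderiv_eq_fderiv]
  exact L.fderiv

variable {E : Type*} [NormedAddCommGroup E] [NormedSpace ℂ E]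
  {N : Type*} [TopologicalSpace N] [ChartedSpace E N]
  {F : Type*} [NormedAddCommGroup F] [NormedSpace ℂ F]
  {M : Type*} [TopologicalSpace M] [ChartedSpace F M]

/-- At the point `x` of `M`, the germs `(z, w)` are those of an identification with `N × N̄`, and the
germs `b` and `β` are those of complexifications of the metric and of the Kähler form of `N`. -/
structure IsModelAt [IsManifold 𝓘(ℂ, E) ω N] (K : RealAnalyticKahlerStructure E N) (f : N → M)
    (z w : M → N) (b β : BilinField ℂ F M) (x : M) : Prop where
  z_holomorphic : ContMDiffAt 𝓘(ℂ, F) 𝓘(ℂ, E) ω z x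
  w_analytic : ContMDiffAt 𝓘(ℝ, F) 𝓘(ℝ, E) ω w x
  w_anti : ∀ u, modelDeriv ℝ F E w x (Complex.I • u) = -(Complex.I • modelDeriv ℝ F E w x u)
  bijective : Function.Bijective fun u ↦ (modelDeriv ℝ F E z x u, modelDeriv ℝ F E w x u)
  nhds_le : 𝓝 (z x, w x) ≤ Filter.map (fun x ↦ (z x, w x)) (𝓝 x)
  diagonal : ∀ p, f p = x → z x = p ∧ w x = p
  coord : ∃ φ : M → E × E, ∀ᶠ y in 𝓝 x, ContMDiffAt 𝓘(ℂ, F) 𝓘(ℂ, E × E) ω φ y ∧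
    Function.Bijective (modelDeriv ℂ F (E × E) φ y) ∧ ∀ u,
      (modelDeriv ℝ F E z y u = 0 ↔ (modelDeriv ℂ F (E × E) φ y u).1 = 0) ∧
      (modelDeriv ℝ F E w y u = 0 ↔ (modelDeriv ℂ F (E × E) φ y u).2 = 0)
  metric_analytic : ContDiffAt ℂ ω (b.inChart x) (chartAt F x x)
  metric_symm : ∀ u v : F, b x u v = b x v u
  metric_nondegenerate : ∀ u : F, (∀ v : F, b x u v = 0) → u = 0
  metric_extends : ∀ p, f p = x → ∀ u v, (b x : F →L[ℂ] F →L[ℂ] ℂ)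
    (modelDeriv ℝ E F f p u) (modelDeriv ℝ E F f p v) = (K.metricField p u v : ℂ)
  form_analytic : ContDiffAt ℂ ω (β.inChart x) (chartAt F x x)
  form_alt : ∀ u : F, β x u u = 0
  form_closed : ∀ x₀, x ∈ (chartAt F x₀).source → ∀ u v w : F,
    fderiv ℂ (β.inChart x₀) (chartAt F x₀ x) u v w - fderiv ℂ (β.inChart x₀) (chartAt F x₀ x) v u w +
      fderiv ℂ (β.inChart x₀) (chartAt F x₀ x) w u v = 0
  form_extends : ∀ p, f p = x → ∀ u v, (β x : F →L[ℂ] F →L[ℂ] ℂ)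
    (modelDeriv ℝ E F f p u) (modelDeriv ℝ E F f p v) = (K.form p u v : ℂ)
  isotropic_z : ∀ u v : F, modelDeriv ℝ F E z x u = 0 → modelDeriv ℝ F E z x v = 0 → β x u v = 0
  isotropic_w : ∀ u v : F, modelDeriv ℝ F E w x u = 0 → modelDeriv ℝ F E w x v = 0 → β x u v = 0
  form_eq_z : ∀ u v : F, modelDeriv ℝ F E z x u = 0 → β x u v = -(Complex.I * b x u v)
  form_eq_w : ∀ u v : F, modelDeriv ℝ F E w x u = 0 → β x u v = Complex.I * b x u v

lemma BilinField.eventuallyEq_inChart {b b' : BilinField ℂ F M} {x₀ x : M}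
    (hx : x ∈ (chartAt F x₀).source) (h : ∀ᶠ y in 𝓝 x, b y = b' y) :
    b.inChart x₀ =ᶠ[𝓝 (chartAt F x₀ x)] b'.inChart x₀ := by
  have hc := (chartAt F x₀).continuousAt_symm ((chartAt F x₀).map_source hx)
  rw [ContinuousAt, (chartAt F x₀).left_inv hx] at hc
  filter_upwards [hc.eventually h] with y hy using BilinField.inChart_congr hy

variable [IsManifold 𝓘(ℂ, E) ω N]

/-- Every clause of `IsModelAt` depends only on germs at `x`, which allows local models to be glued.
For this reason openness of the image is recorded as `nhds_le`, and integrability of the kernels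
through the coordinates in `coord`. -/
lemma IsModelAt.congr {K : RealAnalyticKahlerStructure E N} {f : N → M}
    {z w z' w' : M → N} {b β b' β' : BilinField ℂ F M} {x : M} (h : IsModelAt K f z w b β x)
    (hz : ∀ᶠ y in 𝓝 x, z' y = z y) (hw : ∀ᶠ y in 𝓝 x, w' y = w y)
    (hb : ∀ᶠ y in 𝓝 x, b' y = b y) (hβ : ∀ᶠ y in 𝓝 x, β' y = β y) :
    IsModelAt K f z' w' b' β' x := by
  have ez := modelDeriv_congr (𝕜 := ℝ) (E := F) (E' := E) hz
  have ew := modelDeriv_congr (𝕜 := ℝ) (E := F) (E' := E) hw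
  have ebx := hb.self_of_nhds
  have eβx := hβ.self_of_nhds
  refine ⟨h.z_holomorphic.congr_of_eventuallyEq hz, h.w_analytic.congr_of_eventuallyEq hw, ?_, ?_,
    ?_, ?_, ?_, ?_, ?_, ?_, ?_, ?_, ?_, ?_, ?_, ?_, ?_, ?_, ?_⟩
  · rw [ew]; exact h.w_anti
  · rw [ez, ew]; exact h.bijective
  · rw [hz.self_of_nhds, hw.self_of_nhds]
    refine h.nhds_le.trans_eq (Filter.map_congr ?_)
    filter_upwards [hz, hw] with y h1 h2
    rw [h1, h2]
  · rw [hz.self_of_nhds, hw.self_of_nhds]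
    exact h.diagonal
  · obtain ⟨φ, hφ⟩ := h.coord
    refine ⟨φ, ?_⟩
    filter_upwards [hφ, hz.eventually_nhds, hw.eventually_nhds] with y h1 h2 h3
    rw [modelDeriv_congr (𝕜 := ℝ) (E := F) (E' := E) h2,
      modelDeriv_congr (𝕜 := ℝ) (E := F) (E' := E) h3]
    exact h1
  · exact h.metric_analytic.congr_of_eventuallyEq
      (BilinField.eventuallyEq_inChart (mem_chart_source F x) hb)
  · rw [ebx]; exact h.metric_symm
  · rw [ebx]; exact h.metric_nondegenerate
  · rw [ebx]; exact h.metric_extends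
  · exact h.form_analytic.congr_of_eventuallyEq
      (BilinField.eventuallyEq_inChart (mem_chart_source F x) hβ)
  · rw [eβx]; exact h.form_alt
  · intro x₀ hx₀
    rw [(BilinField.eventuallyEq_inChart hx₀ hβ).fderiv_eq]
    exact h.form_closed x₀ hx₀
  · rw [eβx]; exact h.form_extends
  · rw [ez, eβx]; exact h.isotropic_z
  · rw [ew, eβx]; exact h.isotropic_w
  · rw [ez, eβx, ebx]; exact h.form_eq_z
  · rw [ew, eβx, ebx]; exact h.form_eq_w

lemma BilinField.inChart_modelDeriv_chartAt (T : BilinField ℝ E N) {p q : N}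
    (hq : q ∈ (chartAt E p).source) (u v : E) :
    T.inChart p (chartAt E p q) (modelDeriv ℝ E E (chartAt E p) q u)
      (modelDeriv ℝ E E (chartAt E p) q v) = T q u v := by
  have h1 : ∀ u : E, modelDeriv ℝ E E (chartAt E p).symm (chartAt E p q)
      (modelDeriv ℝ E E (chartAt E p) q u) = u := by
    intro u
    have h2 := modelDeriv_comp (𝕜 := ℝ) (g := (chartAt E p).symm) (h := chartAt E p) (x := q)
      ((contMDiffAt_chartAt_symm ((chartAt E p).map_source hq)).mdifferentiableAt (by simp))
      ((contMDiffAt_chartAt (X := N) hq).mdifferentiableAt (by simp))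
    have h3 : ∀ᶠ y in 𝓝 q, ((chartAt E p).symm ∘ chartAt E p) y = id y := by
      filter_upwards [(chartAt E p).open_source.mem_nhds hq] with y hy
      exact (chartAt E p).left_inv hy
    rw [modelDeriv_congr h3] at h2
    have h4 : modelDeriv ℝ E E (id : N → N) q = ContinuousLinearMap.id ℝ E := mfderiv_id
    rw [h4] at h2
    exact (congrArg (fun L ↦ L u) h2).symm
  change T ((chartAt E p).symm (chartAt E p q)) (modelDeriv ℝ E E (chartAt E p).symm _ _ : E)
    (modelDeriv ℝ E E (chartAt E p).symm _ _ : E) = _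
  rw [h1, h1, (chartAt E p).left_inv hq]

end LocalModels


/-! ### Models near a single point of `N` -/

section LocalModelExistence

variable {E : Type*} [NormedAddCommGroup E] [NormedSpace ℂ E]
  {N : Type*} [TopologicalSpace N] [ChartedSpace E N] [IsManifold 𝓘(ℂ, E) ω N]
  {F : Type*} [NormedAddCommGroup F] [NormedSpace ℂ F]
  {M : Type*} [TopologicalSpace M] [ChartedSpace F M]

lemma modelDeriv_real_eq {G : Type*} [NormedAddCommGroup G] [NormedSpace ℂ G] {φ : M → G} {x : M}
    (hφ : MDifferentiableAt 𝓘(ℂ, F) 𝓘(ℂ, G) φ x) (u : F) :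
    modelDeriv ℝ F G φ x u = modelDeriv ℂ F G φ x u := hφ.mfderiv_real_apply u

lemma modelDeriv_chartAt_symm_comp {p : N} {φ : M → E × E} {x : M} (L : E × E →L[ℝ] E)
    (hφ : MDifferentiableAt 𝓘(ℂ, F) 𝓘(ℂ, E × E) φ x) (hx : L (φ x) ∈ (chartAt E p).target) (u : F) :
    modelDeriv ℝ F E (fun x ↦ (chartAt E p).symm (L (φ x))) x u =
      modelDeriv ℝ E E (chartAt E p).symm (L (φ x)) (L (modelDeriv ℂ F (E × E) φ x u)) := by
  have hL : MDifferentiableAt 𝓘(ℝ, E × E) 𝓘(ℝ, E) L (φ x) := L.differentiableAt.mdifferentiableAt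
  have h1 := modelDeriv_comp (𝕜 := ℝ) (g := (chartAt E p).symm) (h := L ∘ φ) (x := x)
    ((contMDiffAt_chartAt_symm (X := N) hx).mdifferentiableAt (by simp))
    (hL.comp x hφ.restrictScalars_real)
  rw [modelDeriv_comp hL hφ.restrictScalars_real, modelDeriv_clm] at h1
  rw [← modelDeriv_real_eq hφ]
  exact congrArg (fun L ↦ L u) h1

variable [FiniteDimensional ℂ E] [IsManifold 𝓘(ℂ, F) ω M]

/-- The antilinear involution of `E` as a homeomorphism. -/
def conjHomeo (E : Type*) [NormedAddCommGroup E] [NormedSpace ℂ E] [FiniteDimensional ℂ E] :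
    E ≃ₜ E where
  toFun := conjE E
  invFun := conjE E
  left_inv := conjE_conjE
  right_inv := conjE_conjE
  continuous_toFun := (conjE E).continuous
  continuous_invFun := (conjE E).continuous

lemma conjE_eq_zero {u : E} : conjE E u = 0 ↔ u = 0 :=
  ⟨fun h ↦ by rw [← conjE_conjE u, h, map_zero], fun h ↦ by rw [h, map_zero]⟩

/-- In an adapted chart `φ` and with a coordinate expression `G` of the complexified metric, we
obtain a model near `x`. -/
lemma isModelAt_of_adaptedChart (K : RealAnalyticKahlerStructure E N) {f : N → M} {p : N}
    {φ : M → E × E} {G : E × E → E × E →L[ℂ] E × E →L[ℂ] ℂ} {W : Set M} (hW : IsOpen W)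
    (hf : ∀ q, f q ∈ W → MDifferentiableAt 𝓘(ℝ, E) 𝓘(ℝ, F) f q)
    (hφ : ContMDiffOn 𝓘(ℂ, F) 𝓘(ℂ, E × E) ω φ W)
    (hbij : ∀ x ∈ W, Function.Bijective (modelDeriv ℂ F (E × E) φ x))
    (hmap : ∀ x ∈ W, Filter.map φ (𝓝 x) = 𝓝 (φ x))
    (hφf : ∀ q, f q ∈ W → q ∈ (chartAt E p).source ∧ φ (f q) = diagE E (chartAt E p q))
    (hchart : ∀ x ∈ W, (φ x).1 ∈ (chartAt E p).target ∧ conjE E (φ x).2 ∈ (chartAt E p).target)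
    (hGe : ∀ q, f q ∈ W → ∀ u v, G (diagE E (chartAt E p q)) (diagE E u) (diagE E v) =
      (K.metricField.inChart p (chartAt E p q) u v : ℂ))
    (hGan : ∀ x ∈ W, AnalyticAt ℂ G (φ x)) (hGsymm : ∀ x ∈ W, ∀ u v, G (φ x) u v = G (φ x) v u)
    (hGI : ∀ x ∈ W, ∀ u v, G (φ x) (complexI E u) (complexI E v) = G (φ x) u v)
    (hGnd : ∀ x ∈ W, ∀ u, (∀ v, G (φ x) u v = 0) → u = 0)
    (hcl : ∀ x ∈ W, ∀ u v w, fderiv ℂ (fun x ↦ (G x).comp (complexI E)) (φ x) u v w -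
          fderiv ℂ (fun x ↦ (G x).comp (complexI E)) (φ x) v u w +
          fderiv ℂ (fun x ↦ (G x).comp (complexI E)) (φ x) w u v = 0) :
    ∀ x ∈ W, IsModelAt K f (fun x ↦ (chartAt E p).symm (φ x).1)
      (fun x ↦ (chartAt E p).symm (conjE E (φ x).2)) (BilinField.pullback (F := F) φ G)
      (BilinField.pullback (F := F) φ fun x ↦ (G x).comp (complexI E)) x := by
  set χ := chartAt E p
  have hφd : ∀ x ∈ W, MDifferentiableAt 𝓘(ℂ, F) 𝓘(ℂ, E × E) φ x := fun x hx ↦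
    (hφ.contMDiffAt (hW.mem_nhds hx)).mdifferentiableAt (by simp)
  have hdz : ∀ x ∈ W, ∀ u : F, modelDeriv ℝ F E (fun x ↦ χ.symm (φ x).1) x u =
      modelDeriv ℝ E E χ.symm (φ x).1 (modelDeriv ℂ F (E × E) φ x u).1 := fun x hx u ↦
    modelDeriv_chartAt_symm_comp (ContinuousLinearMap.fst ℝ E E) (hφd x hx) (hchart x hx).1 u
  have hdw : ∀ x ∈ W, ∀ u : F, modelDeriv ℝ F E (fun x ↦ χ.symm (conjE E (φ x).2)) x u =
      modelDeriv ℝ E E χ.symm (conjE E (φ x).2) (conjE E (modelDeriv ℂ F (E × E) φ x u).2) :=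
    fun x hx u ↦ modelDeriv_chartAt_symm_comp
      ((conjE E).comp (ContinuousLinearMap.snd ℝ E E)) (hφd x hx) (hchart x hx).2 u
  have hχb : ∀ y ∈ χ.target, Function.Bijective (modelDeriv ℝ E E χ.symm y) := fun y hy ↦
    bijective_mfderiv_chartAt_symm hy
  have hz0 : ∀ x ∈ W, ∀ u : F, modelDeriv ℝ F E (fun x ↦ χ.symm (φ x).1) x u = 0 ↔
      (modelDeriv ℂ F (E × E) φ x u).1 = 0 := fun x hx u ↦ by
    rw [hdz x hx, map_eq_zero_iff _ (hχb _ (hchart x hx).1).injective]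
  have hw0 : ∀ x ∈ W, ∀ u : F, modelDeriv ℝ F E (fun x ↦ χ.symm (conjE E (φ x).2)) x u = 0 ↔
      (modelDeriv ℂ F (E × E) φ x u).2 = 0 := fun x hx u ↦ by
    rw [hdw x hx, map_eq_zero_iff _ (hχb _ (hchart x hx).2).injective, conjE_eq_zero]
  have hII : ∀ v : E × E, complexI E (complexI E v) = -v := fun v ↦ by
    ext <;> simp [smul_smul]
  have hskew : ∀ x ∈ W, ∀ u v, G (φ x) (complexI E u) v = -G (φ x) (complexI E v) u := by
    intro x hx u v
    rw [← hGI x hx, hII, map_neg, neg_apply, hGsymm x hx]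
  have halt : ∀ x ∈ W, ∀ u, G (φ x) (complexI E u) u = 0 := fun x hx u ↦
    self_eq_neg.1 (hskew x hx u u)
  -- Differentiates `φ ∘ f = diagE ∘ χ`.
  have hfD : ∀ q, f q ∈ W → ∀ u : E, modelDeriv ℂ F (E × E) φ (f q) (modelDeriv ℝ E F f q u) =
      diagE E (modelDeriv ℝ E E χ q u) := by
    intro q hq u
    have hfq := hf q hq
    have h1 := modelDeriv_comp (hφd _ hq).restrictScalars_real hfq
    have h2 : ∀ᶠ q' in 𝓝 q, (φ ∘ f) q' = (diagE E ∘ χ) q' := by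
      filter_upwards [hfq.continuousAt.eventually_mem (hW.mem_nhds hq)] with q' hq'
      exact (hφf q' hq').2
    rw [modelDeriv_congr h2, modelDeriv_comp (diagE E).differentiableAt.mdifferentiableAt
      ((contMDiffAt_chartAt (hφf q hq).1).mdifferentiableAt (by simp)), modelDeriv_clm] at h1
    rw [← modelDeriv_real_eq (hφd _ hq)]
    exact (congrArg (fun L ↦ L u) h1).symm
  have hcz : ∀ v : E × E, v.1 = 0 → complexI E v = -(Complex.I • v) := fun v hv ↦ by
    ext <;> simp [hv]
  have hcw : ∀ v : E × E, v.2 = 0 → complexI E v = Complex.I • v := fun v hv ↦ by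
    ext <;> simp [hv]
  -- Invariance gives `G(u, v) = s² G(u, v) = -G(u, v)` on each eigenspace; this makes both
  -- foliations Lagrangian.
  have hiso : ∀ x ∈ W, ∀ s : ℂ, s * s = -1 → ∀ u v : E × E, complexI E u = s • u →
      complexI E v = s • v → G (φ x) (complexI E u) v = 0 := fun x hx s hs u v hu hv ↦ by
    have h1 := hGI x hx u v
    rw [hu, hv, map_smul, map_smul, smul_apply, smul_smul, hs, neg_smul, one_smul] at h1
    rw [hu, map_smul, smul_apply, self_eq_neg.1 h1.symm, smul_zero]
  have hGω : ∀ x ∈ W, ContDiffAt ℂ ω G (φ x) := fun x hx ↦ (hGan x hx).contDiffAt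
  have hΩω : ∀ x ∈ W, ContDiffAt ℂ ω (fun x ↦ (G x).comp (complexI E)) (φ x) := fun x hx ↦
    (hGω x hx).clm_comp contDiffAt_const
  intro x hx
  have hφx := hφ.contMDiffAt (hW.mem_nhds hx)
  refine ⟨?_, ?_, ?_, ?_, ?_, ?_, ?_, ?_, ?_, ?_, ?_, ?_, ?_, ?_, ?_, ?_, ?_, ?_, ?_⟩
  · have h1 : ContMDiffAt 𝓘(ℂ, E × E) 𝓘(ℂ, E) ω (Prod.fst : E × E → E) (φ x) :=
      contDiff_fst.contDiffAt.contMDiffAt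
    exact (contMDiffAt_chartAt_symm (hchart x hx).1).comp x (h1.comp x hφx)
  · have h1 : ContMDiffAt 𝓘(ℝ, E × E) 𝓘(ℝ, E) ω ((conjE E).comp (ContinuousLinearMap.snd ℝ E E))
      (φ x) := (ContinuousLinearMap.contDiff _).contDiffAt.contMDiffAt
    exact (contMDiffAt_chartAt_symm (X := N) (hchart x hx).2).comp x
      (h1.comp x hφx.restrictScalars_real)
  · intro u
    rw [hdw x hx, hdw x hx, map_smul, Prod.smul_snd, conjE_I_smul, map_neg,
      mfderiv_chartAt_symm_I (hchart x hx).2]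
  · have h1 : (fun u ↦ (modelDeriv ℝ F E (fun x ↦ χ.symm (φ x).1) x u,
        modelDeriv ℝ F E (fun x ↦ χ.symm (conjE E (φ x).2)) x u)) =
        Prod.map (modelDeriv ℝ E E χ.symm (φ x).1)
          (modelDeriv ℝ E E χ.symm (conjE E (φ x).2) ∘ conjHomeo E) ∘
          modelDeriv ℂ F (E × E) φ x := by
      funext u
      rw [hdz x hx, hdw x hx]
      rfl
    rw [h1]
    exact ((hχb _ (hchart x hx).1).prodMap
      ((hχb _ (hchart x hx).2).comp (conjHomeo E).bijective)).comp (hbij x hx)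
  · have h1 : (fun x ↦ (χ.symm (φ x).1, χ.symm (conjE E (φ x).2))) =
        Prod.map χ.symm (χ.symm ∘ conjHomeo E) ∘ φ := rfl
    have a1 := χ.symm.map_nhds_eq (hchart x hx).1
    -- All the factors of `(z, w)` are local homeomorphisms, so neighbourhoods go to neighbourhoods.
    have a2 : Filter.map (χ.symm ∘ conjHomeo E) (𝓝 (φ x).2) = 𝓝 (χ.symm (conjE E (φ x).2)) := by
      rw [← Filter.map_map, (conjHomeo E).map_nhds_eq]
      exact χ.symm.map_nhds_eq (hchart x hx).2
    have a3 : 𝓝 (φ x) = 𝓝 (φ x).1 ×ˢ 𝓝 (φ x).2 := nhds_prod_eq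
    rw [h1, ← Filter.map_map, hmap x hx, a3, nhds_prod_eq, ← a1, ← a2, Filter.prod_map_map_eq]
    rfl
  · rintro q rfl
    obtain ⟨h1, h2⟩ := hφf q hx
    rw [h2]
    simp [χ, h1]
  · refine ⟨φ, ?_⟩
    filter_upwards [hW.mem_nhds hx] with y hy
    exact ⟨hφ.contMDiffAt (hW.mem_nhds hy), hbij y hy, fun u ↦ ⟨hz0 y hy u, hw0 y hy u⟩⟩
  · exact (BilinField.isAnalyticOn_iff hW).1 (BilinField.pullback_isAnalyticOn hW hφ hGω) x hx
  · exact fun u v ↦ hGsymm x hx _ _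
  · intro u hu
    have h1 : modelDeriv ℂ F (E × E) φ x u = 0 := by
      refine hGnd x hx _ fun v ↦ ?_
      obtain ⟨v, rfl⟩ := (hbij x hx).surjective v
      exact hu v
    exact (map_eq_zero_iff _ (hbij x hx).injective).1 h1
  · rintro q rfl u v
    change G (φ (f q)) (modelDeriv ℂ F (E × E) φ (f q) (modelDeriv ℝ E F f q u))
      (modelDeriv ℂ F (E × E) φ (f q) (modelDeriv ℝ E F f q v)) = _
    rw [hfD q hx, hfD q hx, (hφf q hx).2, hGe q hx,
      BilinField.inChart_modelDeriv_chartAt _ (hφf q hx).1]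
  · exact (BilinField.isAnalyticOn_iff hW).1 (BilinField.pullback_isAnalyticOn hW hφ hΩω) x hx
  · exact fun u ↦ halt x hx _
  · intro x₀ hx₀
    refine BilinField.pullback_isClosedOn hW hφ (fun y hy ↦ (hΩω y hy).of_le le_top) halt hcl x₀
      (chartAt F x₀ x) ((chartAt F x₀).map_source hx₀) ?_
    rwa [(chartAt F x₀).left_inv hx₀]
  · rintro q rfl u v
    change G (φ (f q)) (complexI E (modelDeriv ℂ F (E × E) φ (f q) (modelDeriv ℝ E F f q u)))
      (modelDeriv ℂ F (E × E) φ (f q) (modelDeriv ℝ E F f q v)) = _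
    rw [hfD q hx, hfD q hx, (hφf q hx).2, complexI_diagE, hGe q hx,
      ← BilinField.inChart_modelDeriv_chartAt _ (hφf q hx).1,
      K.form_inChart (χ.map_source (hφf q hx).1)]
    rfl
  · intro u v hu hv
    rw [hz0 x hx] at hu hv
    exact hiso x hx (-Complex.I) (by simp) _ _ ((hcz _ hu).trans (neg_smul _ _).symm)
      ((hcz _ hv).trans (neg_smul _ _).symm)
  · intro u v hu hv
    rw [hw0 x hx] at hu hv
    exact hiso x hx Complex.I Complex.I_mul_I _ _ (hcw _ hu) (hcw _ hv)
  · intro u v hu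
    rw [hz0 x hx] at hu
    change G (φ x) (complexI E (modelDeriv ℂ F (E × E) φ x u)) (modelDeriv ℂ F (E × E) φ x v) =
      -(Complex.I * G (φ x) (modelDeriv ℂ F (E × E) φ x u) (modelDeriv ℂ F (E × E) φ x v))
    rw [hcz _ hu, map_neg, map_smul]
    rfl
  · intro u v hu
    rw [hw0 x hx] at hu
    change G (φ x) (complexI E (modelDeriv ℂ F (E × E) φ x u)) (modelDeriv ℂ F (E × E) φ x v) =
      Complex.I * G (φ x) (modelDeriv ℂ F (E × E) φ x u) (modelDeriv ℂ F (E × E) φ x v)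
    rw [hcw _ hu, map_smul]
    rfl

/-- Every point of `N` has a neighbourhood in `M` with a model. -/
lemma IsComplexification.exists_localModel [FiniteDimensional ℂ F] {f : N → M}
    (hf : IsComplexification E F f) (K : RealAnalyticKahlerStructure E N) (p : N) :
    ∃ (z w : M → N) (b β : BilinField ℂ F M) (W : Set M), IsOpen W ∧ f p ∈ W ∧
      InjOn (fun x ↦ (z x, w x)) W ∧ ∀ x ∈ W, IsModelAt K f z w b β x := by
  obtain ⟨φ, σ, W, hWo, hpW, hφ, hbij, hσφ, hmap, -, hφf⟩ := hf.exists_adaptedChart p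
  obtain ⟨G, hGe, hG⟩ := K.exists_extension p
  have hχt : (chartAt E p).target ∈ 𝓝 (chartAt E p p) :=
    (chartAt E p).open_target.mem_nhds (mem_chart_target E p)
  have e1 : ∀ᶠ v in 𝓝 (diagE E (chartAt E p p)), v.1 ∈ (chartAt E p).target :=
    continuous_fst.continuousAt.eventually_mem hχt
  have e2 : ∀ᶠ v in 𝓝 (diagE E (chartAt E p p)), conjE E v.2 ∈ (chartAt E p).target :=
    (by fun_prop : Continuous fun v : E × E ↦ conjE E v.2).continuousAt.eventually_mem
      (by simpa using hχt)
  have hφc := (hφ.contMDiffAt (hWo.mem_nhds hpW)).continuousAt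
  rw [ContinuousAt, (hφf p hpW).2] at hφc
  -- The embedding property again turns a condition near `p` in `N` into one near `f p` in `M`.
  have e3 : ∀ᶠ x in 𝓝 (f p), ∀ q, f q = x → ∀ u v,
      G (diagE E (chartAt E p q)) (diagE E u) (diagE E v) =
        (K.metricField.inChart p (chartAt E p q) u v : ℂ) := by
    rw [← Filter.eventually_comap, ← hf.isEmbedding.isInducing.nhds_eq_comap]
    exact ((chartAt E p).continuousAt (mem_chart_source E p)).eventually hGe
  obtain ⟨O, hO, hOo, hpO⟩ := eventually_nhds_iff.1
    (((hφc.eventually ((e1.and e2).and hG)).and e3).and (hWo.mem_nhds hpW))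
  refine ⟨_, _, _, _, O, hOo, hpO, ?_, isModelAt_of_adaptedChart K (φ := φ) (G := G) (p := p) hOo
    (fun q _ ↦ (hf.analytic q).mdifferentiableAt (by simp))
    (hφ.mono fun x hx ↦ (hO x hx).2) (fun x hx ↦ hbij x (hO x hx).2)
    (fun x hx ↦ hmap x (hO x hx).2) (fun q hq ↦ hφf q (hO _ hq).2) (fun x hx ↦ (hO x hx).1.1.1)
    (fun q hq ↦ (hO _ hq).1.2 q rfl) (fun x hx ↦ (hO x hx).1.1.2.1)
    (fun x hx ↦ (hO x hx).1.1.2.2.1) (fun x hx ↦ (hO x hx).1.1.2.2.2.1)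
    (fun x hx ↦ (hO x hx).1.1.2.2.2.2.1) (fun x hx ↦ (hO x hx).1.1.2.2.2.2.2)⟩
  intro x hx y hy hxy
  obtain ⟨h1, h2⟩ := Prod.mk.inj hxy
  obtain ⟨⟨⟨⟨h3, h4⟩, -⟩, -⟩, h5⟩ := hO x hx
  obtain ⟨⟨⟨⟨h3', h4'⟩, -⟩, -⟩, h5'⟩ := hO y hy
  have h6 := (chartAt E p).symm.injOn h3 h3' h1
  have h7 := (conjHomeo E).injective ((chartAt E p).symm.injOn h4 h4' h2)
  rw [← hσφ x h5, ← hσφ y h5', Prod.ext h6 h7]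

end LocalModelExistence


/-! ### Gluing germs along a subset -/

section Gluing

/-- Local sections whose germs agree along a subset `A` of a metrizable space come, near every
point of an open neighbourhood of `A`, from one global section. -/
lemma exists_glue_of_eventually_eq {M : Type*} [TopologicalSpace M]
    [TopologicalSpace.MetrizableSpace M] {ι : Type*} [Nonempty ι] {T : M → Type*} {A : Set M}
    {W : ι → Set M} (hW : ∀ i, IsOpen (W i)) (hA : A ⊆ ⋃ i, W i) (h : ι → ∀ x, T x)
    (hcompat : ∀ i j, ∀ x ∈ A, x ∈ W i → x ∈ W j → ∀ᶠ y in 𝓝 x, h i y = h j y) :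
    ∃ U : Set M, IsOpen U ∧ A ⊆ U ∧ ∃ H : ∀ x, T x, ∀ x ∈ U, ∃ i, x ∈ W i ∧
      ∀ᶠ y in 𝓝 x, H y = h i y := by
  classical
  set Ω : Set M := ⋃ i, W i with hΩ
  have hΩo : IsOpen Ω := isOpen_iUnion hW
  let _ : MetricSpace Ω := TopologicalSpace.metrizableSpaceMetric Ω
  obtain ⟨v, hvo, hvU, hvf, hvW⟩ := precise_refinement (X := Ω) (fun i ↦ Subtype.val ⁻¹' W i)
    (fun i ↦ (hW i).preimage continuous_subtype_val) (by
      ext x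
      simpa using mem_iUnion.1 x.2)
  -- Paracompactness and normality of the metrizable `Ω` give a locally finite cover by closed sets
  -- `C i` inside the `W i`.
  obtain ⟨C, hCU, hCc, hCv⟩ := exists_iUnion_eq_closed_subset hvo (fun x ↦ hvf.point_finite x) hvU
  have hCf : LocallyFinite C := hvf.subset hCv
  let D : ι → Set M := fun i ↦ Subtype.val '' C i
  have hDW : ∀ i, D i ⊆ W i := by
    rintro i _ ⟨x, hx, rfl⟩
    exact hvW i (hCv i hx)
  have hDfin : ∀ x, {i | x ∈ D i}.Finite := by
    intro x
    by_cases hx : x ∈ Ω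
    · refine (hCf.point_finite ⟨x, hx⟩).subset ?_
      rintro i ⟨y, hy, rfl⟩
      exact hy
    · refine Set.finite_empty.subset ?_
      rintro i ⟨y, hy, rfl⟩
      exact hx y.2
  have hDcov : ∀ x ∈ Ω, ∃ i, x ∈ D i := by
    intro x hx
    have : (⟨x, hx⟩ : Ω) ∈ ⋃ i, C i := by rw [hCU]; trivial
    obtain ⟨i, hi⟩ := mem_iUnion.1 this
    exact ⟨i, _, hi, rfl⟩
  -- Closedness and local finiteness: near `x` only the pieces through `x` are met.
  have hDnear : ∀ x ∈ Ω, ∀ᶠ y in 𝓝 x, y ∈ Ω ∧ ∀ i, y ∈ D i → x ∈ D i := by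
    intro x hx
    have h1 := hCf.iInter_compl_mem_nhds hCc ⟨x, hx⟩
    have h2 := hΩo.isOpenEmbedding_subtypeVal.map_nhds_eq ⟨x, hx⟩
    rw [← h2, Filter.eventually_map]
    filter_upwards [h1] with y hy
    refine ⟨y.2, ?_⟩
    rintro i ⟨y', hy', hyy⟩
    obtain rfl := Subtype.ext hyy
    by_contra hxi
    have hxC : (⟨x, hx⟩ : Ω) ∉ C i := fun h ↦ hxi ⟨_, h, rfl⟩
    exact (mem_iInter.1 (mem_iInter.1 hy i) hxC) hy'
  let idx : M → ι := fun x ↦ if hx : ∃ i, x ∈ D i then hx.choose else Classical.arbitrary ι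
  have hidx : ∀ x ∈ Ω, x ∈ D (idx x) := by
    intro x hx
    simp only [idx, dif_pos (hDcov x hx)]
    exact (hDcov x hx).choose_spec
  -- At each point only finitely many agreements are required, and by `hDnear` no new ones appear
  -- nearby, so the set is open. On it the choice made by `idx` does not affect the germ.
  refine ⟨{x | x ∈ Ω ∧ ∀ i j, x ∈ D i → x ∈ D j → ∀ᶠ y in 𝓝 x, h i y = h j y}, ?_, ?_,
    fun x ↦ h (idx x) x, ?_⟩
  · rw [isOpen_iff_mem_nhds]
    rintro x ⟨hx, hxD⟩
    have h1 : ∀ᶠ y in 𝓝 x, ∀ i ∈ {i | x ∈ D i}, ∀ j ∈ {i | x ∈ D i},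
        ∀ᶠ y' in 𝓝 y, h i y' = h j y' :=
      (Filter.eventually_all_finite (hDfin x)).2 fun i hi ↦
        (Filter.eventually_all_finite (hDfin x)).2 fun j hj ↦ (hxD i j hi hj).eventually_nhds
    filter_upwards [h1, hDnear x hx] with y h1 h2
    exact ⟨h2.1, fun i j hi hj ↦ h1 i (h2.2 i hi) j (h2.2 j hj)⟩
  · exact fun x hx ↦ ⟨hA hx, fun i j hi hj ↦ hcompat i j x hx (hDW i hi) (hDW j hj)⟩
  · rintro x ⟨hx, hxD⟩
    refine ⟨idx x, hDW _ (hidx x hx), ?_⟩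
    have h1 : ∀ᶠ y in 𝓝 x, ∀ i ∈ {i | x ∈ D i}, h i y = h (idx x) y :=
      (Filter.eventually_all_finite (hDfin x)).2 fun i hi ↦ hxD i (idx x) hi (hidx x hx)
    filter_upwards [h1, hDnear x hx] with y h1 h2
    exact h1 _ (h2.2 _ (hidx y h2.1))

/-- A map that is injective near every point of an embedded `N` and restricts on `N` to a map with a
continuous retraction is injective on a neighbourhood of `N`. -/
lemma exists_isOpen_injOn {M N P : Type*} [TopologicalSpace M]
    [TopologicalSpace.MetrizableSpace M] [TopologicalSpace N] {f : N → M} (hf : Continuous f)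
    {z : M → N} {w : M → P} (hz : ∀ p, z (f p) = p) (hzc : ∀ p, ContinuousAt z (f p))
    (hinj : ∀ p, ∃ O ∈ 𝓝 (f p), InjOn (fun x ↦ (z x, w x)) O) :
    ∃ U : Set M, IsOpen U ∧ range f ⊆ U ∧ InjOn (fun x ↦ (z x, w x)) U := by
  let _ : MetricSpace M := TopologicalSpace.metrizableSpaceMetric M
  have h1 : ∀ p, ∃ s > 0, InjOn (fun x ↦ (z x, w x)) (Metric.ball (f p) (3 * s)) := by
    intro p
    obtain ⟨O, hO, hOi⟩ := hinj p
    obtain ⟨ε, hε, hεO⟩ := Metric.mem_nhds_iff.1 hO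
    exact ⟨ε / 3, by positivity, hOi.mono (by rwa [mul_div_cancel₀ ε (by norm_num)])⟩
  choose s hs hinj' using h1
  have h2 : ∀ p, ∃ C, IsOpen C ∧ f p ∈ C ∧ ∀ x ∈ C, dist x (f p) < s p ∧
      dist (f (z x)) (f p) < s p := by
    intro p
    have h3 : Filter.Tendsto (fun x ↦ f (z x)) (𝓝 (f p)) (𝓝 (f p)) := by
      have := ContinuousAt.comp (g := f) hf.continuousAt (hzc p)
      rw [ContinuousAt, Function.comp_apply, hz] at this
      exact this
    have h4 : ∀ᶠ x in 𝓝 (f p), dist x (f p) < s p := Metric.ball_mem_nhds (f p) (hs p)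
    obtain ⟨C, hC, hCo, hpC⟩ := eventually_nhds_iff.1 (h4.and (h3.eventually h4))
    exact ⟨C, hCo, hpC, hC⟩
  choose C hCo hpC hC using h2
  -- Going from `y` to `f p` through `f q` and `f (z y) = f (z x)` costs less than `s q + s q + s p
  -- ≤ 3 * s p`. So both points lie in the ball around `f p` where injectivity is known.
  have key : ∀ p q x y, s q ≤ s p → x ∈ C p → y ∈ C q → z x = z y → w x = w y → x = y := by
    intro p q x y hpq hx hy hzz hww
    obtain ⟨h3, h4⟩ := hC p x hx
    obtain ⟨h5, h6⟩ := hC q y hy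
    refine hinj' p ?_ ?_ (Prod.ext hzz hww)
    · rw [Metric.mem_ball]
      linarith [hs p]
    · rw [Metric.mem_ball]
      have h7 := dist_triangle y (f q) (f p)
      have h8 := dist_triangle (f q) (f (z x)) (f p)
      rw [hzz] at h4 h8
      linarith [dist_comm (f q) (f (z y))]
  refine ⟨⋃ p, C p, isOpen_iUnion hCo, ?_, ?_⟩
  · rintro _ ⟨p, rfl⟩
    exact mem_iUnion.2 ⟨p, hpC p⟩
  · intro x hx y hy hxy
    obtain ⟨p, hp⟩ := mem_iUnion.1 hx
    obtain ⟨q, hq⟩ := mem_iUnion.1 hy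
    obtain ⟨hzz, hww⟩ := Prod.mk.inj hxy
    rcases le_total (s q) (s p) with hpq | hpq
    · exact key p q x y hpq hp hq hzz hww
    · exact (key q p y x hpq hq hp hzz.symm hww.symm).symm

end Gluing

/-! ### The glued model on a neighbourhood of `N` -/

section GlobalModel

variable {E : Type*} [NormedAddCommGroup E] [NormedSpace ℂ E] [FiniteDimensional ℂ E]
  {N : Type*} [TopologicalSpace N] [ChartedSpace E N] [IsManifold 𝓘(ℂ, E) ω N]
  {F : Type*} [NormedAddCommGroup F] [NormedSpace ℂ F] [FiniteDimensional ℂ F]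
  {M : Type*} [TopologicalSpace M] [ChartedSpace F M] [IsManifold 𝓘(ℂ, F) ω M]

omit [FiniteDimensional ℂ E] [FiniteDimensional ℂ F] in
lemma isAnalyticOn_metric_of_isModelAt {K : RealAnalyticKahlerStructure E N} {f : N → M}
    {z w : M → N} {b β : BilinField ℂ F M} {W : Set M} (hW : IsOpen W)
    (h : ∀ x ∈ W, IsModelAt K f z w b β x) : b.IsAnalyticOn W :=
  (BilinField.isAnalyticOn_iff hW).2 fun x hx ↦ (h x hx).metric_analytic

omit [FiniteDimensional ℂ E] [FiniteDimensional ℂ F] in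
lemma isAnalyticOn_form_of_isModelAt {K : RealAnalyticKahlerStructure E N} {f : N → M}
    {z w : M → N} {b β : BilinField ℂ F M} {W : Set M} (hW : IsOpen W)
    (h : ∀ x ∈ W, IsModelAt K f z w b β x) : β.IsAnalyticOn W :=
  (BilinField.isAnalyticOn_iff hW).2 fun x hx ↦ (h x hx).form_analytic

omit [FiniteDimensional ℂ E] [FiniteDimensional ℂ F] [IsManifold 𝓘(ℂ, F) ω M] in
lemma IsModelAt.isAntiholomorphicAt {K : RealAnalyticKahlerStructure E N} {f : N → M}
    {z w : M → N} {b β : BilinField ℂ F M} {x : M} (h : IsModelAt K f z w b β x) :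
    IsAntiholomorphicAt E F w x :=
  ⟨h.w_analytic.mdifferentiableAt (by simp), h.w_anti⟩

/-- Two models agree near the points of `N`. -/
lemma IsComplexification.eventually_model_eq {f : N → M} (hf : IsComplexification E F f)
    {K : RealAnalyticKahlerStructure E N} {z w z' w' : M → N} {b β b' β' : BilinField ℂ F M}
    {W W' : Set M} (hW : IsOpen W) (hW' : IsOpen W') (h : ∀ x ∈ W, IsModelAt K f z w b β x)
    (h' : ∀ x ∈ W', IsModelAt K f z' w' b' β' x) {p : N} (hp : f p ∈ W) (hp' : f p ∈ W') :
    ∀ᶠ x in 𝓝 (f p), z x = z' x ∧ w x = w' x ∧ b x = b' x ∧ β x = β' x := by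
  have hx : ∀ᶠ x in 𝓝 (f p), x ∈ W ∧ x ∈ W' :=
    Filter.inter_mem (hW.mem_nhds hp) (hW'.mem_nhds hp')
  have hq : ∀ᶠ q in 𝓝 p, f q ∈ W ∧ f q ∈ W' := hf.isEmbedding.continuous.continuousAt.eventually hx
  have e1 := hf.eventually_eq_of_holomorphic p (z := z) (z' := z')
    (hx.mono fun x hx ↦ (h x hx.1).z_holomorphic.mdifferentiableAt (by simp))
    (hx.mono fun x hx ↦ (h' x hx.2).z_holomorphic.mdifferentiableAt (by simp))
    (hq.mono fun q hq ↦ ⟨((h _ hq.1).diagonal q rfl).1, ((h' _ hq.2).diagonal q rfl).1⟩)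
  have e2 := hf.eventually_eq_of_antiholomorphic p (w := w) (w' := w')
    (hx.mono fun x hx ↦ (h x hx.1).isAntiholomorphicAt)
    (hx.mono fun x hx ↦ (h' x hx.2).isAntiholomorphicAt)
    (hq.mono fun q hq ↦ ⟨((h _ hq.1).diagonal q rfl).2, ((h' _ hq.2).diagonal q rfl).2⟩)
  have e3 := hf.eventually_bilinField_eq p hW hW' hp hp' (isAnalyticOn_metric_of_isModelAt hW h)
    (isAnalyticOn_metric_of_isModelAt hW' h') (hq.mono fun q hq u v ↦
      ((h _ hq.1).metric_extends q rfl u v).trans ((h' _ hq.2).metric_extends q rfl u v).symm)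
  have e4 := hf.eventually_bilinField_eq p hW hW' hp hp' (isAnalyticOn_form_of_isModelAt hW h)
    (isAnalyticOn_form_of_isModelAt hW' h') (hq.mono fun q hq u v ↦
      ((h _ hq.1).form_extends q rfl u v).trans ((h' _ hq.2).form_extends q rfl u v).symm)
  filter_upwards [e1, e2, e3, e4] with x h1 h2 h3 h4 using ⟨h1, h2, h3, h4⟩

/-- A global model on a neighbourhood of `N`. -/
lemma IsComplexification.exists_model [T2Space M] [SecondCountableTopology M] [Nonempty N]
    {f : N → M} (hf : IsComplexification E F f) (K : RealAnalyticKahlerStructure E N) :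
    ∃ (z w : M → N) (b β : BilinField ℂ F M) (U : Set M), IsOpen U ∧ range f ⊆ U ∧
      InjOn (fun x ↦ (z x, w x)) U ∧ ∀ x ∈ U, IsModelAt K f z w b β x := by
  have : ProperSpace F := FiniteDimensional.proper ℂ F
  have : LocallyCompactSpace M := ChartedSpace.locallyCompactSpace F M
  have : TopologicalSpace.MetrizableSpace M :=
    TopologicalSpace.metrizableSpace_of_t3_secondCountable M
  choose z w b β W hWo hpW hinj hmod using hf.exists_localModel K
  -- The four objects are glued as one tuple, so that near each point they all come from the same
  -- local model.
  obtain ⟨U, hU, hfU, H, hH⟩ := exists_glue_of_eventually_eq (A := range f) (W := W) hWo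
    (by rintro _ ⟨p, rfl⟩; exact mem_iUnion.2 ⟨p, hpW p⟩)
    (fun p x ↦ ((z p x, w p x), (b p x, β p x))) (by
      rintro p q _ ⟨r, rfl⟩ hp hq
      filter_upwards [hf.eventually_model_eq (hWo p) (hWo q) (hmod p) (hmod q) hp hq] with x hx
      rw [hx.1, hx.2.1, hx.2.2.1, hx.2.2.2])
  have hmod' : ∀ x ∈ U, IsModelAt K f (fun x ↦ (H x).1.1) (fun x ↦ (H x).1.2) (fun x ↦ (H x).2.1)
      (fun x ↦ (H x).2.2) x := by
    intro x hx
    obtain ⟨p, hxp, hev⟩ := hH x hx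
    refine (hmod p x hxp).congr ?_ ?_ ?_ ?_ <;> filter_upwards [hev] with y hy <;> rw [hy]
  obtain ⟨U', hU', hfU', hinj'⟩ := exists_isOpen_injOn (f := f) (z := fun x ↦ (H x).1.1)
    (w := fun x ↦ (H x).1.2) hf.isEmbedding.continuous
    (fun p ↦ ((hmod' _ (hfU ⟨p, rfl⟩)).diagonal p rfl).1)
    (fun p ↦ (hmod' _ (hfU ⟨p, rfl⟩)).z_holomorphic.continuousAt) (fun p ↦ by
      obtain ⟨q, hq, hev⟩ := hH _ (hfU ⟨p, rfl⟩)
      refine ⟨_, Filter.inter_mem hev ((hWo q).mem_nhds hq), fun x hx y hy hxy ↦ ?_⟩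
      have hx1 : H x = _ := hx.1
      have hy1 : H y = _ := hy.1
      refine hinj q hx.2 hy.2 ?_
      simp only [hx1, hy1] at hxy
      exact hxy)
  exact ⟨_, _, _, _, U ∩ U', hU.inter hU', subset_inter hfU hfU', hinj'.mono inter_subset_right,
    fun x hx ↦ hmod' x hx.1⟩

end GlobalModel


/-! ### Foliations by kernels and the canonical pair -/

section ParaComplex

variable {F : Type*} [NormedAddCommGroup F] [NormedSpace ℂ F]
  {M : Type*} [TopologicalSpace M] [ChartedSpace F M] [IsManifold 𝓘(ℂ, F) ω M] {U : Set M}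

/-- With projections `P₁ + P₂ = 1` and `F = P₁ - P₂`, the equation `F u = u` means `2 P₂ u = 0`. -/
lemma ComplexBiLagrangian.mem_fol₁_iff (S : ComplexBiLagrangian F U) {x : M} (hx : x ∈ U)
    (u : TangentSpace 𝓘(ℂ, F) x) : u ∈ S.fol₁.tangent x ↔ S.paraComplex x hx u = u := by
  have h1 := Submodule.projection_add_projection_eq_self (S.transverse x hx) u
  have h2 := Submodule.projection_apply_eq_zero_iff (S.transverse x hx).symm (x := u)
  rw [← h2, ComplexBiLagrangian.paraComplex, LinearMap.sub_apply]
  constructor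
  · intro h
    rw [h, add_zero] at h1
    rw [h, sub_zero, h1]
  · intro h
    rw [sub_eq_iff_eq_add] at h
    have h3 := h1
    rw [h, add_assoc, add_eq_left, ← two_smul ℂ] at h3
    exact (smul_eq_zero.1 h3).resolve_left two_ne_zero

lemma ComplexBiLagrangian.mem_fol₂_iff (S : ComplexBiLagrangian F U) {x : M} (hx : x ∈ U)
    (u : TangentSpace 𝓘(ℂ, F) x) : u ∈ S.fol₂.tangent x ↔ S.paraComplex x hx u = -u := by
  have h1 := Submodule.projection_add_projection_eq_self (S.transverse x hx) u
  have h2 := Submodule.projection_apply_eq_zero_iff (S.transverse x hx) (x := u)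
  rw [← h2, ComplexBiLagrangian.paraComplex, LinearMap.sub_apply]
  constructor
  · intro h
    rw [h, zero_add] at h1
    rw [h, zero_sub, h1]
  · intro h
    have h3 : (2 : ℂ) • (S.fol₁.tangent x).projection _ (S.transverse x hx) u = u + -u := by
      rw [← h, two_smul]
      nth_rewrite 3 [← h1]
      abel
    rw [add_neg_cancel] at h3
    exact (smul_eq_zero.1 h3).resolve_left two_ne_zero

/-- A complex bi-Lagrangian structure is determined by its symplectic form and its metric. -/
lemma ComplexBiLagrangian.same_of_isMetric {S S' : ComplexBiLagrangian F U}
    {g g' : BilinField ℂ F M} (hg : S.IsMetric g) (hg' : S'.IsMetric g')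
    (hform : ∀ x ∈ U, S'.form x = S.form x) (hgg : ∀ x ∈ U, g' x = g x) : S'.Same S := by
  intro x hx
  -- `g(F' u, v)` and `g(F u, v)` both equal the common form, and `g` is nondegenerate.
  have hP : ∀ u, S'.paraComplex x hx u = S.paraComplex x hx u := by
    intro u
    refine sub_eq_zero.1 (hg.1.nondegenerate x hx _ fun v ↦ ?_)
    rw [map_sub, sub_apply, ← hg.2 x hx, ← hgg x hx, ← hg'.2 x hx, hform x hx,
      sub_self]
  refine ⟨hform x hx, ?_, ?_⟩
  · ext u
    rw [S'.mem_fol₁_iff hx, S.mem_fol₁_iff hx, hP]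
  · ext u
    rw [S'.mem_fol₂_iff hx, S.mem_fol₂_iff hx, hP]

end ParaComplex

/-! ### Foliations by the fibres of `z` and `w` -/

section KernelFoliation

variable {E : Type*} [NormedAddCommGroup E] [NormedSpace ℂ E]
  {N : Type*} [TopologicalSpace N] [ChartedSpace E N]
  {F : Type*} [NormedAddCommGroup F] [NormedSpace ℂ F]
  {M : Type*} [TopologicalSpace M] [ChartedSpace F M]

variable (E F) in
/-- The largest complex subspace of the kernel of the differential of a map. -/
def complexKernel (a : M → N) (x : M) : Submodule ℂ F where
  -- The second condition makes this a complex subspace for every `a`; it is automatic when the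
  -- kernel is that of a complex linear map, as for `z` and `w`.
  carrier := {u | modelDeriv ℝ F E a x u = 0 ∧ modelDeriv ℝ F E a x (Complex.I • u) = 0}
  zero_mem' := by simp
  add_mem' := by
    rintro u v ⟨h1, h2⟩ ⟨h3, h4⟩
    exact ⟨by rw [map_add, h1, h3, add_zero], by rw [smul_add, map_add, h2, h4, add_zero]⟩
  smul_mem' := by
    rintro c u ⟨h1, h2⟩
    have hc : ∀ v : F, c • v = c.re • v + c.im • (Complex.I • v) := by
      intro v
      conv_lhs => rw [← Complex.re_add_im c]
      rw [add_smul, mul_smul, ← Complex.coe_smul, ← Complex.coe_smul]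
    constructor
    · rw [hc, map_add, map_smul, map_smul, h1, h2, smul_zero, smul_zero, add_zero]
    · have hI : Complex.I • c • u = c.re • (Complex.I • u) + c.im • -u := by
        rw [smul_comm, hc, smul_smul Complex.I, Complex.I_mul_I, neg_one_smul]
      rw [hI, map_add, map_smul _ c.re, map_smul _ c.im, h2, map_neg, h1, neg_zero, smul_zero,
        smul_zero, add_zero]

lemma complexKernel_eq_ker {G : Type*} [NormedAddCommGroup G] [NormedSpace ℂ G] {a : M → N} {x : M}
    (L : F →L[ℂ] G) (h : ∀ u, modelDeriv ℝ F E a x u = 0 ↔ L u = 0) :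
    complexKernel E F a x = L.ker := by
  ext u
  have hu : u ∈ complexKernel E F a x ↔
      modelDeriv ℝ F E a x u = 0 ∧ modelDeriv ℝ F E a x (Complex.I • u) = 0 := Iff.rfl
  have hL : u ∈ L.ker ↔ L u = 0 := Iff.rfl
  rw [hu, hL, h, h, map_smul]
  refine ⟨fun h ↦ h.1, fun h ↦ ⟨h, by rw [h, smul_zero]⟩⟩

/-- The kernels of the differential of `a` are, near the points of `U`, those of a holomorphic
submersion. -/
def IsLocallyHolomorphicKernel (E F : Type*) [NormedAddCommGroup E] [NormedSpace ℂ E]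
    [NormedAddCommGroup F] [NormedSpace ℂ F]
    {N : Type*} [TopologicalSpace N] [ChartedSpace E N]
    {M : Type*} [TopologicalSpace M] [ChartedSpace F M] (a : M → N) (U : Set M) : Prop :=
  ∀ x ∈ U, ∃ φ : M → E, ∀ᶠ y in 𝓝 x, ContMDiffAt 𝓘(ℂ, F) 𝓘(ℂ, E) ω φ y ∧
    Function.Surjective (modelDeriv ℂ F E φ y) ∧
    ∀ u, modelDeriv ℝ F E a y u = 0 ↔ modelDeriv ℂ F E φ y u = 0

lemma IsLocallyHolomorphicKernel.mem_complexKernel_iff {a : M → N} {U : Set M}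
    (h : IsLocallyHolomorphicKernel E F a U) {x : M} (hx : x ∈ U) {u : F} :
    u ∈ complexKernel E F a x ↔ modelDeriv ℝ F E a x u = 0 := by
  obtain ⟨φ, hφ⟩ := h x hx
  obtain ⟨-, -, h3⟩ := hφ.self_of_nhds
  rw [complexKernel_eq_ker _ h3, h3]
  rfl

lemma IsLocallyHolomorphicKernel.finrank_add [FiniteDimensional ℂ F] {a : M → N} {U : Set M}
    (h : IsLocallyHolomorphicKernel E F a U) {x : M} (hx : x ∈ U) :
    Module.finrank ℂ E + Module.finrank ℂ (complexKernel E F a x) = Module.finrank ℂ F := by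
  obtain ⟨φ, hφ⟩ := h x hx
  obtain ⟨-, h2, h3⟩ := hφ.self_of_nhds
  rw [complexKernel_eq_ker _ h3,
    ← LinearMap.finrank_range_add_finrank_ker (modelDeriv ℂ F E φ x).toLinearMap,
    LinearMap.range_eq_top.2 h2, finrank_top]

/-- The foliation by the fibres of a map. -/
def kernelFoliation [FiniteDimensional ℂ E] {a : M → N} {U : Set M} (hU : IsOpen U)
    (h : IsLocallyHolomorphicKernel E F a U) : HolomorphicFoliation F U where
  tangent := complexKernel E F a
  integrable := by
    intro x hx
    obtain ⟨φ, hφ⟩ := h x hx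
    obtain ⟨V, hV, hVo, hxV⟩ := eventually_nhds_iff.1 (hφ.and (hU.mem_nhds hx))
    let e : E ≃L[ℂ] (Fin (Module.finrank ℂ E) → ℂ) :=
      ContinuousLinearEquiv.ofFinrankEq (Module.finrank_fin_fun ℂ).symm
    have he : ∀ v, ContMDiffAt 𝓘(ℂ, E) 𝓘(ℂ, Fin (Module.finrank ℂ E) → ℂ) ω e v := fun v ↦
      e.contDiff.contMDiff v
    refine ⟨V, fun y hy ↦ (hV y hy).2, hVo, hxV, Module.finrank ℂ E, e ∘ φ,
      fun y hy ↦ ((he _).comp y (hV y hy).1.1).contMDiffWithinAt, fun y hy ↦ ?_⟩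
    obtain ⟨⟨h1, h2, h3⟩, -⟩ := hV y hy
    have hd : modelDeriv ℂ F (Fin (Module.finrank ℂ E) → ℂ) (e ∘ φ) y =
        (e : E →L[ℂ] _).comp (modelDeriv ℂ F E φ y) := by
      rw [modelDeriv_comp ((he _).mdifferentiableAt (by simp)) (h1.mdifferentiableAt (by simp))]
      congr 1
      exact modelDeriv_clm (e : E →L[ℂ] (Fin (Module.finrank ℂ E) → ℂ)) _
    have hs : Function.Surjective (modelDeriv ℂ F (Fin (Module.finrank ℂ E) → ℂ) (e ∘ φ) y) := by
      rw [hd]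
      exact e.surjective.comp h2
    refine ⟨hs, complexKernel_eq_ker (modelDeriv ℂ F (Fin (Module.finrank ℂ E) → ℂ) (e ∘ φ) y)
      fun u ↦ ?_⟩
    rw [hd, h3]
    exact (map_eq_zero_iff e e.injective).symm

end KernelFoliation

/-! ### The bi-Lagrangian structure of a model -/

section CanonicalStructure

variable {E : Type*} [NormedAddCommGroup E] [NormedSpace ℂ E]
  {N : Type*} [TopologicalSpace N] [ChartedSpace E N] [IsManifold 𝓘(ℂ, E) ω N]
  {F : Type*} [NormedAddCommGroup F] [NormedSpace ℂ F]
  {M : Type*} [TopologicalSpace M] [ChartedSpace F M]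
  {K : RealAnalyticKahlerStructure E N} {f : N → M} {z w : M → N} {b β : BilinField ℂ F M}

lemma isLocallyHolomorphicKernel_fst {U : Set M} (h : ∀ x ∈ U, IsModelAt K f z w b β x) :
    IsLocallyHolomorphicKernel E F z U := by
  intro x hx
  obtain ⟨φ, hφ⟩ := (h x hx).coord
  refine ⟨fun y ↦ (φ y).1, hφ.mono fun y hy ↦ ?_⟩
  obtain ⟨h1, h2, h3⟩ := hy
  have hL : ∀ v, ContMDiffAt 𝓘(ℂ, E × E) 𝓘(ℂ, E) ω (ContinuousLinearMap.fst ℂ E E) v := fun v ↦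
    (ContinuousLinearMap.fst ℂ E E).contDiff.contMDiff v
  have hd : modelDeriv ℂ F E (fun y ↦ (φ y).1) y =
      (ContinuousLinearMap.fst ℂ E E).comp (modelDeriv ℂ F (E × E) φ y) := by
    rw [← modelDeriv_clm (ContinuousLinearMap.fst ℂ E E) (φ y)]
    exact modelDeriv_comp ((hL _).mdifferentiableAt (by simp)) (h1.mdifferentiableAt (by simp))
  refine ⟨(hL _).comp y h1, ?_, fun u ↦ ?_⟩
  · rw [hd]
    exact Prod.fst_surjective.comp h2.2
  · rw [hd]
    exact (h3 u).1

lemma isLocallyHolomorphicKernel_snd {U : Set M} (h : ∀ x ∈ U, IsModelAt K f z w b β x) :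
    IsLocallyHolomorphicKernel E F w U := by
  intro x hx
  obtain ⟨φ, hφ⟩ := (h x hx).coord
  refine ⟨fun y ↦ (φ y).2, hφ.mono fun y hy ↦ ?_⟩
  obtain ⟨h1, h2, h3⟩ := hy
  have hL : ∀ v, ContMDiffAt 𝓘(ℂ, E × E) 𝓘(ℂ, E) ω (ContinuousLinearMap.snd ℂ E E) v := fun v ↦
    (ContinuousLinearMap.snd ℂ E E).contDiff.contMDiff v
  have hd : modelDeriv ℂ F E (fun y ↦ (φ y).2) y =
      (ContinuousLinearMap.snd ℂ E E).comp (modelDeriv ℂ F (E × E) φ y) := by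
    rw [← modelDeriv_clm (ContinuousLinearMap.snd ℂ E E) (φ y)]
    exact modelDeriv_comp ((hL _).mdifferentiableAt (by simp)) (h1.mdifferentiableAt (by simp))
  refine ⟨(hL _).comp y h1, ?_, fun u ↦ ?_⟩
  · rw [hd]
    exact Prod.snd_surjective.comp h2.2
  · rw [hd]
    exact (h3 u).2

lemma IsModelAt.finrank_eq [FiniteDimensional ℂ E] {x : M} (h : IsModelAt K f z w b β x) :
    Module.finrank ℂ F = 2 * Module.finrank ℂ E := by
  obtain ⟨φ, hφ⟩ := h.coord
  rw [(LinearEquiv.ofBijective (modelDeriv ℂ F (E × E) φ x).toLinearMap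
    hφ.self_of_nhds.2.1).finrank_eq, Module.finrank_prod, two_mul]

/-- Bijectivity of `(dz, dw)` provides `u₁` with `dz u₁ = 0` and `dw u₁ = dw u`. -/
lemma IsModelAt.exists_add_eq {x : M} (h : IsModelAt K f z w b β x) (u : F) :
    ∃ u₁ u₂, modelDeriv ℝ F E z x u₁ = 0 ∧ modelDeriv ℝ F E w x u₂ = 0 ∧ u₁ + u₂ = u := by
  obtain ⟨u₁, hu₁⟩ := h.bijective.2 (0, modelDeriv ℝ F E w x u)
  obtain ⟨h1, h2⟩ := Prod.mk.inj hu₁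
  exact ⟨u₁, u - u₁, h1, by rw [map_sub, h2, sub_self], add_sub_cancel _ _⟩

lemma IsModelAt.isCompl_complexKernel {U : Set M} (h : ∀ x ∈ U, IsModelAt K f z w b β x) {x : M}
    (hx : x ∈ U) : IsCompl (complexKernel E F z x) (complexKernel E F w x) := by
  constructor
  · rw [Submodule.disjoint_def]
    intro u hu hu'
    apply (h x hx).bijective.1
    simp only [map_zero, hu.1, hu'.1]
  · rw [codisjoint_iff, Submodule.eq_top_iff']
    intro u
    obtain ⟨u₁, u₂, h1, h2, rfl⟩ := (h x hx).exists_add_eq u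
    exact Submodule.add_mem_sup
      (((isLocallyHolomorphicKernel_fst h).mem_complexKernel_iff hx).2 h1)
      (((isLocallyHolomorphicKernel_snd h).mem_complexKernel_iff hx).2 h2)

/-- As `F (u₁ + u₂) = u₁ - u₂`, this is the defining relation `ω(u, v) = g(F u, v)` for `g = -i b`.
-/
lemma IsModelAt.form_add_apply {x : M} (h : IsModelAt K f z w b β x) {u₁ u₂ : F}
    (h1 : modelDeriv ℝ F E z x u₁ = 0) (h2 : modelDeriv ℝ F E w x u₂ = 0) (v : F) :
    β x (u₁ + u₂) v = -Complex.I * b x (u₁ - u₂) v := by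
  have h4 : β x (u₁ + u₂) v = β x u₁ v + β x u₂ v :=
    ContinuousLinearMap.map_add₂ (β x : F →L[ℂ] F →L[ℂ] ℂ) u₁ u₂ v
  have h5 : b x (u₁ - u₂) v = b x u₁ v - b x u₂ v :=
    ContinuousLinearMap.map_sub₂ (b x : F →L[ℂ] F →L[ℂ] ℂ) u₁ u₂ v
  rw [h4, h5, h.form_eq_z _ _ h1, h.form_eq_w _ _ h2]
  ring

/-- By `form_add_apply`, `u₁ - u₂` is in the kernel of `b`, so `u₁ = u₂` lies in `ker dz ∩ ker dw =
0`. -/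
lemma IsModelAt.form_nondegenerate {x : M} (h : IsModelAt K f z w b β x) (u : F)
    (hu : ∀ v : F, β x u v = 0) : u = 0 := by
  obtain ⟨u₁, u₂, h1, h2, rfl⟩ := h.exists_add_eq u
  have h3 : u₁ - u₂ = 0 := by
    refine h.metric_nondegenerate _ fun v ↦ ?_
    have h4 := h.form_add_apply h1 h2 v
    rw [hu, zero_eq_mul] at h4
    exact h4.resolve_left (neg_ne_zero.2 Complex.I_ne_zero)
  rw [sub_eq_zero] at h3
  subst h3
  have h7 : u₁ = 0 := by
    apply h.bijective.1
    simp only [map_zero, h1, h2]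
  rw [h7, add_zero]

variable [FiniteDimensional ℂ E] [FiniteDimensional ℂ F] [IsManifold 𝓘(ℂ, F) ω M] {U : Set M}

/-- The complex bi-Lagrangian structure given by a model of the complexified Kähler structure. -/
def canonicalBiLagrangian (hU : IsOpen U) (h : ∀ x ∈ U, IsModelAt K f z w b β x) :
    ComplexBiLagrangian F U where
  form := β
  fol₁ := kernelFoliation hU (isLocallyHolomorphicKernel_fst h)
  fol₂ := kernelFoliation hU (isLocallyHolomorphicKernel_snd h)
  symplectic :=
    { holomorphic := isAnalyticOn_form_of_isModelAt hU h
      alt := fun x hx ↦ (h x hx).form_alt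
      nondegenerate := fun x hx ↦ (h x hx).form_nondegenerate
      closed := fun x₀ y hy hyU u v t ↦ by
        have h1 := (h _ hyU).form_closed x₀ ((chartAt F x₀).map_target hy) u v t
        rwa [(chartAt F x₀).right_inv hy] at h1 }
  lagrangian₁ := fun x hx ↦ by
    refine ⟨fun u hu v hv ↦ (h x hx).isotropic_z u v hu.1 hv.1, ?_⟩
    have h1 := (isLocallyHolomorphicKernel_fst h).finrank_add hx
    have h2 := (h x hx).finrank_eq
    change 2 * Module.finrank ℂ (complexKernel E F z x) = Module.finrank ℂ F
    omega
  lagrangian₂ := fun x hx ↦ by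
    refine ⟨fun u hu v hv ↦ (h x hx).isotropic_w u v hu.1 hv.1, ?_⟩
    have h1 := (isLocallyHolomorphicKernel_snd h).finrank_add hx
    have h2 := (h x hx).finrank_eq
    change 2 * Module.finrank ℂ (complexKernel E F w x) = Module.finrank ℂ F
    omega
  transverse := fun x hx ↦ IsModelAt.isCompl_complexKernel h hx

lemma isCanonicalPair_canonicalBiLagrangian (hU : IsOpen U) (hfU : range f ⊆ U)
    (hinj : InjOn (fun x ↦ (z x, w x)) U) (h : ∀ x ∈ U, IsModelAt K f z w b β x) :
    IsCanonicalPair (E := E) f (canonicalBiLagrangian hU h).fol₁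
      (canonicalBiLagrangian hU h).fol₂ := by
  refine ⟨z, w, ⟨fun x hx ↦ (h x hx).z_holomorphic.contMDiffWithinAt,
    ⟨fun x hx ↦ (h x hx).w_analytic.contMDiffWithinAt, fun x hx ↦ (h x hx).w_anti⟩, hinj, ?_,
    fun x hx ↦ (h x hx).bijective, fun p ↦ (h _ (hfU ⟨p, rfl⟩)).diagonal p rfl⟩, fun x hx ↦
    ⟨fun u ↦ (isLocallyHolomorphicKernel_fst h).mem_complexKernel_iff hx,
      fun u ↦ (isLocallyHolomorphicKernel_snd h).mem_complexKernel_iff hx⟩⟩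
  rw [isOpen_iff_mem_nhds]
  rintro _ ⟨x, hx, rfl⟩
  exact (h x hx).nhds_le (Filter.image_mem_map (hU.mem_nhds hx))

lemma isMetric_canonicalBiLagrangian (hU : IsOpen U) (h : ∀ x ∈ U, IsModelAt K f z w b β x) :
    (canonicalBiLagrangian hU h).IsMetric fun x ↦ -Complex.I • b x := by
  refine ⟨⟨(BilinField.isAnalyticOn_iff hU).2 fun x hx ↦ ?_, fun x hx u v ↦ ?_, fun x hx u hu ↦ ?_⟩,
    fun x hx u v ↦ ?_⟩
  · have h1 : BilinField.inChart (𝕜 := ℂ) (fun x ↦ -Complex.I • b x : BilinField ℂ F M) x =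
        fun y ↦ -Complex.I • b.inChart x y := by
      funext y
      rfl
    rw [h1]
    exact (h x hx).metric_analytic.const_smul _
  · exact congrArg (fun c ↦ -Complex.I • c) ((h x hx).metric_symm u v)
  · refine (h x hx).metric_nondegenerate u fun v ↦ ?_
    exact (smul_eq_zero.1 (hu v)).resolve_left (neg_ne_zero.2 Complex.I_ne_zero)
  · obtain ⟨u₁, u₂, h1, h2, rfl⟩ := (h x hx).exists_add_eq u
    have e1 := ((canonicalBiLagrangian hU h).mem_fol₁_iff hx u₁).1
      (((isLocallyHolomorphicKernel_fst h).mem_complexKernel_iff hx).2 h1)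
    have e2 := ((canonicalBiLagrangian hU h).mem_fol₂_iff hx u₂).1
      (((isLocallyHolomorphicKernel_snd h).mem_complexKernel_iff hx).2 h2)
    have e3 : (canonicalBiLagrangian hU h).paraComplex x hx (u₁ + u₂) = u₁ - u₂ := by
      refine (map_add _ _ _).trans ?_
      rw [e1, e2]
      exact (sub_eq_add_neg u₁ u₂).symm
    rw [e3]
    exact (h x hx).form_add_apply h1 h2 v

omit [IsManifold 𝓘(ℂ, E) ω N] in
/-- Holomorphic extensions are unique on connected neighbourhoods. -/
lemma IsHolomorphicExtension.eqOn [Nonempty N]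
    (hf : IsComplexification E F f) (hU : IsOpen U)
    (hc : IsPreconnected U) (hfU : range f ⊆ U) {T : BilinField ℝ E N} {Tc Tc' : BilinField ℂ F M}
    (h : IsHolomorphicExtension f U T Tc) (h' : IsHolomorphicExtension f U T Tc') :
    ∀ x ∈ U, Tc x = Tc' x := by
  obtain ⟨p⟩ := ‹Nonempty N›
  have hp : f p ∈ U := hfU ⟨p, rfl⟩
  exact BilinField.eq_of_eventually_eq hU hc h.1 h'.1 hp (hf.eventually_bilinField_eq p hU hU hp hp
    h.1 h'.1 (Filter.Eventually.of_forall fun q u v ↦ (h.2 q u v).trans (h'.2 q u v).symm))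

end CanonicalStructure

end

/-! ### Existence and uniqueness on small connected neighbourhoods -/

theorem mainTheorem1
    {E : Type*} [NormedAddCommGroup E] [NormedSpace ℂ E] [FiniteDimensional ℂ E]
    {N : Type*} [TopologicalSpace N] [ChartedSpace E N] [IsManifold 𝓘(ℂ, E) ω N]
    [ConnectedSpace N]
    {F : Type*} [NormedAddCommGroup F] [NormedSpace ℂ F] [FiniteDimensional ℂ F]
    {M : Type*} [TopologicalSpace M] [T2Space M] [SecondCountableTopology M]
    [ChartedSpace F M] [IsManifold 𝓘(ℂ, F) ω M]
    (K : RealAnalyticKahlerStructure E N) (f : N → M) (hf : IsComplexification E F f) :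
    ∃ U₀ : Set M, IsOpen U₀ ∧ IsConnected U₀ ∧ range f ⊆ U₀ ∧
      ∀ U : Set M, IsOpen U → IsConnected U → range f ⊆ U → U ⊆ U₀ →
        ∃ S : ComplexBiLagrangian F U,
          (IsHolomorphicExtension f U K.form S.form ∧
            IsCanonicalPair (E := E) f S.fol₁ S.fol₂ ∧
            ∃ g₀c : BilinField ℂ F M, IsHolomorphicExtension f U K.metric.inner g₀c ∧
              S.IsMetric fun x ↦ -Complex.I • g₀c x) ∧
          ∀ S' : ComplexBiLagrangian F U,
            (IsHolomorphicExtension f U K.form S'.form ∧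
              IsCanonicalPair (E := E) f S'.fol₁ S'.fol₂ ∧
              ∃ g₀c : BilinField ℂ F M, IsHolomorphicExtension f U K.metric.inner g₀c ∧
                S'.IsMetric fun x ↦ -Complex.I • g₀c x) →
            S'.Same S := by
  obtain ⟨z, w, b, β, W, hWo, hfW, hinj, hmod⟩ := hf.exists_model K
  have p₀ : N := Classical.arbitrary N
  have : LocallyConnectedSpace M := ChartedSpace.locallyConnectedSpace F M
  have hconn : IsPreconnected (range f) := isPreconnected_range hf.isEmbedding.continuous
  -- As `N` is connected, `f(N)` lies in one component of the domain `W` of the model, and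
  -- components of open sets are open because `M` is locally connected.
  refine ⟨connectedComponentIn W (f p₀), hWo.connectedComponentIn,
    isConnected_connectedComponentIn_iff.2 (hfW ⟨p₀, rfl⟩),
    hconn.subset_connectedComponentIn ⟨p₀, rfl⟩ hfW, fun U hU hUc hfU hUW ↦ ?_⟩
  have hUW' : U ⊆ W := hUW.trans (connectedComponentIn_subset _ _)
  have h : ∀ x ∈ U, IsModelAt K f z w b β x := fun x hx ↦ hmod x (hUW' hx)
  have hform : IsHolomorphicExtension f U K.form β :=
    ⟨isAnalyticOn_form_of_isModelAt hU h, fun p ↦ (h _ (hfU ⟨p, rfl⟩)).form_extends p rfl⟩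
  have hmetric : IsHolomorphicExtension f U K.metric.inner b :=
    ⟨isAnalyticOn_metric_of_isModelAt hU h, fun p ↦ (h _ (hfU ⟨p, rfl⟩)).metric_extends p rfl⟩
  refine ⟨canonicalBiLagrangian hU h, ⟨hform, isCanonicalPair_canonicalBiLagrangian hU hfU
    (hinj.mono hUW') h, b, hmetric, isMetric_canonicalBiLagrangian hU h⟩, ?_⟩
  -- The identity theorem on `U` identifies the two forms and the two metric extensions, and these
  -- determine the foliations.
  rintro S' ⟨hform', -, g, hg, hgm⟩
  refine ComplexBiLagrangian.same_of_isMetric (isMetric_canonicalBiLagrangian hU h) hgm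
    (hform'.eqOn hf hU hUc.isPreconnected hfU hform) fun x hx ↦ ?_
  rw [hg.eqOn hf hU hUc.isPreconnected hfU hmetric x hx]
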